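/- **Lemma (1-approximate kernel for Edge-Disjoint Triangle Packing).** An *edge-disjoint triangle packing* of a finite simple graph $G$ is a family $S$ of $3$-element subsets of $V(G)$, each inducing a triangle in $G$, such that no two distinct members of $S$ share an edge. A *solution* for $G$ is a list (without repetitions) of the members of such a family, and its value is $|S|$. For a parameter $k\in\mathbb N=\{0,1,2,\dots\}$ put $$\mathrm{ETP}^{\bot}(G,k,S)=\min\{|S|,\,k+1\},\qquad \mathrm{OPT}(G,k)=\max_{S}\mathrm{ETP}^{\bot}(G,k,S),$$ the maximum being over all edge-disjoint triangle packings $S$ of $G$ (this is *Edge-Disjoint Triangle Packing parameterized by solution size*). Then this problem has a $1$-approximate kernel with $4k$ vertices. That is, there are two algorithms: 1. a *reduction algorithm* that, given $(G,k)$, computes in time polynomial in $|G|+k$ a pair $(G',k')$ with $|V(G')|\le 4k$ and $k'\le 4k$; 2. a *solution-lifting algorithm* that, given $(G,k)$, the pair $(G',k')$ computed from it by the reduction algorithm, and any solution $S'$ for $G'$, computes in time polynomial in $|G|+|G'|+k+k'+|S'|$ a solution $S$ for $G$ such that $$\frac{\mathrm{ETP}^{\bot}(G,k,S)}{\mathrm{OPT}(G,k)}\;\ge\;\frac{\mathrm{ETP}^{\bot}(G',k',S')}{\mathrm{OPT}(G',k')},$$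 where $\frac00$ is read as $1$. Here $|G|$, $|G'|$ and $|S'|$ in the time bounds denote the lengths of the encodings, graphs being given by their adjacency matrices and solutions by lists of triples of vertices. -/

import Mathlib

/-! ### A random access machine with a step count

Programs work on finitely many variables and finitely many arrays, all holding natural
numbers.  The only arithmetic is addition and truncated subtraction, so that the bit length of a
number grows by at most one per operation, and charging one step per elementary operation gives
the usual notion of polynomial time. -/

namespace RAM

/-- The contents of the memory, and the word written to the output so far. -/
structure Store where
  var : ℕ → ℕ
  arr : ℕ → ℕ → ℕ
  out : List ℕ

/-- Expressions; `get a e` is the entry of array `a` at the index given by `e`. -/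
inductive Expr where
  | const (c : ℕ)
  | var (x : ℕ)
  | get (a : ℕ) (e : Expr)
  | add (e₁ e₂ : Expr)
  | sub (e₁ e₂ : Expr)

namespace Expr

def eval (σ : Store) : Expr → ℕ
  | const c => c
  | var x => σ.var x
  | get a e => σ.arr a (e.eval σ)
  | add e₁ e₂ => e₁.eval σ + e₂.eval σ
  | sub e₁ e₂ => e₁.eval σ - e₂.eval σ

/-- One step per elementary operation. -/
def cost : Expr → ℕ
  | const _ => 1
  | var _ => 1
  | get _ e => e.cost + 1
  | add e₁ e₂ => e₁.cost + e₂.cost + 1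
  | sub e₁ e₂ => e₁.cost + e₂.cost + 1

end Expr

/-- Programs.  `put a i e` writes `e` into array `a` at index `i`, `emit e` appends `e` to the
output, `ite` and `loop` (a while loop) regard a nonzero value as true. -/
inductive Prog where
  | skip
  | assign (x : ℕ) (e : Expr)
  | put (a : ℕ) (i e : Expr)
  | emit (e : Expr)
  | seq (c₁ c₂ : Prog)
  | ite (e : Expr) (c₁ c₂ : Prog)
  | loop (e : Expr) (c : Prog)

/-- `Run c σ σ' t`: started in `σ`, the program `c` halts in `σ'` after `t` steps. -/
inductive Run : Prog → Store → Store → ℕ → Prop where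
  | skip (σ : Store) : Run .skip σ σ 1
  | assign (σ : Store) (x : ℕ) (e : Expr) :
      Run (.assign x e) σ { σ with var := Function.update σ.var x (e.eval σ) } (e.cost + 1)
  | put (σ : Store) (a : ℕ) (i e : Expr) :
      Run (.put a i e) σ
        { σ with
          arr := Function.update σ.arr a (Function.update (σ.arr a) (i.eval σ) (e.eval σ)) }
        (i.cost + e.cost + 1)
  | emit (σ : Store) (e : Expr) :
      Run (.emit e) σ { σ with out := σ.out ++ [e.eval σ] } (e.cost + 1)
  | seq {σ₁ σ₂ σ₃ : Store} {c₁ c₂ : Prog} {t₁ t₂ : ℕ} (h₁ : Run c₁ σ₁ σ₂ t₁)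
      (h₂ : Run c₂ σ₂ σ₃ t₂) : Run (.seq c₁ c₂) σ₁ σ₃ (t₁ + t₂)
  | iteTrue {σ₁ σ₂ : Store} {e : Expr} {c₁ c₂ : Prog} {t : ℕ} (he : e.eval σ₁ ≠ 0)
      (h : Run c₁ σ₁ σ₂ t) : Run (.ite e c₁ c₂) σ₁ σ₂ (e.cost + t)
  | iteFalse {σ₁ σ₂ : Store} {e : Expr} {c₁ c₂ : Prog} {t : ℕ} (he : e.eval σ₁ = 0)
      (h : Run c₂ σ₁ σ₂ t) : Run (.ite e c₁ c₂) σ₁ σ₂ (e.cost + t)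
  | loopDone {σ : Store} {e : Expr} {c : Prog} (he : e.eval σ = 0) :
      Run (.loop e c) σ σ e.cost
  | loopStep {σ₁ σ₂ σ₃ : Store} {e : Expr} {c : Prog} {t₁ t₂ : ℕ} (he : e.eval σ₁ ≠ 0)
      (h₁ : Run c σ₁ σ₂ t₁) (h₂ : Run (.loop e c) σ₂ σ₃ t₂) :
      Run (.loop e c) σ₁ σ₃ (e.cost + t₁ + t₂)

/-- The initial memory for a list of input words: array `i` holds the `i`-th word and variable
`i` its length; everything else is zero, and the output is empty. -/
def init (ws : List (List ℕ)) : Store where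
  var i := (ws.getD i []).length
  arr i j := (ws.getD i []).getD j 0
  out := []

/-- On the input words `ws` the program halts with output `o` after at most `T` steps. -/
def OutputsWithin (c : Prog) (ws : List (List ℕ)) (o : List ℕ) (T : ℕ) : Prop :=
  ∃ σ t, Run c (init ws) σ t ∧ σ.out = o ∧ t ≤ T

/-- The length of a word of natural numbers written in binary, with a separator after each
number. -/
def wordSize (w : List ℕ) : ℕ := (w.map fun a => a.size + 1).sum

end RAM

/-! ### Maximization problems and approximate kernels -/

/-- A maximization problem.  Instances and candidate solutions are given to algorithms as words;
a candidate solution that is not feasible has value `⊥ = -∞`. -/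
structure MaxProblem where
  Inst : Type
  Sol : Type
  encInst : Inst → List ℕ
  encInst_injective : Function.Injective encInst
  encSol : Sol → List ℕ
  encSol_injective : Function.Injective encSol
  value : Inst → Sol → EReal

/-- A parameterized maximization problem; the value may depend on the parameter. -/
structure ParamMaxProblem where
  Inst : Type
  Sol : Type
  encInst : Inst → List ℕ
  encInst_injective : Function.Injective encInst
  encSol : Sol → List ℕ
  encSol_injective : Function.Injective encSol
  value : Inst → ℕ → Sol → EReal

/-- The parameterization by solution size: `(I, k, s) ↦ min (P (I, s)) (k + 1)`. -/
noncomputable def MaxProblem.bySolutionSize (P : MaxProblem) : ParamMaxProblem where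
  Inst := P.Inst
  Sol := P.Sol
  encInst := P.encInst
  encInst_injective := P.encInst_injective
  encSol := P.encSol
  encSol_injective := P.encSol_injective
  value I k s := min (P.value I s) ((k : EReal) + 1)

/-- The quotient `v / opt`, with the convention `0 / 0 = 1`. -/
noncomputable def approxRatio (v opt : EReal) : EReal :=
  if v = 0 ∧ opt = 0 then 1 else v / opt

namespace ParamMaxProblem

variable (Q : ParamMaxProblem)

noncomputable def opt (I : Q.Inst) (k : ℕ) : EReal := ⨆ s : Q.Sol, Q.value I k s

/-- `s` is a (feasible) solution to `(I, k)`. -/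
def IsSolution (I : Q.Inst) (k : ℕ) (s : Q.Sol) : Prop := Q.value I k s ≠ ⊥

/-- The bit size of an instance. -/
def instSize (I : Q.Inst) : ℕ := RAM.wordSize (Q.encInst I)

/-- The bit size of a solution. -/
def solSize (s : Q.Sol) : ℕ := RAM.wordSize (Q.encSol s)

/-- The map `reduce` is computed in time polynomial in `|I| + k`. -/
def PolyTimeReduction (reduce : Q.Inst → ℕ → Q.Inst × ℕ) : Prop :=
  ∃ (c : RAM.Prog) (p : Polynomial ℕ), ∀ (I : Q.Inst) (k : ℕ),
    RAM.OutputsWithin c [Q.encInst I, [k]]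
      ((reduce I k).2 :: Q.encInst (reduce I k).1)
      (p.eval (Q.instSize I + k))

/-- Given `(I, k)`, the reduced instance `(I', k')` and a solution `s'` to it, the candidate
solution `lift I k s'` is computed in time polynomial in `|I| + |I'| + k + k' + |s'|`. -/
def PolyTimeLifting (reduce : Q.Inst → ℕ → Q.Inst × ℕ) (lift : Q.Inst → ℕ → Q.Sol → Q.Sol) :
    Prop :=
  ∃ (c : RAM.Prog) (p : Polynomial ℕ), ∀ (I : Q.Inst) (k : ℕ) (I' : Q.Inst) (k' : ℕ) (s' : Q.Sol),
    reduce I k = (I', k') → Q.IsSolution I' k' s' →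
      RAM.OutputsWithin c [Q.encInst I, [k], Q.encInst I', [k'], Q.encSol s']
        (Q.encSol (lift I k s'))
        (p.eval (Q.instSize I + Q.instSize I' + k + k' + Q.solSize s'))

/-- `Q` has an `α`-approximate kernel of size `g`, where the size of an instance is measured by
`size`. -/
def HasApproxKernel (α : ℝ) (size : Q.Inst → ℕ) (g : ℕ → ℕ) : Prop :=
  ∃ (reduce : Q.Inst → ℕ → Q.Inst × ℕ) (lift : Q.Inst → ℕ → Q.Sol → Q.Sol),
    Q.PolyTimeReduction reduce ∧
    Q.PolyTimeLifting reduce lift ∧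
    ∀ (I : Q.Inst) (k : ℕ) (I' : Q.Inst) (k' : ℕ), reduce I k = (I', k') →
      size I' ≤ g k ∧ k' ≤ g k ∧
      ∀ s' : Q.Sol, Q.IsSolution I' k' s' →
        Q.IsSolution I k (lift I k s') ∧
        ((1 / α : ℝ) : EReal) * approxRatio (Q.value I' k' s') (Q.opt I' k') ≤
          approxRatio (Q.value I k (lift I k s')) (Q.opt I k)

end ParamMaxProblem

/-! ### Edge-Disjoint Triangle Packing -/

namespace TrianglePacking

/-- A finite simple graph with vertex set `{0, …, n - 1}`. -/
structure Graph where
  n : ℕ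
  graph : SimpleGraph (Fin n)

/-- `S` is a family of triangles of `G`, no two of which share an edge. -/
def IsPacking (G : Graph) (S : Finset (Finset (Fin G.n))) : Prop :=
  (∀ X ∈ S, G.graph.IsNClique 3 X) ∧
    (S : Set (Finset (Fin G.n))).Pairwise fun X Y => (X ∩ Y : Set (Fin G.n)).Subsingleton

/-- The word of a graph: the number of vertices, followed by the rows of the adjacency matrix. -/
noncomputable def encodeGraph (G : Graph) : List ℕ :=
  open Classical in
  G.n :: List.ofFn fun p : Fin (G.n * G.n) => if G.graph.Adj p.divNat p.modNat then 1 else 0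

theorem encodeGraph_injective : Function.Injective encodeGraph := by
  rintro ⟨n, G⟩ ⟨m, H⟩ h
  simp only [encodeGraph, List.cons.injEq] at h
  obtain ⟨rfl, h⟩ := h
  have h' := List.ofFn_injective h
  congr 1
  ext i j
  have key : ∀ p : Fin (n * n), G.Adj p.divNat p.modNat ↔ H.Adj p.divNat p.modNat := by
    intro p
    have hp := congrFun h' p
    by_cases hG : G.Adj p.divNat p.modNat <;> by_cases hH : H.Adj p.divNat p.modNat <;> simp_all
  have e := finProdFinEquiv.symm_apply_apply (i, j)
  have e1 : (finProdFinEquiv (i, j)).divNat = i := congrArg Prod.fst e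
  have e2 : (finProdFinEquiv (i, j)).modNat = j := congrArg Prod.snd e
  have hk := key (finProdFinEquiv (i, j))
  rwa [e1, e2] at hk

/-- The set of the entries of a triple. -/
def tripleSet (t : ℕ × ℕ × ℕ) : Finset ℕ := {t.1, t.2.1, t.2.2}

/-- The list `s` of triples lists the members of the family `S`, each exactly once. -/
def IsListing {n : ℕ} (s : List (ℕ × ℕ × ℕ)) (S : Finset (Finset (Fin n))) : Prop :=
  (s.map tripleSet).Nodup ∧
    (s.map tripleSet).toFinset = S.image fun X => X.map Fin.valEmbedding

/-- The word of a list of triples. -/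
def encodeTriples (s : List (ℕ × ℕ × ℕ)) : List ℕ := s.flatMap fun t => [t.1, t.2.1, t.2.2]

theorem encodeTriples_injective : Function.Injective encodeTriples := by
  intro s
  induction s with
  | nil => intro s' h; cases s' with
    | nil => rfl
    | cons b s' => simp [encodeTriples] at h
  | cons a s ih => intro s' h; cases s' with
    | nil => simp [encodeTriples] at h
    | cons b s' =>
      simp only [encodeTriples, List.flatMap_cons, List.cons_append, List.nil_append,
        List.cons.injEq] at h
      obtain ⟨h1, h2, h3, h4⟩ := h
      rw [ih h4, Prod.ext h1 (Prod.ext h2 h3)]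

/-- The problem to find a largest edge-disjoint triangle packing of a graph.  A candidate solution
is a list of triples; it is feasible if it lists an edge-disjoint triangle packing, and then its
value is the number of triangles, which is the length of the list. -/
noncomputable def problem : MaxProblem where
  Inst := Graph
  Sol := List (ℕ × ℕ × ℕ)
  encInst := encodeGraph
  encInst_injective := encodeGraph_injective
  encSol := encodeTriples
  encSol_injective := encodeTriples_injective
  value G s :=
    open Classical in
    if ∃ S : Finset (Finset (Fin G.n)), IsPacking G S ∧ IsListing s S then (s.length : EReal) else ⊥

end TrianglePacking

/-! Keep an edge-disjoint triangle packing P of G, n = |V(G)|, and let the vertices outside V(P) bid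
for the edges of P that form triangles with them. Such a vertex owning nothing takes a cheapest
packed edge among its neighbours, evicts the previous owner and raises the price by one. If two
edges of one packed triangle are owned, that triangle gives way to the two triangles formed by these
edges and their owners; if some triangle shares no edge with P, it is added. Either change enlarges
P and restarts the auction. Prices are capped at n² + 1, so a potential dominated by the size of P
allows fewer than (n² + 1)³ improvements (`Rep.search`).

When nothing is possible any more, pigeonhole gives a level l ≤ n² + 1 that is not a price
(`exists_level`). The edges of price above l, each with its owner, form the crown. An owner pays at
most one more than the price of any packed edge among its neighbours, and a vertex outside P owning
nothing sees only prices at the cap. Hence a vertex that is a crown owner, or lies outside P and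
owns nothing, sees only prices ≥ l, thus > l. Every triangle of G has a packed edge, so a triangle
without expensive edges avoids all these vertices (`Valid.kept_of_price_le`). The kernel is the
graph on the kept vertices without the expensive edges.

Deleting from a packing of G the triangles with an expensive edge costs at most |crown| triangles
and leaves a packing of the kernel (`Valid.exists_residual`). Conversely the crown can be added to
every packing of the kernel (`Valid.isPackingList_append_crown`). So lifting means adding the crown;
the value and the optimum shift by the same amount, which does not lower the ratio, even after
truncation at k + 1 (`approxRatio_lift_le`).

A packed triangle contributes three vertices and at most one owner, whence 4|P| kept vertices
(`Valid.card_kept_le`). If |P| > k the kernel is empty and P itself, of truncated value k + 1, is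
the lifted solution. In all cases k' = k.

For the running time the algorithms are written with loops bounded by input data; `run_compile`
turns such a program into a machine program with a polynomial step bound. The lifting program
recomputes the auction from (G, k). -/

namespace RAM

/-! ### Structured programs with bounded loops -/

def Store.set (σ : Store) (x v : ℕ) : Store := { σ with var := Function.update σ.var x v }

@[simp] theorem Store.set_arr (σ : Store) (x v : ℕ) : (σ.set x v).arr = σ.arr := rfl

@[simp] theorem Store.set_out (σ : Store) (x v : ℕ) : (σ.set x v).out = σ.out := rfl

theorem Store.set_var (σ : Store) (x v y : ℕ) :
    (σ.set x v).var y = if y = x then v else σ.var y := by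
  simp [Store.set, Function.update_apply]

/-- The numbers of iterations of bounded loops: the first entry of the first input word, the length
of the first input word, or the length of the fifth input word. -/
inductive Bound where
  | head
  | first
  | fifth

namespace Bound

def toExpr : Bound → Expr
  | head => .get 0 (.const 0)
  | first => .var 0
  | fifth => .var 4

def eval (σ : Store) (b : Bound) : ℕ := b.toExpr.eval σ

@[simp] theorem eval_head (σ : Store) : eval σ head = σ.arr 0 0 := rfl
@[simp] theorem eval_first (σ : Store) : eval σ first = σ.var 0 := rfl
@[simp] theorem eval_fifth (σ : Store) : eval σ fifth = σ.var 4 := rfl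

end Bound

/-- Programs all of whose loops are bounded: `rep x b c` runs `c` for `x = 0, …, b - 1`. -/
inductive Code where
  | skip
  | assign (x : ℕ) (e : Expr)
  | put (a : ℕ) (i e : Expr)
  | emit (e : Expr)
  | seq (c₁ c₂ : Code)
  | ite (e : Expr) (c₁ c₂ : Code)
  | rep (x : ℕ) (b : Bound) (c : Code)

namespace Code

infixr:60 " ;; " => Code.seq

def compile : Code → Prog
  | skip => .skip
  | assign x e => .assign x e
  | put a i e => .put a i e
  | emit e => .emit e
  | seq c₁ c₂ => .seq c₁.compile c₂.compile
  | ite e c₁ c₂ => .ite e c₁.compile c₂.compile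
  -- The truncated difference of bound and counter is nonzero exactly while the counter is below the
  -- bound. The bound is read again in every pass.
  | rep x b c => .seq (.assign x (.const 0))
      (.loop (.sub b.toExpr (.var x)) (.seq c.compile (.assign x (.add (.var x) (.const 1)))))

/-- Total, because the number of passes is fixed on entering a loop. Agreement with `compile`, which
tests the bound in every pass, relies on `wf`. -/
def exec : Code → Store → Store
  | skip, σ => σ
  | assign x e, σ => σ.set x (e.eval σ)
  | put a i e, σ => { σ with
      arr := Function.update σ.arr a (Function.update (σ.arr a) (i.eval σ) (e.eval σ)) }
  | emit e, σ => { σ with out := σ.out ++ [e.eval σ] }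
  | seq c₁ c₂, σ => c₂.exec (c₁.exec σ)
  | ite e c₁ c₂, σ => if e.eval σ ≠ 0 then c₁.exec σ else c₂.exec σ
  | rep x b c, σ =>
      (fun τ => (c.exec τ).set x ((c.exec τ).var x + 1))^[b.eval σ] (σ.set x 0)

/-! ### Frame conditions: what a program leaves unchanged -/

def avoidsVar (x : ℕ) : Code → Bool
  | skip => true
  | assign y _ => x != y
  | put _ _ _ => true
  | emit _ => true
  | seq c₁ c₂ => c₁.avoidsVar x && c₂.avoidsVar x
  | ite _ c₁ c₂ => c₁.avoidsVar x && c₂.avoidsVar x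
  | rep y _ c => x != y && c.avoidsVar x

def avoidsArr (a : ℕ) : Code → Bool
  | skip => true
  | assign _ _ => true
  | put b _ _ => a != b
  | emit _ => true
  | seq c₁ c₂ => c₁.avoidsArr a && c₂.avoidsArr a
  | ite _ c₁ c₂ => c₁.avoidsArr a && c₂.avoidsArr a
  | rep _ _ c => c.avoidsArr a

def silent : Code → Bool
  | skip => true
  | assign _ _ => true
  | put _ _ _ => true
  | emit _ => false
  | seq c₁ c₂ => c₁.silent && c₂.silent
  | ite _ c₁ c₂ => c₁.silent && c₂.silent
  | rep _ _ c => c.silent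

/-- The input words are read-only, and so are the loop variables in the bodies of loops. -/
def wf : Code → Bool
  | skip => true
  | assign x _ => 5 ≤ x
  | put a _ _ => 5 ≤ a
  | emit _ => true
  | seq c₁ c₂ => c₁.wf && c₂.wf
  | ite _ c₁ c₂ => c₁.wf && c₂.wf
  | rep x _ c => 5 ≤ x && c.avoidsVar x && c.wf

/-- Induction over the iterations of a loop. -/
theorem rep_induction {x : ℕ} {b : Bound} {c : Code} {σ : Store} (I : ℕ → Store → Prop)
    (hframe : ∀ τ, (c.exec τ).var x = τ.var x)
    (h₀ : I 0 (σ.set x 0))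
    (hs : ∀ i < b.eval σ, ∀ τ, τ.var x = i → I i τ → I (i + 1) ((c.exec τ).set x (i + 1))) :
    I (b.eval σ) ((rep x b c).exec σ) := by
  have key : ∀ m ≤ b.eval σ,
      ((fun τ => (c.exec τ).set x ((c.exec τ).var x + 1))^[m] (σ.set x 0)).var x = m ∧
      I m ((fun τ => (c.exec τ).set x ((c.exec τ).var x + 1))^[m] (σ.set x 0)) := by
    intro m
    induction m with
    | zero => intro _; exact ⟨by simp [Store.set_var], h₀⟩
    | succ m ih =>
      intro hm
      obtain ⟨h1, h2⟩ := ih (by omega)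
      rw [Function.iterate_succ_apply', hframe, h1]
      exact ⟨by simp [Store.set_var], hs m (by omega) _ h1 h2⟩
  exact (key _ le_rfl).2

theorem exec_var {c : Code} {x : ℕ} (h : c.avoidsVar x = true) (σ : Store) :
    (c.exec σ).var x = σ.var x := by
  induction c generalizing σ with
  | skip => rfl
  | assign y e => simp_all [avoidsVar, exec, Store.set_var]
  | put a i e => rfl
  | emit e => rfl
  | seq c₁ c₂ ih₁ ih₂ =>
    simp only [avoidsVar, Bool.and_eq_true] at h
    rw [exec, ih₂ h.2, ih₁ h.1]
  | ite e c₁ c₂ ih₁ ih₂ =>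
    simp only [avoidsVar, Bool.and_eq_true] at h
    rw [exec]; split_ifs
    exacts [ih₁ h.1 σ, ih₂ h.2 σ]
  | rep y b c ih =>
    simp only [avoidsVar, Bool.and_eq_true, bne_iff_ne] at h
    rw [exec]
    generalize b.eval σ = m
    induction m with
    | zero => simp [Store.set_var, h.1]
    | succ m ihm => rw [Function.iterate_succ_apply', Store.set_var, if_neg h.1, ih h.2, ihm]

theorem exec_arr {c : Code} {a : ℕ} (h : c.avoidsArr a = true) (σ : Store) :
    (c.exec σ).arr a = σ.arr a := by
  induction c generalizing σ with
  | skip => rfl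
  | assign y e => rfl
  | put b i e => simp_all [avoidsArr, exec]
  | emit e => rfl
  | seq c₁ c₂ ih₁ ih₂ =>
    simp only [avoidsArr, Bool.and_eq_true] at h
    rw [exec, ih₂ h.2, ih₁ h.1]
  | ite e c₁ c₂ ih₁ ih₂ =>
    simp only [avoidsArr, Bool.and_eq_true] at h
    rw [exec]; split_ifs
    exacts [ih₁ h.1 σ, ih₂ h.2 σ]
  | rep y b c ih =>
    rw [exec]
    generalize b.eval σ = m
    induction m with
    | zero => rfl
    | succ m ihm => rw [Function.iterate_succ_apply', Store.set_arr, ih h, ihm]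

theorem exec_out {c : Code} (h : c.silent = true) (σ : Store) : (c.exec σ).out = σ.out := by
  induction c generalizing σ with
  | skip => rfl
  | assign y e => rfl
  | put b i e => rfl
  | emit e => simp [silent] at h
  | seq c₁ c₂ ih₁ ih₂ =>
    simp only [silent, Bool.and_eq_true] at h
    rw [exec, ih₂ h.2, ih₁ h.1]
  | ite e c₁ c₂ ih₁ ih₂ =>
    simp only [silent, Bool.and_eq_true] at h
    rw [exec]; split_ifs
    exacts [ih₁ h.1 σ, ih₂ h.2 σ]
  | rep y b c ih =>
    rw [exec]
    generalize b.eval σ = m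
    induction m with
    | zero => rfl
    | succ m ihm => rw [Function.iterate_succ_apply', Store.set_out, ih h, ihm]

theorem avoidsVar_of_wf {c : Code} (h : c.wf = true) {x : ℕ} (hx : x < 5) :
    c.avoidsVar x = true := by
  induction c with
  | assign y e => simp [wf, avoidsVar] at *; omega
  | rep y b c ih => simp [wf, avoidsVar] at *; exact ⟨by omega, ih h.2⟩
  | _ => simp_all [wf, avoidsVar]

theorem avoidsArr_of_wf {c : Code} (h : c.wf = true) {a : ℕ} (ha : a < 5) :
    c.avoidsArr a = true := by
  induction c with
  | put b i e => simp [wf, avoidsArr] at *; omega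
  | rep y b c ih => simp [wf, avoidsArr] at *; exact ih h.2
  | _ => simp_all [wf, avoidsArr]

theorem exec_bound {c : Code} (h : c.wf = true) (b : Bound) (σ : Store) :
    b.eval (c.exec σ) = b.eval σ := by
  cases b with
  | head => simp [exec_arr (avoidsArr_of_wf h (a := 0) (by omega))]
  | first => simp [exec_var (avoidsVar_of_wf h (x := 0) (by omega))]
  | fifth => simp [exec_var (avoidsVar_of_wf h (x := 4) (by omega))]

/-! ### Running times of bounded programs -/

theorem _root_.RAM.Bound.eval_set (b : Bound) {x : ℕ} (hx : 5 ≤ x) (σ : Store) (v : ℕ) :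
    b.eval (σ.set x v) = b.eval σ := by
  cases b <;> simp [Store.set_var] <;> omega

/-- A bound for the running time, as a polynomial in a bound for the numbers of iterations. -/
noncomputable def time : Code → Polynomial ℕ
  | skip => 1
  | assign _ e => Polynomial.C (e.cost + 1)
  | put _ i e => Polynomial.C (i.cost + e.cost + 1)
  | emit e => Polynomial.C (e.cost + 1)
  | seq c₁ c₂ => c₁.time + c₂.time
  | ite e c₁ c₂ => Polynomial.C e.cost + c₁.time + c₂.time
  -- Initialization costs 2 and a test at most 4, giving 6 with the last test; each pass pays 8 for
  -- its test and the increment of the counter.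
  | rep _ _ c => Polynomial.C 6 + Polynomial.X * (c.time + Polynomial.C 8)

/-- A well-formed program never changes the values of the bounds, so one `N` serves for all loops,
nested ones included. -/
theorem run_compile {c : Code} (h : c.wf = true) {N : ℕ} (σ : Store)
    (hN : ∀ b : Bound, b.eval σ ≤ N) :
    ∃ t ≤ c.time.eval N, Run c.compile σ (c.exec σ) t := by
  induction c generalizing σ with
  | skip => exact ⟨1, by simp [time], .skip σ⟩
  | assign x e => exact ⟨_, by simp [time], .assign σ x e⟩
  | put a i e => exact ⟨_, by simp [time], .put σ a i e⟩
  | emit e => exact ⟨_, by simp [time], .emit σ e⟩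
  | seq c₁ c₂ ih₁ ih₂ =>
    simp only [wf, Bool.and_eq_true] at h
    obtain ⟨t₁, ht₁, h₁⟩ := ih₁ h.1 σ hN
    obtain ⟨t₂, ht₂, h₂⟩ := ih₂ h.2 (c₁.exec σ) (fun b => by rw [exec_bound h.1]; exact hN b)
    exact ⟨t₁ + t₂, by simp only [time, Polynomial.eval_add]; omega, .seq h₁ h₂⟩
  | ite e c₁ c₂ ih₁ ih₂ =>
    simp only [wf, Bool.and_eq_true] at h
    rw [exec]
    split_ifs with he
    · obtain ⟨t, ht, hr⟩ := ih₁ h.1 σ hN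
      exact ⟨_, by simp only [time, Polynomial.eval_add, Polynomial.eval_C]; omega,
        .iteTrue he hr⟩
    · obtain ⟨t, ht, hr⟩ := ih₂ h.2 σ hN
      exact ⟨_, by simp only [time, Polynomial.eval_add, Polynomial.eval_C]; omega,
        .iteFalse (not_not.1 he) hr⟩
  | rep x b c ih =>
    simp only [wf, Bool.and_eq_true, decide_eq_true_eq] at h
    obtain ⟨⟨hx, hc⟩, hw⟩ := h
    have hcost : (Expr.sub b.toExpr (.var x)).cost ≤ 4 := by
      cases b <;> simp [Expr.cost, Bound.toExpr]
    -- Invariant: the counter plus the number `m` of passes still to be made equals the bound.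
    have key : ∀ m, ∀ τ : Store, (∀ b : Bound, b.eval τ = b.eval σ) → τ.var x + m = b.eval σ →
        ∃ t ≤ m * (c.time.eval N + 8) + 4,
          Run (.loop (.sub b.toExpr (.var x))
            (.seq c.compile (.assign x (.add (.var x) (.const 1))))) τ
            ((fun τ => (c.exec τ).set x ((c.exec τ).var x + 1))^[m] τ) t := by
      intro m
      induction m with
      | zero =>
        intro τ hb hm
        refine ⟨_, by simpa using hcost, .loopDone ?_⟩
        have := hb b
        simp only [Bound.eval] at this hm
        simp only [Expr.eval]
        omega
      | succ m ihm =>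
        intro τ hb hm
        obtain ⟨t, ht, hr⟩ := ih hw τ (fun b => by rw [hb]; exact hN b)
        obtain ⟨t', ht', hr'⟩ := ihm ((c.exec τ).set x ((c.exec τ).var x + 1))
          (fun b => by rw [Bound.eval_set b hx, exec_bound hw, hb])
          (by simp only [Store.set_var, if_true, exec_var hc]; omega)
        rw [Function.iterate_succ_apply]
        refine ⟨_, ?_, .loopStep ?_ (.seq hr (.assign _ _ _)) hr'⟩
        · simp only [Expr.cost] at hcost ⊢
          rw [Nat.succ_mul]
          omega
        · have := hb b
          simp only [Bound.eval] at this hm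
          simp only [Expr.eval]
          omega
    obtain ⟨t, ht, hr⟩ := key (b.eval σ) (σ.set x 0) (fun b => Bound.eval_set b hx σ 0)
      (by simp [Store.set_var])
    refine ⟨2 + t, ?_, .seq (.assign _ _ _) hr⟩
    have := Nat.mul_le_mul_right (c.time.eval N + 8) (hN b)
    simp only [time, Polynomial.eval_add, Polynomial.eval_mul, Polynomial.eval_C,
      Polynomial.eval_X]
    omega

/-! ### Programs that ignore all input words but the first two -/

def _root_.RAM.Expr.ignores : Expr → Bool
  | .const _ => true
  | .var x => x < 2 || 5 ≤ x
  | .get a e => (a < 2 || 5 ≤ a) && e.ignores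
  | .add e₁ e₂ => e₁.ignores && e₂.ignores
  | .sub e₁ e₂ => e₁.ignores && e₂.ignores

def ignores : Code → Bool
  | skip => true
  | assign _ e => e.ignores
  | put _ i e => i.ignores && e.ignores
  | emit e => e.ignores
  | seq c₁ c₂ => c₁.ignores && c₂.ignores
  | ite e c₁ c₂ => e.ignores && c₁.ignores && c₂.ignores
  | rep _ b c => b.toExpr.ignores && c.ignores

/-- The stores agree, except possibly for the output and the third to fifth input word. -/
def _root_.RAM.Store.Agrees (σ τ : Store) : Prop :=
  ∀ x, (x < 2 ∨ 5 ≤ x) → σ.var x = τ.var x ∧ σ.arr x = τ.arr x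

theorem _root_.RAM.Store.Agrees.eval {σ τ : Store} (h : σ.Agrees τ) {e : Expr}
    (he : e.ignores = true) : e.eval σ = e.eval τ := by
  induction e with
  | const c => rfl
  | var x =>
    simp only [Expr.ignores, Bool.or_eq_true, decide_eq_true_eq] at he
    exact (h x he).1
  | get a e ih =>
    simp only [Expr.ignores, Bool.and_eq_true, Bool.or_eq_true, decide_eq_true_eq] at he
    simp only [Expr.eval, ih he.2, (h a he.1).2]
  | add e₁ e₂ ih₁ ih₂ =>
    simp only [Expr.ignores, Bool.and_eq_true] at he
    simp only [Expr.eval, ih₁ he.1, ih₂ he.2]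
  | sub e₁ e₂ ih₁ ih₂ =>
    simp only [Expr.ignores, Bool.and_eq_true] at he
    simp only [Expr.eval, ih₁ he.1, ih₂ he.2]

theorem _root_.RAM.Store.Agrees.set {σ τ : Store} (h : σ.Agrees τ) (x v : ℕ) :
    (σ.set x v).Agrees (τ.set x v) := by
  intro y hy
  simp [Store.set_var, h y hy]

/-- This lets the lifting program, which has three more words in memory, rerun the analysis made by
the reduction and arrive at the same tables. -/
theorem _root_.RAM.Store.Agrees.exec {c : Code} (hw : c.wf = true) (hc : c.ignores = true)
    {σ τ : Store} (h : σ.Agrees τ) : (c.exec σ).Agrees (c.exec τ) := by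
  induction c generalizing σ τ with
  | skip => exact h
  | assign x e => rw [Code.exec, Code.exec, h.eval hc]; exact h.set _ _
  | put a i e =>
    simp only [ignores, Bool.and_eq_true] at hc
    simp only [wf, decide_eq_true_eq] at hw
    intro y hy
    refine ⟨(h y hy).1, ?_⟩
    simp only [Code.exec, h.eval hc.1, h.eval hc.2, Function.update_apply, (h y hy).2,
      (h a (Or.inr hw)).2]
  | emit e => exact h
  | seq c₁ c₂ ih₁ ih₂ =>
    simp only [ignores, wf, Bool.and_eq_true] at hc hw
    exact ih₂ hw.2 hc.2 (ih₁ hw.1 hc.1 h)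
  | ite e c₁ c₂ ih₁ ih₂ =>
    simp only [ignores, wf, Bool.and_eq_true] at hc hw
    simp only [Code.exec, h.eval hc.1.1]
    split_ifs
    exacts [ih₁ hw.1 hc.1.2 h, ih₂ hw.2 hc.2 h]
  | rep x b c ih =>
    simp only [ignores, wf, Bool.and_eq_true, decide_eq_true_eq] at hc hw
    simp only [Code.exec, Bound.eval, h.eval hc.1]
    generalize b.toExpr.eval τ = m
    induction m with
    | zero => exact h.set _ _
    | succ m ihm =>
      have := ih hw.2 hc.2 ihm
      rw [Function.iterate_succ_apply', Function.iterate_succ_apply', (this x (by omega)).1]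
      exact this.set _ _

/-! ### Counting and listing -/

/-- `σ` and `τ` agree except for the output and the variables in `L`. -/
def SameUpTo (L : List ℕ) (σ τ : Store) : Prop := σ.arr = τ.arr ∧ ∀ x ∉ L, σ.var x = τ.var x

theorem SameUpTo.mono {L L' : List ℕ} {σ τ : Store} (h : SameUpTo L σ τ) (hL : L ⊆ L') :
    SameUpTo L' σ τ := ⟨h.1, fun x hx => h.2 x fun h' => hx (hL h')⟩

theorem SameUpTo.set {L : List ℕ} {σ τ : Store} {x : ℕ} (h : SameUpTo (x :: L) σ τ) (v : ℕ) :
    SameUpTo L (σ.set x v) (τ.set x v) := by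
  refine ⟨h.1, fun y hy => ?_⟩
  simp only [Store.set_var]
  split_ifs with hyx
  · rfl
  · exact h.2 y (by simp [hyx, hy])

/-- `c` adds `g` to the variable `f`; it changes no array, and besides `f` only variables in `L`
and not the output. -/
def Counts (c : Code) (f : ℕ) (L : List ℕ) (g : Store → ℕ) : Prop :=
  (∀ σ τ, SameUpTo (f :: L) σ τ → g σ = g τ) ∧
  ∀ σ, SameUpTo (f :: L) (c.exec σ) σ ∧ (c.exec σ).out = σ.out ∧
    (c.exec σ).var f = σ.var f + g σ

/-- `c` appends `g` to the output, and changes nothing else but variables in `L`. -/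
def Lists (c : Code) (L : List ℕ) (g : Store → List ℕ) : Prop :=
  (∀ σ τ, SameUpTo L σ τ → g σ = g τ) ∧
  ∀ σ, SameUpTo L (c.exec σ) σ ∧ (c.exec σ).out = σ.out ++ g σ

def tally (f : ℕ) (e : Expr) : Code :=
  .ite e (.assign f (.add (.var f) (.const 1))) .skip

def _root_.RAM.Expr.reads (x : ℕ) : Expr → Bool
  | .const _ => false
  | .var y => x == y
  | .get _ e => e.reads x
  | .add e₁ e₂ => e₁.reads x || e₂.reads x
  | .sub e₁ e₂ => e₁.reads x || e₂.reads x

theorem SameUpTo.eval {L : List ℕ} {σ τ : Store} (h : SameUpTo L σ τ) {e : Expr}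
    (he : ∀ x ∈ L, e.reads x = false) : e.eval σ = e.eval τ := by
  induction e with
  | const c => rfl
  | var x =>
    refine h.2 x fun hx => ?_
    simpa [Expr.reads] using he x hx
  | get a e ih =>
    simp only [Expr.eval, h.1, ih fun x hx => by simpa [Expr.reads] using he x hx]
  | add e₁ e₂ ih₁ ih₂ =>
    simp only [Expr.reads, Bool.or_eq_false_iff] at he
    simp only [Expr.eval, ih₁ fun x hx => (he x hx).1, ih₂ fun x hx => (he x hx).2]
  | sub e₁ e₂ ih₁ ih₂ =>
    simp only [Expr.reads, Bool.or_eq_false_iff] at he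
    simp only [Expr.eval, ih₁ fun x hx => (he x hx).1, ih₂ fun x hx => (he x hx).2]

theorem counts_tally {f : ℕ} {e : Expr} (he : e.reads f = false) :
    Counts (tally f e) f [] (fun σ => if e.eval σ ≠ 0 then 1 else 0) := by
  refine ⟨fun σ τ h => by beta_reduce; rw [h.eval (by simpa using he)], fun σ => ?_⟩
  simp only [tally, exec]
  split_ifs with h
  · refine ⟨⟨rfl, fun x hx => ?_⟩, rfl, ?_⟩
    · simp only [List.mem_singleton] at hx
      simp [Store.set_var, hx]
    · simp [Store.set_var, Expr.eval]
  · exact ⟨⟨rfl, fun _ _ => rfl⟩, rfl, rfl⟩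

/-- Since `g` depends neither on the sum nor on the counters of inner loops, its value in pass `i`
is the one it has in the initial store with `x` set to `i`. Nested counting loops thus become nested
sums. -/
theorem Counts.rep {c : Code} {f x : ℕ} {L : List ℕ} {g : Store → ℕ} {b : Bound}
    (h : Counts c f L g) (hx : 5 ≤ x) (hxf : x ≠ f) (hxL : x ∉ L) (hf : 5 ≤ f)
    (hL : ∀ y ∈ L, 5 ≤ y) :
    Counts (.rep x b c) f (x :: L)
      (fun σ => ∑ i ∈ Finset.range (b.eval σ), g (σ.set x i)) := by
  have hsub : ∀ {σ τ : Store}, SameUpTo (f :: x :: L) σ τ → SameUpTo (x :: f :: L) σ τ :=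
    fun h => h.mono (by intro y; simp only [List.mem_cons]; tauto)
  constructor
  · intro σ τ hs
    have hb : b.eval σ = b.eval τ := by
      cases b with
      | head => simp [hs.1]
      | first =>
        refine hs.2 0 fun h0 => ?_
        simp only [List.mem_cons] at h0
        rcases h0 with h0 | h0 | h0
        · omega
        · omega
        · exact absurd (hL 0 h0) (by omega)
      | fifth =>
        refine hs.2 4 fun h0 => ?_
        simp only [List.mem_cons] at h0
        rcases h0 with h0 | h0 | h0
        · omega
        · omega
        · exact absurd (hL 4 h0) (by omega)
    simp only [hb]
    exact Finset.sum_congr rfl fun i _ => h.1 _ _ ((hsub hs).set i)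
  · intro σ
    have hframe : ∀ τ : Store, (c.exec τ).var x = τ.var x := fun τ =>
      (h.2 τ).1.2 x (by simp [hxf, hxL])
    rw [exec]
    beta_reduce
    generalize b.eval σ = m
    induction m with
    | zero =>
      refine ⟨⟨rfl, fun y hy => ?_⟩, rfl, ?_⟩
      · simp only [List.mem_cons, not_or] at hy
        simp [Store.set_var, hy.2.1]
      · simp [Store.set_var, hxf.symm]
    | succ m ihm =>
      rw [Function.iterate_succ_apply']
      have hv : ((fun τ => (c.exec τ).set x ((c.exec τ).var x + 1))^[m] (σ.set x 0)).var x = m := by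
        clear ihm
        induction m with
        | zero => simp [Store.set_var]
        | succ m ih => rw [Function.iterate_succ_apply', hframe, ih]; simp [Store.set_var]
      generalize (fun τ => (c.exec τ).set x ((c.exec τ).var x + 1))^[m] (σ.set x 0) = τ at ihm hv
      obtain ⟨ih1, ih2, ih3⟩ := ihm
      obtain ⟨h1, h2, h3⟩ := h.2 τ
      refine ⟨⟨h1.1.trans ih1.1, fun y hy => ?_⟩, h2.trans ih2, ?_⟩
      · simp only [List.mem_cons, not_or] at hy
        rw [Store.set_var, if_neg hy.2.1, h1.2 y (by simp [hy]), ih1.2 y (by simp [hy])]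
      · rw [Store.set_var, if_neg hxf.symm, h3, ih3, Finset.sum_range_succ, add_assoc]
        congr 2
        -- The counter already has the value `m` in the current store, so setting it to `m` there
        -- changes nothing.
        have := h.1 _ _ ((hsub ih1).set m)
        rw [← this]
        congr 1
        simp only [Store.set, ← hv, Function.update_eq_self]

theorem Lists.rep {c : Code} {x : ℕ} {L : List ℕ} {g : Store → List ℕ} {b : Bound}
    (h : Lists c L g) (hx : 5 ≤ x) (hxL : x ∉ L) (hL : ∀ y ∈ L, 5 ≤ y) :
    Lists (.rep x b c) (x :: L)
      (fun σ => (List.range (b.eval σ)).flatMap fun i => g (σ.set x i)) := by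
  constructor
  · intro σ τ hs
    have hb : b.eval σ = b.eval τ := by
      cases b with
      | head => simp [hs.1]
      | first =>
        refine hs.2 0 fun h0 => ?_
        rcases List.mem_cons.1 h0 with h0 | h0
        · omega
        · exact absurd (hL 0 h0) (by omega)
      | fifth =>
        refine hs.2 4 fun h0 => ?_
        rcases List.mem_cons.1 h0 with h0 | h0
        · omega
        · exact absurd (hL 4 h0) (by omega)
    simp only [hb]
    congr 1
    funext i
    exact h.1 _ _ (hs.set i)
  · intro σ
    have hframe : ∀ τ : Store, (c.exec τ).var x = τ.var x := fun τ => (h.2 τ).1.2 x hxL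
    rw [exec]
    beta_reduce
    generalize b.eval σ = m
    induction m with
    | zero =>
      refine ⟨⟨rfl, fun y hy => ?_⟩, by simp⟩
      simp only [List.mem_cons, not_or] at hy
      simp [Store.set_var, hy.1]
    | succ m ihm =>
      rw [Function.iterate_succ_apply']
      have hv : ((fun τ => (c.exec τ).set x ((c.exec τ).var x + 1))^[m] (σ.set x 0)).var x = m := by
        clear ihm
        induction m with
        | zero => simp [Store.set_var]
        | succ m ih => rw [Function.iterate_succ_apply', hframe, ih]; simp [Store.set_var]
      generalize (fun τ => (c.exec τ).set x ((c.exec τ).var x + 1))^[m] (σ.set x 0) = τ at ihm hv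
      obtain ⟨ih1, ih2⟩ := ihm
      obtain ⟨h1, h2⟩ := h.2 τ
      refine ⟨⟨h1.1.trans ih1.1, fun y hy => ?_⟩, ?_⟩
      · simp only [List.mem_cons, not_or] at hy
        rw [Store.set_var, if_neg hy.1, h1.2 y (by simp [hy]), ih1.2 y (by simp [hy])]
      · rw [Store.set_out, h2, ih2, List.range_succ, List.flatMap_append, List.append_assoc]
        congr 2
        have := h.1 _ _ (ih1.set m)
        rw [List.flatMap_singleton, ← this]
        congr 1
        simp only [Store.set, ← hv, Function.update_eq_self]

theorem lists_emit {e : Expr} : Lists (.emit e) [] (fun σ => [e.eval σ]) :=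
  ⟨fun σ τ h => by beta_reduce; rw [h.eval (by simp)], fun _ => ⟨⟨rfl, fun _ _ => rfl⟩, rfl⟩⟩

theorem Lists.seq {c₁ c₂ : Code} {L : List ℕ} {g₁ g₂ : Store → List ℕ} (h₁ : Lists c₁ L g₁)
    (h₂ : Lists c₂ L g₂) : Lists (.seq c₁ c₂) L (fun σ => g₁ σ ++ g₂ σ) := by
  refine ⟨fun σ τ h => by beta_reduce; rw [h₁.1 σ τ h, h₂.1 σ τ h], fun σ => ?_⟩
  obtain ⟨a1, a2⟩ := h₁.2 σ
  obtain ⟨b1, b2⟩ := h₂.2 (c₁.exec σ)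
  refine ⟨⟨b1.1.trans a1.1, fun x hx => (b1.2 x hx).trans (a1.2 x hx)⟩, ?_⟩
  rw [exec, b2, a2, h₂.1 _ _ a1, List.append_assoc]

theorem Lists.when {c : Code} {L : List ℕ} {g : Store → List ℕ} (h : Lists c L g) {e : Expr}
    (he : ∀ x ∈ L, e.reads x = false) :
    Lists (.ite e c .skip) L (fun σ => if e.eval σ ≠ 0 then g σ else []) := by
  refine ⟨fun σ τ hs => by beta_reduce; rw [h.1 σ τ hs, hs.eval he], fun σ => ?_⟩
  simp only [exec]
  split_ifs
  · exact h.2 σ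
  · exact ⟨⟨rfl, fun _ _ => rfl⟩, by simp⟩

end Code

end RAM

open Finset

namespace TrianglePacking

/-! ### The state of the local search -/

section Tables

variable {n : ℕ} {α : Type*}

/-- Change one entry of a table. -/
def upd (T : Fin n → Fin n → α) (i j : Fin n) (v : α) : Fin n → Fin n → α :=
  fun a b => if a = i ∧ b = j then v else T a b

/-- A table of the edges in a packing: `T a b = some c` if the triangle `abc` is in the packing. -/
structure IsTable (G : SimpleGraph (Fin n)) (T : Fin n → Fin n → Option (Fin n)) : Prop where
  adj : ∀ {a b c}, T a b = some c → G.Adj a b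
  symm : ∀ {a b c}, T a b = some c → T b a = some c
  rot : ∀ {a b c}, T a b = some c → T a c = some b

def addTriangle (T : Fin n → Fin n → Option (Fin n)) (a b c : Fin n) :
    Fin n → Fin n → Option (Fin n) :=
  upd (upd (upd (upd (upd (upd T a b (some c)) b a (some c)) a c (some b)) c a (some b))
    b c (some a)) c b (some a)

def removeTriangle (T : Fin n → Fin n → Option (Fin n)) (a b c : Fin n) :
    Fin n → Fin n → Option (Fin n) :=
  upd (upd (upd (upd (upd (upd T a b none) b a none) a c none) c a none) b c none) c b none

variable {G : SimpleGraph (Fin n)} {T : Fin n → Fin n → Option (Fin n)} {a b c : Fin n}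

theorem IsTable.rot' (h : IsTable G T) (habc : T a b = some c) : T b c = some a :=
  h.rot (h.symm habc)

theorem IsTable.add (h : IsTable G T) (hab : G.Adj a b) (hbc : G.Adj b c) (hac : G.Adj a c)
    (h1 : T a b = none) (h2 : T b c = none) (h3 : T a c = none) :
    IsTable G (addTriangle T a b c) := by
  have k1 := hab.ne
  have k2 := hbc.ne
  have k3 := hac.ne
  have e1 : T b a = none := by
    by_contra hne
    obtain ⟨d, hd⟩ := Option.ne_none_iff_exists'.1 hne
    simp [h.symm hd] at h1
  have e2 : T c b = none := by
    by_contra hne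
    obtain ⟨d, hd⟩ := Option.ne_none_iff_exists'.1 hne
    simp [h.symm hd] at h2
  have e3 : T c a = none := by
    by_contra hne
    obtain ⟨d, hd⟩ := Option.ne_none_iff_exists'.1 hne
    simp [h.symm hd] at h3
  -- The six cells written are distinct and were empty, so the entries of the new table are the old
  -- ones and these six.
  have key : ∀ x y z, addTriangle T a b c x y = some z ↔ T x y = some z ∨
      (x = a ∧ y = b ∧ z = c) ∨ (x = b ∧ y = a ∧ z = c) ∨ (x = a ∧ y = c ∧ z = b) ∨
      (x = c ∧ y = a ∧ z = b) ∨ (x = b ∧ y = c ∧ z = a) ∨ (x = c ∧ y = b ∧ z = a) := by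
    intro x y z
    simp only [addTriangle, upd]
    grind
  refine ⟨fun {x y z} hx => ?_, fun {x y z} hx => ?_, fun {x y z} hx => ?_⟩
  · rw [key] at hx
    rcases hx with hx | ⟨rfl, rfl, rfl⟩ | ⟨rfl, rfl, rfl⟩ | ⟨rfl, rfl, rfl⟩ | ⟨rfl, rfl, rfl⟩ |
      ⟨rfl, rfl, rfl⟩ | ⟨rfl, rfl, rfl⟩
    exacts [h.adj hx, hab, hab.symm, hac, hac.symm, hbc, hbc.symm]
  · rw [key] at hx ⊢
    rcases hx with hx | hx
    · exact Or.inl (h.symm hx)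
    · right; grind
  · rw [key] at hx ⊢
    rcases hx with hx | hx
    · exact Or.inl (h.rot hx)
    · right; grind

theorem IsTable.remove (h : IsTable G T) (habc : T a b = some c) :
    IsTable G (removeTriangle T a b c) := by
  have e1 := h.symm habc
  have e2 := h.rot habc
  have e3 := h.symm e2
  have e4 := h.rot e1
  have e5 := h.symm e4
  have key : ∀ x y z, removeTriangle T a b c x y = some z ↔ T x y = some z ∧
      ¬ ((x = a ∧ y = b ∧ z = c) ∨ (x = b ∧ y = a ∧ z = c) ∨ (x = a ∧ y = c ∧ z = b) ∨
      (x = c ∧ y = a ∧ z = b) ∨ (x = b ∧ y = c ∧ z = a) ∨ (x = c ∧ y = b ∧ z = a)) := by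
    intro x y z
    simp only [removeTriangle, upd]
    grind
  refine ⟨fun {x y z} hx => ?_, fun {x y z} hx => ?_, fun {x y z} hx => ?_⟩
  · rw [key] at hx
    exact h.adj hx.1
  · rw [key] at hx ⊢
    exact ⟨h.symm hx.1, fun hp => hx.2 (by grind)⟩
  · rw [key] at hx ⊢
    exact ⟨h.rot hx.1, fun hp => hx.2 (by grind)⟩

/-! ### Size of a packing, measured by its table -/

/-- The number of nonempty entries. -/
def support (T : Fin n → Fin n → Option (Fin n)) : ℕ := #{p : Fin n × Fin n | T p.1 p.2 ≠ none}

theorem support_upd_some (h : T a b = none) : support (upd T a b (some c)) = support T + 1 := by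
  have : (univ.filter fun p : Fin n × Fin n => upd T a b (some c) p.1 p.2 ≠ none) =
      insert (a, b) (univ.filter fun p : Fin n × Fin n => T p.1 p.2 ≠ none) := by
    ext ⟨x, y⟩
    simp only [upd, mem_filter, mem_univ, true_and, mem_insert, Prod.mk.injEq]
    grind
  rw [support, this, card_insert_of_notMem (by simp [h]), support]

theorem support_upd_none (h : T a b ≠ none) : support (upd T a b none) + 1 = support T := by
  have : (univ.filter fun p : Fin n × Fin n => T p.1 p.2 ≠ none) =
      insert (a, b) (univ.filter fun p : Fin n × Fin n => upd T a b none p.1 p.2 ≠ none) := by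
    ext ⟨x, y⟩
    simp only [upd, mem_filter, mem_univ, true_and, mem_insert, Prod.mk.injEq]
    grind
  rw [support, support, this, card_insert_of_notMem (by simp [upd])]

theorem support_le : support T ≤ n * n := by
  refine (card_filter_le _ _).trans ?_
  simp

theorem IsTable.none_symm (h : IsTable G T) (hab : T a b = none) : T b a = none := by
  by_contra hne
  obtain ⟨d, hd⟩ := Option.ne_none_iff_exists'.1 hne
  simp [h.symm hd] at hab

theorem IsTable.support_add (h : IsTable G T) (hab : a ≠ b) (hbc : b ≠ c) (hac : a ≠ c)
    (h1 : T a b = none) (h2 : T b c = none) (h3 : T a c = none) :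
    support (addTriangle T a b c) = support T + 6 := by
  have e1 := h.none_symm h1
  have e2 := h.none_symm h2
  have e3 := h.none_symm h3
  rw [addTriangle, support_upd_some, support_upd_some, support_upd_some, support_upd_some,
    support_upd_some, support_upd_some] <;> (try simp only [upd]) <;> grind

theorem IsTable.support_remove (h : IsTable G T) (hab : T a b = some c) :
    support (removeTriangle T a b c) + 6 = support T := by
  have e1 := h.symm hab
  have e2 := h.rot hab
  have e3 := h.symm e2
  have e4 := h.rot e1
  have e5 := h.symm e4
  have k1 := (h.adj hab).ne
  have k2 := (h.adj e2).ne
  have k3 := (h.adj e4).ne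
  have s1 := support_upd_none (T := T) (a := a) (b := b) (by grind)
  have s2 := support_upd_none (T := upd T a b none) (a := b) (b := a)
    (by simp only [upd]; grind)
  have s3 := support_upd_none (T := upd (upd T a b none) b a none) (a := a) (b := c)
    (by simp only [upd]; grind)
  have s4 := support_upd_none (T := upd (upd (upd T a b none) b a none) a c none)
    (a := c) (b := a) (by simp only [upd]; grind)
  have s5 := support_upd_none (T := upd (upd (upd (upd T a b none) b a none) a c none) c a none)
    (a := b) (b := c) (by simp only [upd]; grind)
  have s6 := support_upd_none
    (T := upd (upd (upd (upd (upd T a b none) b a none) a c none) c a none) b c none)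
    (a := c) (b := b) (by simp only [upd]; grind)
  rw [removeTriangle]
  omega

theorem sum_upd {d : Fin n → Fin n → ℕ} {v : ℕ} :
    ∑ x, ∑ y, upd d a b v x y + d a b = ∑ x, ∑ y, d x y + v := by
  have h1 : ∑ p ∈ univ.erase (a, b), upd d a b v p.1 p.2 + upd d a b v a b =
      ∑ p : Fin n × Fin n, upd d a b v p.1 p.2 :=
    Finset.sum_erase_add univ (fun p : Fin n × Fin n => upd d a b v p.1 p.2) (mem_univ (a, b))
  have h2 : ∑ p ∈ univ.erase (a, b), d p.1 p.2 + d a b = ∑ p : Fin n × Fin n, d p.1 p.2 :=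
    Finset.sum_erase_add univ (fun p : Fin n × Fin n => d p.1 p.2) (mem_univ (a, b))
  have h3 : ∑ p ∈ univ.erase (a, b), upd d a b v p.1 p.2 =
      ∑ p ∈ univ.erase (a, b), d p.1 p.2 := by
    refine sum_congr rfl fun p hp => ?_
    have : ¬ (p.1 = a ∧ p.2 = b) := fun h => (mem_erase.1 hp).1 (Prod.ext h.1 h.2)
    simp [upd, this]
  have h4 : upd d a b v a b = v := by simp [upd]
  rw [h3, h4] at h1
  simp only [← Fintype.sum_prod_type']
  omega

end Tables

/-- `third` is the table of a packing, `owner` assigns vertices outside the packing to edges in the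
packing, and `price` counts how often the owner of an edge changed. -/
structure Core (n : ℕ) where
  third : Fin n → Fin n → Option (Fin n)
  price : Fin n → Fin n → ℕ
  owner : Fin n → Fin n → Option (Fin n)

namespace Core

variable {n : ℕ}

/-- The invariants of the auction. An owner and its edge form a triangle whose tip lies outside the
packing, and a vertex owns at most one edge, up to orientation. Owners are replaced but never
dismissed, so an edge of positive price always has one. `envy_free` is what converts an unused price
level into a crown; `price_le` bounds the potential. -/
structure Valid (G : SimpleGraph (Fin n)) (s : Core n) : Prop where
  table : IsTable G s.third
  owner_symm : ∀ {a b u}, s.owner a b = some u → s.owner b a = some u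
  owner_third : ∀ {a b u}, s.owner a b = some u → s.third a b ≠ none
  owner_adj : ∀ {a b u}, s.owner a b = some u → G.Adj u a
  owner_free : ∀ {a b u}, s.owner a b = some u → ∀ x, s.third u x = none
  owner_inj : ∀ {a b a' b' u}, s.owner a b = some u → s.owner a' b' = some u →
    a' = a ∧ b' = b ∨ a' = b ∧ b' = a
  price_symm : ∀ a b, s.price a b = s.price b a
  price_eq_zero : ∀ {a b}, s.owner a b = none → s.price a b = 0
  price_le : ∀ a b, s.price a b ≤ n * n + 1
  envy_free : ∀ {a b u}, s.owner a b = some u → ∀ {a' b'}, G.Adj u a' → G.Adj u b' →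
    s.third a' b' ≠ none → s.price a b ≤ s.price a' b' + 1

/-- Replace the packing and forget all owners. -/
def restart (T : Fin n → Fin n → Option (Fin n)) : Core n := ⟨T, fun _ _ => 0, fun _ _ => none⟩

theorem valid_restart {G : SimpleGraph (Fin n)} {T : Fin n → Fin n → Option (Fin n)}
    (h : IsTable G T) : (restart T).Valid G := by
  constructor <;> simp [restart, h]

/-- The weight `(n * n + 1) ^ 2` exceeds every possible sum of prices, so a larger packing
compensates for the loss of all prices at a restart. -/
def potential (s : Core n) : ℕ :=
  support s.third * (n * n + 1) ^ 2 + ∑ a, ∑ b, s.price a b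

theorem sum_price_lt {G : SimpleGraph (Fin n)} {s : Core n} (h : s.Valid G) :
    ∑ a, ∑ b, s.price a b < (n * n + 1) ^ 2 := by
  have : ∑ a, ∑ b, s.price a b ≤ ∑ a : Fin n, ∑ b : Fin n, (n * n + 1) :=
    sum_le_sum fun a _ => sum_le_sum fun b _ => h.price_le a b
  simp only [sum_const, card_univ, Fintype.card_fin, smul_eq_mul] at this
  nlinarith

theorem potential_lt {G : SimpleGraph (Fin n)} {s : Core n} (h : s.Valid G) :
    s.potential < (n * n + 1) ^ 3 := by
  have h1 := sum_price_lt h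
  have h2 := Nat.mul_le_mul_right ((n * n + 1) ^ 2) (support_le (T := s.third))
  rw [potential, pow_succ' _ 2, add_mul, one_mul]
  omega

theorem potential_lt_restart {G : SimpleGraph (Fin n)} {s : Core n} (h : s.Valid G)
    {T : Fin n → Fin n → Option (Fin n)} (hT : support s.third < support T) :
    s.potential < (restart T).potential := by
  have h1 := sum_price_lt h
  have h2 := Nat.mul_le_mul_right ((n * n + 1) ^ 2) (Nat.succ_le_of_lt hT)
  rw [Nat.succ_mul] at h2
  simp only [potential, restart]
  omega

/-! #### The three kinds of steps -/

variable (G : SimpleGraph (Fin n)) (s : Core n)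

def CanAdd (a b c : Fin n) : Prop :=
  G.Adj a b ∧ G.Adj b c ∧ G.Adj a c ∧ s.third a b = none ∧ s.third b c = none ∧ s.third a c = none

/-- Bidding only for a cheapest edge limits the envy of the new owner to one. The cap `n * n + 1` is
the largest level that `exists_level` may return, so prices at the cap are never below the level. -/
def CanBid (u y z : Fin n) : Prop :=
  (∀ x, s.third u x = none) ∧ (∀ a b, s.owner a b ≠ some u) ∧
  (∀ a b, G.Adj u a → G.Adj u b → s.third a b ≠ none → s.price y z ≤ s.price a b) ∧
  G.Adj u y ∧ G.Adj u z ∧ s.third y z ≠ none ∧ s.price y z < n * n + 1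

/-- Two owned edges `yz` and `yw` of one packed triangle `yzw`: exchanging it for `yzu` and `ywx`
gains a triangle. -/
def CanReplace (y z : Fin n) : Prop :=
  ∃ u w x, s.owner y z = some u ∧ s.third y z = some w ∧ s.owner y w = some x

def bid (u y z : Fin n) : Core n where
  third := s.third
  price := upd (upd s.price y z (s.price y z + 1)) z y (s.price y z + 1)
  owner := upd (upd s.owner y z (some u)) z y (some u)

variable {G s}

theorem Valid.add (h : s.Valid G) {a b c : Fin n} (hc : s.CanAdd G a b c) :
    (restart (addTriangle s.third a b c)).Valid G ∧
    s.potential < (restart (addTriangle s.third a b c)).potential := by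
  obtain ⟨h1, h2, h3, h4, h5, h6⟩ := hc
  refine ⟨valid_restart (h.table.add h1 h2 h3 h4 h5 h6), potential_lt_restart h ?_⟩
  rw [h.table.support_add h1.ne h2.ne h3.ne h4 h5 h6]
  omega

/-- The new owner pays the least price it sees plus one. For every remaining owner its own price is
unchanged and the other prices only rise, so no envy arises; the evicted owner has left the
comparison. The potential grows by two, once for each orientation of the edge. -/
theorem Valid.bid (h : s.Valid G) {u y z : Fin n} (hc : s.CanBid G u y z) :
    (s.bid u y z).Valid G ∧ s.potential < (s.bid u y z).potential := by
  obtain ⟨h1, h2, h3, h4, h5, h6, h7⟩ := hc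
  obtain ⟨w, hw⟩ := Option.ne_none_iff_exists'.1 h6
  have hyz := (h.table.adj hw).ne
  have hzy := h.table.symm hw
  have hps := h.price_symm
  have ho : ∀ {a b v}, (s.bid u y z).owner a b = some v →
      (v = u ∧ (a = y ∧ b = z ∨ a = z ∧ b = y)) ∨
      (s.owner a b = some v ∧ ¬ (a = y ∧ b = z) ∧ ¬ (a = z ∧ b = y)) := by
    intro a b v
    simp only [Core.bid, upd]
    grind
  have hp : ∀ a b, (s.bid u y z).price a b = s.price a b +
      if a = y ∧ b = z ∨ a = z ∧ b = y then 1 else 0 := by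
    intro a b
    simp only [Core.bid, upd]
    grind
  refine ⟨⟨h.table, fun {a b v} hv => ?_, fun {a b v} hv => ?_, fun {a b v} hv => ?_,
    fun {a b v} hv => ?_, fun {a b a' b' v} hv hv' => ?_, fun a b => ?_, fun {a b} hv => ?_,
    fun a b => ?_, fun {a b v} hv a' b' ha hb hab => ?_⟩, ?_⟩
  · have := @h.owner_symm
    have := ho hv
    simp only [Core.bid, upd]
    grind
  · rcases ho hv with ⟨rfl, ⟨rfl, rfl⟩ | ⟨rfl, rfl⟩⟩ | ⟨hv, -⟩
    · exact h6
    · exact Option.ne_none_iff_exists'.2 ⟨w, hzy⟩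
    · exact h.owner_third hv
  · rcases ho hv with ⟨rfl, ⟨rfl, rfl⟩ | ⟨rfl, rfl⟩⟩ | ⟨hv, -⟩
    exacts [h4, h5, h.owner_adj hv]
  · rcases ho hv with ⟨rfl, -⟩ | ⟨hv, -⟩
    exacts [h1, h.owner_free hv]
  · have := @h.owner_inj
    have := ho hv
    have := ho hv'
    grind
  · have := hps a b
    rw [hp, hp]
    grind
  · have := @h.price_eq_zero a b
    simp only [Core.bid, upd] at hv
    rw [hp]
    grind
  · have := h.price_le a b
    have := hps y z
    rw [hp]
    grind
  · have hab' : s.third a' b' ≠ none := hab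
    rw [hp, hp]
    rcases ho hv with ⟨rfl, hv⟩ | ⟨hv, h8, h9⟩
    · have := h3 a' b' ha hb hab'
      have := hps y z
      grind
    · have := h.envy_free hv ha hb hab'
      grind
  · have e1 := sum_upd (d := s.price) (a := y) (b := z) (v := s.price y z + 1)
    have e2 := sum_upd (d := upd s.price y z (s.price y z + 1)) (a := z) (b := y)
      (v := s.price y z + 1)
    have e3 : upd s.price y z (s.price y z + 1) z y = s.price y z := by
      simp only [upd]
      grind
    simp only [potential, Core.bid]
    omega

/-- The owners lie outside the packing, so all their edges are free, and after the removal of `yzw`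
so are `yz` and `yw`. The two new triangles meet only in `y`. -/
theorem Valid.replace (h : s.Valid G) {y z u w x : Fin n} (hu : s.owner y z = some u)
    (hw : s.third y z = some w) (hx : s.owner y w = some x) :
    (restart (addTriangle (addTriangle (removeTriangle s.third y z w) y z u) y w x)).Valid G ∧
    s.potential <
      (restart (addTriangle (addTriangle (removeTriangle s.third y z w) y z u) y w x)).potential := by
  have hyz := h.table.adj hw
  have hyw := h.table.adj (h.table.rot hw)
  have hzw := h.table.adj (h.table.rot' hw)
  have huy := h.owner_adj hu
  have huz := h.owner_adj (h.owner_symm hu)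
  have hxy := h.owner_adj hx
  have hxw := h.owner_adj (h.owner_symm hx)
  have fu := h.owner_free hu
  have fx := h.owner_free hx
  -- A vertex owns only one edge, and `yz`, `yw` are different edges.
  have hne : u ≠ x := by
    rintro rfl
    rcases h.owner_inj hu hx with ⟨-, e⟩ | ⟨e, -⟩
    · exact hzw.ne e.symm
    · exact hyz.ne e
  have fu' := fun a => h.table.none_symm (fu a)
  have fx' := fun a => h.table.none_symm (fx a)
  have k1 := hyz.ne
  have k2 := hyw.ne
  have k3 := hzw.ne
  have k4 := huy.ne
  have k5 := huz.ne
  have k6 := hxy.ne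
  have k7 := hxw.ne
  have wu : w ≠ u := by
    rintro rfl
    have := h.table.symm (h.table.rot hw)
    simp [fu] at this
  have zx : z ≠ x := by
    rintro rfl
    have := h.table.symm hw
    simp [fx] at this
  have t1 := h.table.remove hw
  have s1 := h.table.support_remove hw
  have a1 : removeTriangle s.third y z w y z = none := by simp only [removeTriangle, upd]; grind
  have a2 : removeTriangle s.third y z w z u = none := by simp only [removeTriangle, upd]; grind
  have a3 : removeTriangle s.third y z w y u = none := by simp only [removeTriangle, upd]; grind
  have b1 : removeTriangle s.third y z w y w = none := by simp only [removeTriangle, upd]; grind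
  have b2 : removeTriangle s.third y z w w x = none := by simp only [removeTriangle, upd]; grind
  have b3 : removeTriangle s.third y z w y x = none := by simp only [removeTriangle, upd]; grind
  have t2 := t1.add hyz huz.symm huy.symm a1 a2 a3
  have s2 := t1.support_add k1 k5.symm k4.symm a1 a2 a3
  generalize removeTriangle s.third y z w = T at *
  have c1 : addTriangle T y z u y w = none := by simp only [addTriangle, upd]; grind
  have c2 : addTriangle T y z u w x = none := by simp only [addTriangle, upd]; grind
  have c3 : addTriangle T y z u y x = none := by simp only [addTriangle, upd]; grind
  have t3 := t2.add hyw hxw.symm hxy.symm c1 c2 c3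
  have s3 := t2.support_add k2 k7.symm k6.symm c1 c2 c3
  exact ⟨valid_restart t3, potential_lt_restart h (by omega)⟩

end Core
/-! ### Packings as lists of triples -/

section Lists

variable {n : ℕ}

def vset (t : Fin n × Fin n × Fin n) : Finset (Fin n) := {t.1, t.2.1, t.2.2}

def toTriple (t : Fin n × Fin n × Fin n) : ℕ × ℕ × ℕ := (t.1, t.2.1, t.2.2)

theorem mem_vset {x : Fin n} {t : Fin n × Fin n × Fin n} :
    x ∈ vset t ↔ x = t.1 ∨ x = t.2.1 ∨ x = t.2.2 := by simp [vset]

theorem tripleSet_toTriple (t : Fin n × Fin n × Fin n) :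
    tripleSet (toTriple t) = (vset t).map Fin.valEmbedding := by
  simp [tripleSet, toTriple, vset, Finset.map_insert]

def EdgeDisjoint (t t' : Fin n × Fin n × Fin n) : Prop :=
  ∀ x ∈ vset t, x ∈ vset t' → ∀ y ∈ vset t, y ∈ vset t' → x = y

structure IsPackingList (G : SimpleGraph (Fin n)) (l : List (Fin n × Fin n × Fin n)) : Prop where
  adj : ∀ t ∈ l, G.Adj t.1 t.2.1 ∧ G.Adj t.1 t.2.2 ∧ G.Adj t.2.1 t.2.2
  disjoint : l.Pairwise EdgeDisjoint

theorem IsPackingList.nil (G : SimpleGraph (Fin n)) : IsPackingList G [] := ⟨by simp, by simp⟩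

/-- A triangle is not edge-disjoint from itself, so pairwise disjointness already excludes
repetitions. -/
theorem IsPackingList.nodup {G : SimpleGraph (Fin n)} {l : List (Fin n × Fin n × Fin n)}
    (h : IsPackingList G l) : l.Nodup := by
  refine List.Pairwise.imp_of_mem (fun {t t'} ht _ hd he => ?_) h.disjoint
  subst he
  exact (h.adj t ht).1.ne (hd t.1 (by simp [vset]) (by simp [vset]) t.2.1 (by simp [vset])
    (by simp [vset]))

theorem IsPackingList.length_le {G : SimpleGraph (Fin n)} {l : List (Fin n × Fin n × Fin n)}
    (h : IsPackingList G l) : l.length ≤ n * (n * n) := by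
  have := h.nodup.length_le_card
  simpa using this

/-- Passes from families of vertex sets to lists of triples over `Fin`. Being a listing forces the
entries to be vertices; distinct vertex sets of the family correspond to distinct positions of the
list. -/
theorem exists_packing_iff (G : Graph) (s : List (ℕ × ℕ × ℕ)) :
    (∃ S : Finset (Finset (Fin G.n)), IsPacking G S ∧ IsListing s S) ↔
      ∃ l : List (Fin G.n × Fin G.n × Fin G.n), l.map toTriple = s ∧ IsPackingList G.graph l := by
  constructor
  · rintro ⟨S, ⟨hS1, hS2⟩, hs1, hs2⟩
    have hmem : ∀ t ∈ s, ∃ X ∈ S, tripleSet t = X.map Fin.valEmbedding := by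
      intro t ht
      have : tripleSet t ∈ (s.map tripleSet).toFinset := by
        rw [List.mem_toFinset]
        exact List.mem_map_of_mem ht
      rw [hs2, mem_image] at this
      obtain ⟨X, hX, h⟩ := this
      exact ⟨X, hX, h.symm⟩
    have hlt : ∀ t ∈ s, ∃ t' : Fin G.n × Fin G.n × Fin G.n, toTriple t' = t := by
      intro t ht
      obtain ⟨X, hX, h⟩ := hmem t ht
      have hx : ∀ v ∈ tripleSet t, v < G.n := by
        intro v hv
        rw [h, mem_map] at hv
        obtain ⟨w, -, rfl⟩ := hv
        exact w.2
      exact ⟨(⟨t.1, hx _ (by simp [tripleSet])⟩, ⟨t.2.1, hx _ (by simp [tripleSet])⟩,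
        ⟨t.2.2, hx _ (by simp [tripleSet])⟩), rfl⟩
    have hl : s ∈ Set.range (List.map (toTriple (n := G.n))) := by
      rw [Set.range_list_map]
      exact hlt
    obtain ⟨l, rfl⟩ := hl
    have hvset : ∀ t ∈ l, vset t ∈ S := by
      intro t ht
      obtain ⟨X, hX, h⟩ := hmem _ (List.mem_map_of_mem ht)
      rw [tripleSet_toTriple, map_inj] at h
      rwa [h]
    refine ⟨l, rfl, fun t ht => ?_, ?_⟩
    · have := hS1 _ (hvset t ht)
      have hc := this.card_eq
      have hcl := this.isClique
      obtain ⟨a, b, c⟩ := t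
      simp only [vset] at hc hcl
      obtain ⟨hab, hac, hbc⟩ : a ≠ b ∧ a ≠ c ∧ b ≠ c := by
        have h2 : ∀ x y : Fin G.n, #{x, y} ≤ 2 := fun _ _ => card_le_two
        refine ⟨?_, ?_, ?_⟩ <;> rintro rfl
        · rw [insert_eq_of_mem (by simp)] at hc
          exact absurd hc (h2 _ _ |>.trans_lt (by omega)).ne
        · rw [insert_eq_of_mem (by simp)] at hc
          exact absurd hc (h2 _ _ |>.trans_lt (by omega)).ne
        · rw [pair_eq_singleton] at hc
          exact absurd hc (h2 _ _ |>.trans_lt (by omega)).ne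
      exact ⟨hcl (by simp) (by simp) hab, hcl (by simp) (by simp) hac,
        hcl (by simp) (by simp) hbc⟩
    · rw [List.map_map, List.Nodup, List.pairwise_map] at hs1
      refine List.Pairwise.imp_of_mem (fun {t t'} ht ht' hne x hx hx' y hy hy' => ?_) hs1
      simp only [Function.comp, tripleSet_toTriple, ne_eq, map_inj] at hne
      exact hS2 (hvset t ht) (hvset t' ht') hne ⟨hx, hx'⟩ ⟨hy, hy'⟩
  · rintro ⟨l, rfl, h⟩
    have hne : ∀ {t t'}, t ∈ l → EdgeDisjoint t t' → vset t ≠ vset t' := by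
      intro t t' ht hd he
      exact (h.adj t ht).1.ne (hd t.1 (by simp [vset]) (he ▸ by simp [vset]) t.2.1 (by simp [vset])
        (he ▸ by simp [vset]))
    refine ⟨(l.map vset).toFinset, ⟨fun X hX => ?_, ?_⟩, ?_, ?_⟩
    · simp only [List.mem_toFinset, List.mem_map] at hX
      obtain ⟨t, ht, rfl⟩ := hX
      rw [SimpleGraph.is3Clique_iff]
      exact ⟨t.1, t.2.1, t.2.2, (h.adj t ht).1, (h.adj t ht).2.1, (h.adj t ht).2.2, rfl⟩
    · intro X hX Y hY hXY
      simp only [List.coe_toFinset, Set.mem_ofPred_eq, List.mem_map] at hX hY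
      obtain ⟨t, ht, rfl⟩ := hX
      obtain ⟨t', ht', rfl⟩ := hY
      have hd : EdgeDisjoint t t' := by
        have : Std.Symm (EdgeDisjoint (n := G.n)) :=
          ⟨fun a b hab x hx hx' y hy hy' => hab x hx' hx y hy' hy⟩
        refine h.disjoint.forall ht ht' ?_
        rintro rfl
        exact hXY rfl
      exact fun x hx y hy => hd x hx.1 hx.2 y hy.1 hy.2
    · rw [List.map_map, List.Nodup, List.pairwise_map]
      refine List.Pairwise.imp_of_mem (fun {t t'} ht _ hd => ?_) h.disjoint
      simp only [Function.comp, tripleSet_toTriple, ne_eq, map_inj]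
      exact hne ht hd
    · ext X
      simp [tripleSet_toTriple]

end Lists

/-! ### Listing the entries of a table -/

section Scan

variable {n : ℕ} {α : Type*}

/-- The entries of a table, row by row. -/
def scan (g : Fin n → Fin n → Option α) : List α :=
  (List.finRange n).flatMap fun a => (List.finRange n).flatMap fun b => (g a b).toList

theorem mem_scan {g : Fin n → Fin n → Option α} {t : α} :
    t ∈ scan g ↔ ∃ a b, g a b = some t := by simp [scan]

theorem length_scan (g : Fin n → Fin n → Option α) :
    (scan g).length = ∑ a, ∑ b, (g a b).toList.length := by
  simp [scan, List.length_flatMap, Fin.sum_univ_def]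

theorem nodup_scan {g : Fin n → Fin n → Option α}
    (h : ∀ a b a' b' t, g a b = some t → g a' b' = some t → a = a' ∧ b = b') :
    (scan g).Nodup := by
  rw [scan, List.nodup_flatMap]
  refine ⟨fun a _ => ?_, ?_⟩
  · rw [List.nodup_flatMap]
    refine ⟨fun b _ => ?_, ?_⟩
    · cases g a b <;> simp
    · refine (List.nodup_finRange n).imp fun {b b'} hb t ht ht' => ?_
      simp only [Option.mem_toList] at ht ht'
      exact hb (h _ _ _ _ _ ht ht').2
  · refine (List.nodup_finRange n).imp fun {a a'} ha t ht ht' => ?_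
    simp only [List.mem_flatMap, Option.mem_toList] at ht ht'
    obtain ⟨b, -, hb⟩ := ht
    obtain ⟨b', -, hb'⟩ := ht'
    exact ha (h _ _ _ _ _ hb hb').1

end Scan

/-! ### The crown -/

namespace Core

variable {n : ℕ} (G : SimpleGraph (Fin n)) (s : Core n) (l : ℕ)

/-- No step of the local search is possible. -/
structure Stuck : Prop where
  no_add : ∀ a b c, ¬ s.CanAdd G a b c
  no_bid : ∀ u y z, ¬ s.CanBid G u y z
  no_replace : ∀ y z, ¬ s.CanReplace y z

/-- The triangles in the packing. -/
def packed : List (Fin n × Fin n × Fin n) :=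
  -- A triangle fills six cells of the table; the order condition selects one of them.
  scan fun a b => (s.third a b).bind fun c => if a < b ∧ b < c then some (a, b, c) else none

/-- The triangles formed by the edges of price more than `l` and their owners. -/
def crown : List (Fin n × Fin n × Fin n) :=
  scan fun a b => (s.owner a b).bind fun u =>
    if a < b ∧ l < s.price a b then some (u, a, b) else none

/-- What is dropped are the tips of the crown and the vertices outside the packing that own nothing.
-/
def Kept (v : Fin n) : Prop :=
  (∃ x, s.third v x ≠ none) ∨ ∃ a b, s.owner a b = some v ∧ s.price a b ≤ l

/-- The graph without the edges of price more than `l`. -/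
def residual : SimpleGraph (Fin n) where
  Adj a b := G.Adj a b ∧ s.price a b ≤ l ∧ s.price b a ≤ l
  symm := ⟨fun _ _ h => ⟨h.1.symm, h.2.2, h.2.1⟩⟩
  loopless := ⟨fun _ h => h.1.ne rfl⟩

variable {G s l}

theorem mem_packed {t : Fin n × Fin n × Fin n} :
    t ∈ s.packed ↔ s.third t.1 t.2.1 = some t.2.2 ∧ t.1 < t.2.1 ∧ t.2.1 < t.2.2 := by
  obtain ⟨x, y, z⟩ := t
  simp only [packed, mem_scan, Option.bind_eq_some_iff]
  constructor
  · rintro ⟨a, b, c, h1, h2⟩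
    split_ifs at h2 with h
    simp only [Option.some.injEq, Prod.mk.injEq] at h2
    obtain ⟨rfl, rfl, rfl⟩ := h2
    exact ⟨h1, h⟩
  · rintro ⟨h1, h2⟩
    exact ⟨x, y, z, h1, by simp [h2]⟩

theorem mem_crown {t : Fin n × Fin n × Fin n} :
    t ∈ s.crown l ↔ s.owner t.2.1 t.2.2 = some t.1 ∧ t.2.1 < t.2.2 ∧
      l < s.price t.2.1 t.2.2 := by
  obtain ⟨x, y, z⟩ := t
  simp only [crown, mem_scan, Option.bind_eq_some_iff]
  constructor
  · rintro ⟨a, b, c, h1, h2⟩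
    split_ifs at h2 with h
    simp only [Option.some.injEq, Prod.mk.injEq] at h2
    obtain ⟨rfl, rfl, rfl⟩ := h2
    exact ⟨h1, h⟩
  · rintro ⟨h1, h2⟩
    exact ⟨y, z, x, h1, by simp [h2]⟩

theorem nodup_packed : s.packed.Nodup := by
  refine nodup_scan fun a b a' b' t h h' => ?_
  simp only [Option.bind_eq_some_iff, Option.ite_none_right_eq_some, Option.some.injEq] at h h'
  obtain ⟨c, -, -, rfl⟩ := h
  obtain ⟨c', -, -, h'⟩ := h'
  simp only [Prod.mk.injEq] at h'
  exact ⟨h'.1.symm, h'.2.1.symm⟩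

theorem nodup_crown : (s.crown l).Nodup := by
  refine nodup_scan fun a b a' b' t h h' => ?_
  simp only [Option.bind_eq_some_iff, Option.ite_none_right_eq_some, Option.some.injEq] at h h'
  obtain ⟨c, -, -, rfl⟩ := h
  obtain ⟨c', -, -, h'⟩ := h'
  simp only [Prod.mk.injEq] at h'
  exact ⟨h'.2.1.symm, h'.2.2.symm⟩

theorem _root_.TrianglePacking.IsTable.third_of_mem {T : Fin n → Fin n → Option (Fin n)}
    (h : IsTable G T) {t : Fin n × Fin n × Fin n} (ht : T t.1 t.2.1 = some t.2.2) {x y : Fin n}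
    (hx : x ∈ vset t) (hy : y ∈ vset t) (hxy : x ≠ y) :
    ∃ z, T x y = some z ∧ vset t = {x, y, z} := by
  obtain ⟨a, b, c⟩ := t
  have e0 : T a b = some c := ht
  have e1 := h.symm e0
  have e2 := h.rot e0
  have e3 := h.symm e2
  have e4 := h.rot e1
  have e5 := h.symm e4
  have k : ∀ z, T x y = some z → (∀ v, v = a ∨ v = b ∨ v = c ↔ v = x ∨ v = y ∨ v = z) →
      ∃ z, T x y = some z ∧ vset (a, b, c) = {x, y, z} := by
    intro z hz hv
    refine ⟨z, hz, ?_⟩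
    ext v
    simpa [vset] using hv v
  simp only [vset, mem_insert, mem_singleton] at hx hy
  rcases hx with rfl | rfl | rfl <;> rcases hy with rfl | rfl | rfl
  · exact absurd rfl hxy
  · exact k _ e0 (by tauto)
  · exact k _ e2 (by tauto)
  · exact k _ e1 (by tauto)
  · exact absurd rfl hxy
  · exact k _ e4 (by tauto)
  · exact k _ e3 (by tauto)
  · exact k _ e5 (by tauto)
  · exact absurd rfl hxy

theorem Valid.exists_packed (h : s.Valid G) {a b c : Fin n} (habc : s.third a b = some c) :
    ∃ t ∈ s.packed, vset t = {a, b, c} := by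
  have e1 := h.table.symm habc
  have e2 := h.table.rot habc
  have e3 := h.table.symm e2
  have e4 := h.table.rot e1
  have e5 := h.table.symm e4
  have k1 := (h.table.adj habc).ne
  have k2 := (h.table.adj e2).ne
  have k3 := (h.table.adj e4).ne
  have k : ∀ x y z : Fin n, s.third x y = some z → x < y → y < z →
      (∀ v, v = x ∨ v = y ∨ v = z ↔ v = a ∨ v = b ∨ v = c) →
      ∃ t ∈ s.packed, vset t = {a, b, c} := by
    intro x y z h1 h2 h3 hv
    refine ⟨(x, y, z), mem_packed.2 ⟨h1, h2, h3⟩, ?_⟩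
    ext v
    simpa [vset] using hv v
  rcases lt_or_gt_of_ne k1 with h1 | h1 <;> rcases lt_or_gt_of_ne k2 with h2 | h2 <;>
    rcases lt_or_gt_of_ne k3 with h3 | h3
  · exact k _ _ _ habc h1 h3 (by tauto)
  · exact k _ _ _ e2 h2 h3 (by tauto)
  · exact absurd (h1.trans h3) (not_lt.2 h2.le)
  · exact k _ _ _ e3 h2 h1 (by tauto)
  · exact k _ _ _ e1 h1 h2 (by tauto)
  · exact absurd (h2.trans h3) (not_lt.2 h1.le)
  · exact k _ _ _ e4 h3 h2 (by tauto)
  · exact k _ _ _ e5 h3 h1 (by tauto)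

/-- Two packed triangles with a common edge read the same third vertex from the table, so their
vertex sets agree; being sorted, the triples agree as well. -/
theorem Valid.isPackingList_packed (h : s.Valid G) : IsPackingList G s.packed := by
  refine ⟨fun t ht => ?_, nodup_packed.pairwise_of_forall_ne fun t ht t' ht' hne => ?_⟩
  · have := (mem_packed.1 ht).1
    exact ⟨h.table.adj this, h.table.adj (h.table.rot this), h.table.adj (h.table.rot' this)⟩
  · intro x hx hx' y hy hy'
    by_contra hxy
    obtain ⟨h1, h2, h3⟩ := mem_packed.1 ht
    obtain ⟨h1', h2', h3'⟩ := mem_packed.1 ht'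
    obtain ⟨z, hz, e⟩ := h.table.third_of_mem h1 hx hy hxy
    obtain ⟨z', hz', e'⟩ := h.table.third_of_mem h1' hx' hy' hxy
    obtain rfl : z = z' := by simpa [hz] using hz'
    have he : vset t = vset t' := e.trans e'.symm
    refine hne ?_
    obtain ⟨a, b, c⟩ := t
    obtain ⟨a', b', c'⟩ := t'
    have m1 : a ∈ vset (a', b', c') := he ▸ by simp [vset]
    have m2 : b ∈ vset (a', b', c') := he ▸ by simp [vset]
    have m3 : c ∈ vset (a', b', c') := he ▸ by simp [vset]
    simp only [mem_vset] at m1 m2 m3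
    simp only at h2 h3 h2' h3'
    simp only [Prod.mk.injEq]
    omega

/-! #### The number of kept vertices -/

-- Map each owner to the packed triangle containing its edge. The map is injective: two different
-- owned edges of one triangle would allow a replacement. This adds at most one vertex to the three
-- of each packed triangle.
open Classical in
theorem Valid.card_kept_le (h : s.Valid G) (hr : ∀ y z, ¬ s.CanReplace y z) :
    #{v | s.Kept l v} ≤ 4 * s.packed.length := by
  have h1 : #{v | ∃ x, s.third v x ≠ none} ≤ s.packed.length * 3 := by
    rw [← List.toFinset_card_of_nodup nodup_packed]
    refine le_trans (card_le_card ?_) (card_biUnion_le_card_mul _ vset 3 fun t _ => card_le_three)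
    intro v hv
    simp only [mem_filter, mem_univ, true_and] at hv
    obtain ⟨x, hx⟩ := hv
    obtain ⟨y, hy⟩ := Option.ne_none_iff_exists'.1 hx
    obtain ⟨t, ht, he⟩ := h.exists_packed hy
    exact mem_biUnion.2 ⟨t, by simpa using ht, by simp [he]⟩
  have h2 : #{v | ∃ a b, s.owner a b = some v} ≤ s.packed.length := by
    rw [← List.toFinset_card_of_nodup nodup_packed]
    have hex : ∀ v, (∃ a b, s.owner a b = some v) →
        ∃ t ∈ s.packed, ∃ a b, s.owner a b = some v ∧ a ∈ vset t ∧ b ∈ vset t := by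
      rintro v ⟨a, b, hab⟩
      obtain ⟨c, hc⟩ := Option.ne_none_iff_exists'.1 (h.owner_third hab)
      obtain ⟨t, ht, he⟩ := h.exists_packed hc
      exact ⟨t, ht, a, b, hab, by simp [he], by simp [he]⟩
    choose! f hf using hex
    refine card_le_card_of_injOn f (fun v hv => ?_) fun v hv v' hv' he => ?_
    · simpa using (hf v (by simpa using hv)).1
    · obtain ⟨ht, a, b, hab, ha, hb⟩ := hf v (by simpa using hv)
      obtain ⟨-, a', b', hab', ha', hb'⟩ := hf v' (by simpa using hv')
      rw [← he] at ha' hb'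
      have hne : ∀ {a b v}, s.owner a b = some v → a ≠ b := by
        intro a b v hv
        obtain ⟨c, hc⟩ := Option.ne_none_iff_exists'.1 (h.owner_third hv)
        exact (h.table.adj hc).ne
      obtain ⟨c, hc, hset⟩ := h.table.third_of_mem (mem_packed.1 ht).1 ha hb (hne hab)
      have hnab := hne hab'
      have n1 : s.owner a c = none := by
        by_contra hac
        obtain ⟨x, hx⟩ := Option.ne_none_iff_exists'.1 hac
        exact hr a b ⟨v, c, x, hab, hc, hx⟩
      have n2 : s.owner b c = none := by
        by_contra hac
        obtain ⟨x, hx⟩ := Option.ne_none_iff_exists'.1 hac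
        exact hr b a ⟨v, c, x, h.owner_symm hab, h.table.symm hc, hx⟩
      have n3 := h.owner_symm hab'
      have n4 := h.owner_symm hab
      rw [hset] at ha' hb'
      simp only [mem_insert, mem_singleton] at ha' hb'
      grind
  refine (card_le_card (t := (univ.filter fun v => ∃ x, s.third v x ≠ none) ∪
    univ.filter fun v => ∃ a b, s.owner a b = some v) ?_).trans
    ((card_union_le _ _).trans (by omega))
  intro v hv
  simp only [mem_filter, mem_univ, true_and, mem_union] at hv ⊢
  rcases hv with hv | ⟨a, b, hv, -⟩
  · exact Or.inl hv
  · exact Or.inr ⟨a, b, hv⟩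

/-! #### Removing the crown -/

/-- There are only `n * n` ordered pairs to carry prices, but `n * n + 1` candidates for the level.
-/
theorem exists_level (s : Core n) :
    ∃ l, 1 ≤ l ∧ l ≤ n * n + 1 ∧ ∀ a b, s.price a b ≠ l := by
  have hlt : #(univ.image fun p : Fin n × Fin n => s.price p.1 p.2) < #(Icc 1 (n * n + 1)) := by
    refine card_image_le.trans_lt ?_
    simp
  obtain ⟨l, hl, hl'⟩ := exists_mem_notMem_of_card_lt_card hlt
  rw [mem_Icc] at hl
  refine ⟨l, hl.1, hl.2, fun a b hab => hl' ?_⟩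
  exact mem_image.2 ⟨(a, b), mem_univ _, hab⟩

/-- Otherwise the cheapest packed edge seen by `u` would be below the cap, and `u` could bid for it.
-/
theorem Stuck.price_ge (hs : s.Stuck G) {u : Fin n} (hu : ∀ x, s.third u x = none)
    (hm : ∀ a b, s.owner a b ≠ some u) {y z : Fin n} (hy : G.Adj u y) (hz : G.Adj u z)
    (hyz : s.third y z ≠ none) : n * n + 1 ≤ s.price y z := by
  classical
  obtain ⟨p, hp, hmin⟩ := exists_min_image
    {p : Fin n × Fin n | G.Adj u p.1 ∧ G.Adj u p.2 ∧ s.third p.1 p.2 ≠ none}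
    (fun p => s.price p.1 p.2) ⟨(y, z), by simp [hy, hz, hyz]⟩
  simp only [mem_filter, mem_univ, true_and] at hp hmin
  have h1 := hmin (y, z) ⟨hy, hz, hyz⟩
  by_contra hlt
  exact hs.no_bid u p.1 p.2 ⟨hu, hm, fun a b ha hb hab => hmin (a, b) ⟨ha, hb, hab⟩, hp.1, hp.2.1,
    hp.2.2, by simp only at h1; omega⟩

/-- Suppose `u` is not kept. Then `uy` and `uz` are not packed, so `yz` is, as no triangle can be
added. If `u` owns nothing, `yz` has reached the cap; if `u` owns an edge of price at least `l + 1`,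
envy-freeness makes `yz` cost at least `l`. In both cases the price of `yz` would be exactly `l`,
which is no price. -/
theorem Valid.kept_of_price_le (h : s.Valid G) (hs : s.Stuck G) (hl : l ≤ n * n + 1)
    (hlev : ∀ a b, s.price a b ≠ l) {u y z : Fin n} (hy : G.Adj u y) (hz : G.Adj u z)
    (hyz : G.Adj y z) (hp : s.price y z ≤ l) : s.Kept l u := by
  by_contra hk
  simp only [Kept, not_or, not_exists, not_and, not_not, not_le] at hk
  obtain ⟨h1, h2⟩ := hk
  have h3 : s.third y z ≠ none := fun h0 => hs.no_add u y z ⟨hy, hyz, hz, h1 y, h0, h1 z⟩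
  have h4 : l ≤ s.price y z := by
    by_cases hm : ∀ a b, s.owner a b ≠ some u
    · exact hl.trans (hs.price_ge h1 hm hy hz h3)
    · push Not at hm
      obtain ⟨a, b, hab⟩ := hm
      have := h.envy_free hab hy hz h3
      have := h2 a b hab
      omega
  exact hlev y z (le_antisymm hp h4)

/-- Every edge of positive price has an owner, so no expensive edge is missing from the crown. -/
theorem length_crown (h : s.Valid G) :
    (s.crown l).length = #{p : Fin n × Fin n | p.1 < p.2 ∧ l < s.price p.1 p.2} := by
  rw [crown, length_scan, card_filter, Fintype.sum_prod_type]
  refine sum_congr rfl fun a _ => sum_congr rfl fun b _ => ?_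
  cases ho : s.owner a b with
  | none => simp [h.price_eq_zero ho]
  | some u =>
    simp only [Option.bind_some]
    split_ifs <;> simp

/-- Removing the crown loses at most as many triangles as the crown has. -/
theorem Valid.exists_residual (h : s.Valid G) (hs : s.Stuck G) (hl : l ≤ n * n + 1)
    (hlev : ∀ a b, s.price a b ≠ l) {L : List (Fin n × Fin n × Fin n)} (hL : IsPackingList G L) :
    ∃ L', IsPackingList (s.residual G l) L' ∧ (∀ t ∈ L', ∀ v ∈ vset t, s.Kept l v) ∧
      L.length ≤ L'.length + (s.crown l).length := by
  classical
  -- The triangles with an expensive edge are discarded; the others survive with all their edges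
  -- and, by `kept_of_price_le`, all their vertices.
  let bad : Fin n × Fin n × Fin n → Prop := fun t =>
    ∃ p : Fin n × Fin n, p.1 ∈ vset t ∧ p.2 ∈ vset t ∧ p.1 < p.2 ∧ l < s.price p.1 p.2
  have hgood : ∀ t ∈ L, ¬ bad t → ∀ x ∈ vset t, ∀ y ∈ vset t, G.Adj x y → s.price x y ≤ l := by
    intro t _ hb x hx y hy hxy
    by_contra hlt
    rcases lt_or_gt_of_ne hxy.ne with h1 | h1
    · exact hb ⟨(x, y), hx, hy, h1, not_le.1 hlt⟩
    · refine hb ⟨(y, x), hy, hx, h1, ?_⟩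
      rw [h.price_symm]
      exact not_le.1 hlt
  refine ⟨L.filter fun t => ¬ bad t, ⟨fun t ht => ?_, hL.disjoint.filter _⟩, fun t ht => ?_, ?_⟩
  · simp only [List.mem_filter, decide_eq_true_eq] at ht
    obtain ⟨h1, h2, h3⟩ := hL.adj t ht.1
    have hg := hgood t ht.1 ht.2
    have m1 : t.1 ∈ vset t := by simp [vset]
    have m2 : t.2.1 ∈ vset t := by simp [vset]
    have m3 : t.2.2 ∈ vset t := by simp [vset]
    exact ⟨⟨h1, hg _ m1 _ m2 h1, hg _ m2 _ m1 h1.symm⟩,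
      ⟨h2, hg _ m1 _ m3 h2, hg _ m3 _ m1 h2.symm⟩, ⟨h3, hg _ m2 _ m3 h3, hg _ m3 _ m2 h3.symm⟩⟩
  · simp only [List.mem_filter, decide_eq_true_eq] at ht
    obtain ⟨h1, h2, h3⟩ := hL.adj t ht.1
    have hg := hgood t ht.1 ht.2
    have m1 : t.1 ∈ vset t := by simp [vset]
    have m2 : t.2.1 ∈ vset t := by simp [vset]
    have m3 : t.2.2 ∈ vset t := by simp [vset]
    intro v hv
    rw [mem_vset] at hv
    rcases hv with rfl | rfl | rfl
    · exact h.kept_of_price_le hs hl hlev h1 h2 h3 (hg _ m2 _ m3 h3)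
    · exact h.kept_of_price_le hs hl hlev h1.symm h3 h2 (hg _ m1 _ m3 h2)
    · exact h.kept_of_price_le hs hl hlev h2.symm h3.symm h1 (hg _ m1 _ m2 h1)
  · have hlen : L.length = (L.filter fun t => ¬ bad t).length + (L.filter fun t => bad t).length := by
      rw [add_comm]
      simpa using (List.length_eq_length_filter_add (l := L) (fun t => decide (bad t)))
    rw [hlen]
    refine Nat.add_le_add_left ?_ _
    have hex : ∀ t, bad t → ∃ p : Fin n × Fin n,
      p.1 ∈ vset t ∧ p.2 ∈ vset t ∧ p.1 < p.2 ∧ l < s.price p.1 p.2 := fun t ht => ht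
    -- Each discarded triangle is charged to one of its expensive edges. Edge-disjointness makes
    -- this injective on the list; the value at other triples plays no role.
    obtain ⟨e, he⟩ : ∃ e : Fin n × Fin n × Fin n → Fin n × Fin n, ∀ t, bad t →
        (e t).1 ∈ vset t ∧ (e t).2 ∈ vset t ∧ (e t).1 < (e t).2 ∧ l < s.price (e t).1 (e t).2 :=
      ⟨fun t => if ht : bad t then (hex t ht).choose else (t.1, t.1), fun t ht => by
        beta_reduce; rw [dif_pos ht]; exact (hex t ht).choose_spec⟩
    have hnd : ((L.filter fun t => bad t).map e).Nodup := by
      rw [List.Nodup, List.pairwise_map]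
      refine List.Pairwise.imp_of_mem (fun {t t'} ht ht' hd heq => ?_) (hL.disjoint.filter _)
      simp only [List.mem_filter, decide_eq_true_eq] at ht ht'
      obtain ⟨h1, h2, h3, -⟩ := he t ht.2
      obtain ⟨h1', h2', -⟩ := he t' ht'.2
      rw [← heq] at h1' h2'
      exact h3.ne (hd _ h1 h1' _ h2 h2')
    rw [length_crown h, ← List.length_map (f := e), ← List.toFinset_card_of_nodup hnd]
    refine card_le_card fun p hp => ?_
    simp only [List.mem_toFinset, List.mem_map, List.mem_filter, decide_eq_true_eq] at hp
    obtain ⟨t, ht, rfl⟩ := hp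
    simpa using (he t ht.2).2.2

/-- The crown can be added to any packing of the remaining graph. -/
theorem Valid.isPackingList_append_crown (h : s.Valid G)
    {L : List (Fin n × Fin n × Fin n)} (hL : IsPackingList (s.residual G l) L)
    (hk : ∀ t ∈ L, ∀ v ∈ vset t, s.Kept l v) : IsPackingList G (L ++ s.crown l) := by
  -- A tip lies outside the packing, and the only edge it owns costs more than `l`.
  have hnk : ∀ t ∈ s.crown l, ¬ s.Kept l t.1 := by
    rintro t ht (⟨x, hx⟩ | ⟨a, b, hab, hp⟩)
    · exact hx (h.owner_free (mem_crown.1 ht).1 x)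
    · obtain ⟨h1, -, h3⟩ := mem_crown.1 ht
      have := h.price_symm t.2.1 t.2.2
      rcases h.owner_inj h1 hab with ⟨rfl, rfl⟩ | ⟨rfl, rfl⟩ <;> omega
  have hthird : ∀ t ∈ s.crown l, ∃ x, s.third t.2.1 t.2.2 = some x := fun t ht =>
    Option.ne_none_iff_exists'.1 (h.owner_third (mem_crown.1 ht).1)
  refine ⟨fun t ht => ?_, List.pairwise_append.2 ⟨hL.disjoint, ?_, ?_⟩⟩
  · rcases List.mem_append.1 ht with ht | ht
    · obtain ⟨h1, h2, h3⟩ := hL.adj t ht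
      exact ⟨h1.1, h2.1, h3.1⟩
    · obtain ⟨x, hx⟩ := hthird t ht
      have h1 := (mem_crown.1 ht).1
      exact ⟨h.owner_adj h1, h.owner_adj (h.owner_symm h1), h.table.adj hx⟩
  -- Tips are outside the packing and distinct from each other, so an edge common to two crown
  -- triangles would be the base of both; but an edge has just one owner.
  · refine nodup_crown.pairwise_of_forall_ne fun t ht t' ht' hne => ?_
    obtain ⟨x, hx⟩ := hthird t ht
    obtain ⟨x', hx'⟩ := hthird t' ht'
    have hx2 := h.table.symm hx
    have hx2' := h.table.symm hx'
    obtain ⟨h1, h2, -⟩ := mem_crown.1 ht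
    obtain ⟨h1', h2', -⟩ := mem_crown.1 ht'
    have f1 := h.owner_free h1
    have f1' := h.owner_free h1'
    have hinj := @h.owner_inj t.2.1 t.2.2 t'.2.1 t'.2.2 t.1 h1
    obtain ⟨u, a, b⟩ := t
    obtain ⟨u', a', b'⟩ := t'
    simp only [ne_eq, Prod.mk.injEq] at *
    have n1 : u ≠ a' := by rintro rfl; simp [f1] at hx'
    have n2 : u ≠ b' := by rintro rfl; simp [f1] at hx2'
    have n3 : u' ≠ a := by rintro rfl; simp [f1'] at hx
    have n4 : u' ≠ b := by rintro rfl; simp [f1'] at hx2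
    have n5 : u ≠ u' := by
      rintro rfl
      rcases hinj h1' with ⟨rfl, rfl⟩ | ⟨rfl, rfl⟩
      · simp at hne
      · exact absurd h2 (not_lt.2 h2'.le)
    intro x hx hx' y hy hy'
    simp only [mem_vset] at hx hx' hy hy'
    clear hinj f1 f1'
    have hab : ¬ (a = a' ∧ b = b') := by
      rintro ⟨rfl, rfl⟩
      rw [h1] at h1'
      exact n5 (Option.some.inj h1')
    omega
  -- A common edge avoids the tip, which is not kept. It is thus the base of the crown triangle, too
  -- expensive to be an edge of the residual graph.
  · intro t ht t' ht' x hx hx' y hy hy'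
    by_contra hxy
    have hx1 : x ≠ t'.1 := fun he => hnk t' ht' (he ▸ hk t ht x hx)
    have hy1 : y ≠ t'.1 := fun he => hnk t' ht' (he ▸ hk t ht y hy)
    have hadj : (s.residual G l).Adj x y := by
      obtain ⟨h1, h2, h3⟩ := hL.adj t ht
      rw [mem_vset] at hx hy
      rcases hx with rfl | rfl | rfl <;> rcases hy with rfl | rfl | rfl
      exacts [absurd rfl hxy, h1, h2, h1.symm, absurd rfl hxy, h3, h2.symm, h3.symm,
        absurd rfl hxy]
    obtain ⟨-, -, h3⟩ := mem_crown.1 ht'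
    have p1 := hadj.2.1
    have p2 := hadj.2.2
    rw [mem_vset] at hx' hy'
    rcases hx' with hx' | hx' | hx' <;> rcases hy' with hy' | hy' | hy' <;>
      first
        | exact absurd hx' hx1
        | exact absurd hy' hy1
        | exact absurd (hx'.trans hy'.symm) hxy
        | (subst hx' hy'; omega)

end Core
end TrianglePacking

/-! ### Programs for the local search and for the kernel -/

namespace RAM

/-! ### Boolean expressions -/

namespace Expr

/-- Truncated subtraction turns this into a minimum. It is nonzero when both arguments are, and it
is a genuine bit when they are bits, as needed for writing an adjacency matrix. -/
def conj (a b : Expr) : Expr := .sub a (.sub a b)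
def neg (a : Expr) : Expr := .sub (.const 1) a
def lt (a b : Expr) : Expr := .sub b a
def eq (a b : Expr) : Expr := neg (.add (.sub a b) (.sub b a))

theorem eval_conj (σ : Store) (a b : Expr) : (conj a b).eval σ = min (a.eval σ) (b.eval σ) := by
  simp only [conj, eval]
  omega

theorem eval_conj_ne_zero (σ : Store) (a b : Expr) :
    (conj a b).eval σ ≠ 0 ↔ a.eval σ ≠ 0 ∧ b.eval σ ≠ 0 := by
  rw [eval_conj]
  omega

theorem eval_neg_ne_zero (σ : Store) (a : Expr) : (neg a).eval σ ≠ 0 ↔ a.eval σ = 0 := by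
  simp only [neg, eval]
  omega

theorem eval_lt_ne_zero (σ : Store) (a b : Expr) :
    (lt a b).eval σ ≠ 0 ↔ a.eval σ < b.eval σ := by
  simp only [lt, eval]
  omega

theorem eval_eq_ne_zero (σ : Store) (a b : Expr) :
    (eq a b).eval σ ≠ 0 ↔ a.eval σ = b.eval σ := by
  simp only [eq, neg, eval]
  omega

end Expr

end RAM

namespace TrianglePacking

open RAM RAM.Code

/-! ### Programs working on graphs

Array `0` is the encoding of a graph with `n` vertices, and array `8` holds the multiples of `n`.
Arrays `5`, `6` and `7` are the tables `third`, `price` and `owner`. -/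

/-- The machine does not multiply, so the offset of a row is looked up. -/
def position (e₁ e₂ : Expr) : Expr := .add (.get 8 e₁) e₂

def entry (a : ℕ) (e₁ e₂ : Expr) : Expr := .get a (position e₁ e₂)

def edge (e₁ e₂ : Expr) : Expr := .get 0 (.add (.const 1) (position e₁ e₂))

def succ (e : Expr) : Expr := .add e (.const 1)

def pred (e : Expr) : Expr := .sub e (.const 1)

/-- With `none` as zero, the initial memory represents empty tables. -/
def code {n : ℕ} : Option (Fin n) → ℕ
  | none => 0
  | some i => i + 1

theorem code_ne_zero {n : ℕ} (o : Option (Fin n)) : code o ≠ 0 ↔ o ≠ none := by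
  cases o <;> simp [code]

theorem code_eq_zero {n : ℕ} (o : Option (Fin n)) : code o = 0 ↔ o = none := by
  cases o <;> simp [code]

theorem code_eq_succ {n : ℕ} (o : Option (Fin n)) (i : Fin n) : code o = i + 1 ↔ o = some i := by
  cases o <;> simp [code, Fin.ext_iff]

theorem index_inj {n : ℕ} {i j i' j' : Fin n} :
    (i * n + j : ℕ) = i' * n + j' ↔ i = i' ∧ j = j' := by
  constructor
  · intro h
    have hn : 0 < n := i.pos
    have h1 := congrArg (· / n) h
    have h2 := congrArg (· % n) h
    simp only [mul_comm _ n, Nat.mul_add_div hn, Nat.mul_add_mod, Nat.div_eq_of_lt j.2,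
      Nat.div_eq_of_lt j'.2, Nat.mod_eq_of_lt j.2, Nat.mod_eq_of_lt j'.2, add_zero] at h1 h2
    exact ⟨Fin.ext h1, Fin.ext h2⟩
  · rintro ⟨rfl, rfl⟩
    rfl

theorem index_lt {n : ℕ} (i j : Fin n) : (i * n + j : ℕ) < n * n := by
  have := Nat.mul_le_mul_right n (Nat.succ_le_of_lt i.2)
  rw [Nat.succ_mul] at this
  omega

theorem divNat_index {n : ℕ} (i j : Fin n) (h : (i * n + j : ℕ) < n * n) :
    (⟨i * n + j, h⟩ : Fin (n * n)).divNat = i := by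
  have hv : (⟨i * n + j, h⟩ : Fin (n * n)) = finProdFinEquiv (i, j) := by
    ext
    simp [finProdFinEquiv, mul_comm, add_comm]
  rw [hv]
  exact congrArg Prod.fst (finProdFinEquiv.symm_apply_apply (i, j))

theorem modNat_index {n : ℕ} (i j : Fin n) (h : (i * n + j : ℕ) < n * n) :
    (⟨i * n + j, h⟩ : Fin (n * n)).modNat = j := by
  have hv : (⟨i * n + j, h⟩ : Fin (n * n)) = finProdFinEquiv (i, j) := by
    ext
    simp [finProdFinEquiv, mul_comm, add_comm]
  rw [hv]
  exact congrArg Prod.snd (finProdFinEquiv.symm_apply_apply (i, j))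

open Classical in
theorem encodeGraph_getD (G : Graph) (i j : Fin G.n) :
    (encodeGraph G).getD (1 + (i * G.n + j)) 0 = if G.graph.Adj i j then 1 else 0 := by
  rw [encodeGraph, add_comm 1, List.getD_cons_succ,
    List.getD_eq_getElem _ _ (by simpa using index_lt i j), List.getElem_ofFn, divNat_index,
    modNat_index]

/-- The store `σ` represents the graph `G` and the state `s` of the local search. -/
structure Rep (G : Graph) (σ : Store) (s : Core G.n) : Prop where
  input : ∀ j, σ.arr 0 j = (encodeGraph G).getD j 0
  size : σ.var 0 = G.n * G.n + 1
  row : ∀ i : Fin G.n, σ.arr 8 i = i * G.n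
  third : ∀ i j : Fin G.n, σ.arr 5 (i * G.n + j) = code (s.third i j)
  price : ∀ i j : Fin G.n, σ.arr 6 (i * G.n + j) = s.price i j
  owner : ∀ i j : Fin G.n, σ.arr 7 (i * G.n + j) = code (s.owner i j)

namespace Rep

variable {G : Graph} {σ τ : Store} {s : Core G.n}

theorem congr (h : Rep G σ s) (ha : τ.arr = σ.arr) (hv : τ.var 0 = σ.var 0) : Rep G τ s := by
  obtain ⟨h1, h2, h3, h4, h5, h6⟩ := h
  constructor <;> simp only [ha, hv] <;> assumption

theorem set (h : Rep G σ s) {x : ℕ} (hx : 5 ≤ x) (v : ℕ) : Rep G (σ.set x v) s :=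
  h.congr rfl (by rw [Store.set_var, if_neg (by omega)])

theorem head (h : Rep G σ s) : Bound.eval σ .head = G.n := by
  simp [h.input, encodeGraph]

variable {e₁ e₂ : Expr} {i j : Fin G.n}

theorem eval_position (h : Rep G σ s) (h₁ : e₁.eval σ = i) (h₂ : e₂.eval σ = j) :
    (position e₁ e₂).eval σ = i * G.n + j := by
  simp [position, Expr.eval, h₁, h₂, h.row]

theorem eval_edge (h : Rep G σ s) (h₁ : e₁.eval σ = i) (h₂ : e₂.eval σ = j) :
    (edge e₁ e₂).eval σ ≠ 0 ↔ G.graph.Adj i j := by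
  simp only [edge, Expr.eval, h.eval_position h₁ h₂, h.input, encodeGraph_getD]
  simp

theorem eval_edge_le (h : Rep G σ s) (h₁ : e₁.eval σ = i) (h₂ : e₂.eval σ = j) :
    (edge e₁ e₂).eval σ ≤ 1 := by
  simp only [edge, Expr.eval, h.eval_position h₁ h₂, h.input, encodeGraph_getD]
  split_ifs <;> simp

theorem eval_third (h : Rep G σ s) (h₁ : e₁.eval σ = i) (h₂ : e₂.eval σ = j) :
    (entry 5 e₁ e₂).eval σ = code (s.third i j) := by
  simp only [entry, Expr.eval, h.eval_position h₁ h₂, h.third]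

theorem eval_price (h : Rep G σ s) (h₁ : e₁.eval σ = i) (h₂ : e₂.eval σ = j) :
    (entry 6 e₁ e₂).eval σ = s.price i j := by
  simp only [entry, Expr.eval, h.eval_position h₁ h₂, h.price]

theorem eval_owner (h : Rep G σ s) (h₁ : e₁.eval σ = i) (h₂ : e₂.eval σ = j) :
    (entry 7 e₁ e₂).eval σ = code (s.owner i j) := by
  simp only [entry, Expr.eval, h.eval_position h₁ h₂, h.owner]

variable {e : Expr}

theorem put_third (h : Rep G σ s) (h₁ : e₁.eval σ = i) (h₂ : e₂.eval σ = j) {v : Option (Fin G.n)}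
    (hv : e.eval σ = code v) :
    Rep G ((Code.put 5 (position e₁ e₂) e).exec σ) ⟨upd s.third i j v, s.price, s.owner⟩ := by
  refine ⟨h.input, h.size, h.row, fun a b => ?_, h.price, h.owner⟩
  simp only [Code.exec, h.eval_position h₁ h₂, hv, Function.update_self, Function.update_apply,
    index_inj, upd, h.third]
  split_ifs <;> rfl

theorem put_price (h : Rep G σ s) (h₁ : e₁.eval σ = i) (h₂ : e₂.eval σ = j) {v : ℕ}
    (hv : e.eval σ = v) :
    Rep G ((Code.put 6 (position e₁ e₂) e).exec σ) ⟨s.third, upd s.price i j v, s.owner⟩ := by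
  refine ⟨h.input, h.size, h.row, h.third, fun a b => ?_, h.owner⟩
  simp only [Code.exec, h.eval_position h₁ h₂, hv, Function.update_self, Function.update_apply,
    index_inj, upd, h.price]

theorem put_owner (h : Rep G σ s) (h₁ : e₁.eval σ = i) (h₂ : e₂.eval σ = j) {v : Option (Fin G.n)}
    (hv : e.eval σ = code v) :
    Rep G ((Code.put 7 (position e₁ e₂) e).exec σ) ⟨s.third, s.price, upd s.owner i j v⟩ := by
  refine ⟨h.input, h.size, h.row, h.third, h.price, fun a b => ?_⟩
  simp only [Code.exec, h.eval_position h₁ h₂, hv, Function.update_self, Function.update_apply,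
    index_inj, upd, h.owner]
  split_ifs <;> rfl

end Rep

/-! ### Updates of the tables -/

def putAround (x y z : ℕ) (ex ey ez : Expr) : Code :=
  .put 5 (position (.var x) (.var y)) ez ;; .put 5 (position (.var y) (.var x)) ez ;;
  .put 5 (position (.var x) (.var z)) ey ;; .put 5 (position (.var z) (.var x)) ey ;;
  .put 5 (position (.var y) (.var z)) ex ;; .put 5 (position (.var z) (.var y)) ex

def insertTriangle (x y z : ℕ) : Code :=
  putAround x y z (succ (.var x)) (succ (.var y)) (succ (.var z))

def deleteTriangle (x y z : ℕ) : Code := putAround x y z (.const 0) (.const 0) (.const 0)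

/-- The bound is the length `n * n + 1` of the first word; the one cell cleared beyond the tables is
harmless. -/
def reset : Code :=
  .rep 11 .first (.put 6 (.var 11) (.const 0) ;; .put 7 (.var 11) (.const 0))

section

variable {G : Graph} {σ : Store} {s : Core G.n} {a b c : Fin G.n} {x y z : ℕ}

theorem Rep.insertTriangle (h : Rep G σ s) (hx : σ.var x = a) (hy : σ.var y = b)
    (hz : σ.var z = c) :
    Rep G ((insertTriangle x y z).exec σ) ⟨addTriangle s.third a b c, s.price, s.owner⟩ := by
  have h1 := h.put_third (e₁ := .var x) (e₂ := .var y) (e := succ (.var z)) hx hy (v := some c)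
    (by simp [succ, Expr.eval, hz, code])
  have h2 := h1.put_third (e₁ := .var y) (e₂ := .var x) (e := succ (.var z)) hy hx (v := some c)
    (by simp [succ, Expr.eval, hz, code, Code.exec])
  have h3 := h2.put_third (e₁ := .var x) (e₂ := .var z) (e := succ (.var y)) hx hz (v := some b)
    (by simp [succ, Expr.eval, hy, code, Code.exec])
  have h4 := h3.put_third (e₁ := .var z) (e₂ := .var x) (e := succ (.var y)) hz hx (v := some b)
    (by simp [succ, Expr.eval, hy, code, Code.exec])
  have h5 := h4.put_third (e₁ := .var y) (e₂ := .var z) (e := succ (.var x)) hy hz (v := some a)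
    (by simp [succ, Expr.eval, hx, code, Code.exec])
  exact h5.put_third (e₁ := .var z) (e₂ := .var y) (e := succ (.var x)) hz hy (v := some a)
    (by simp [succ, Expr.eval, hx, code, Code.exec])

theorem Rep.deleteTriangle (h : Rep G σ s) (hx : σ.var x = a) (hy : σ.var y = b)
    (hz : σ.var z = c) :
    Rep G ((deleteTriangle x y z).exec σ) ⟨removeTriangle s.third a b c, s.price, s.owner⟩ := by
  have h1 := h.put_third (e₁ := .var x) (e₂ := .var y) (e := .const 0) hx hy (v := none) rfl
  have h2 := h1.put_third (e₁ := .var y) (e₂ := .var x) (e := .const 0) hy hx (v := none) rfl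
  have h3 := h2.put_third (e₁ := .var x) (e₂ := .var z) (e := .const 0) hx hz (v := none) rfl
  have h4 := h3.put_third (e₁ := .var z) (e₂ := .var x) (e := .const 0) hz hx (v := none) rfl
  have h5 := h4.put_third (e₁ := .var y) (e₂ := .var z) (e := .const 0) hy hz (v := none) rfl
  exact h5.put_third (e₁ := .var z) (e₂ := .var y) (e := .const 0) hz hy (v := none) rfl

theorem Rep.reset (h : Rep G σ s) : Rep G (reset.exec σ) (Core.restart s.third) := by
  have key := rep_induction (x := 11) (b := .first)
    (c := .put 6 (.var 11) (.const 0) ;; .put 7 (.var 11) (.const 0)) (σ := σ)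
    (fun m τ => (∀ j, τ.arr 0 j = (encodeGraph G).getD j 0) ∧ τ.var 0 = G.n * G.n + 1 ∧
      (∀ i : Fin G.n, τ.arr 8 i = i * G.n) ∧
      (∀ i j : Fin G.n, τ.arr 5 (i * G.n + j) = code (s.third i j)) ∧
      ∀ j < m, τ.arr 6 j = 0 ∧ τ.arr 7 j = 0) (fun τ => rfl)
    ⟨h.input, h.size, h.row, h.third, by simp⟩
    (fun i _ τ hi ⟨h1, h2, h3, h4, h5⟩ => ⟨h1, h2, h3, h4, fun j hj => by
      rcases Nat.lt_succ_iff_lt_or_eq.1 hj with hj | rfl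
      · have hne : j ≠ i := by omega
        simpa [Code.exec, Expr.eval, hi, hne] using h5 j hj
      · simp [Code.exec, Expr.eval, hi]⟩)
  obtain ⟨h1, h2, h3, h4, h5⟩ := key
  have hlt : ∀ i j : Fin G.n, (i * G.n + j : ℕ) < σ.var 0 := fun i j => by
    rw [h.size]
    exact (index_lt i j).trans (by omega)
  exact ⟨h1, h2, h3, h4, fun i j => (h5 _ (hlt i j)).1, fun i j => (h5 _ (hlt i j)).2⟩

end

/-! ### Counting entries of tables -/

def count₁ (e : Expr) : Code := .rep 11 .head (tally 10 e)

def count₂ (e : Expr) : Code := .rep 11 .head (.rep 12 .head (tally 10 e))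

section

variable {G : Graph} {σ : Store} {s : Core G.n} {e : Expr}

open Classical in
theorem Rep.count₁ (h : Rep G σ s) (he : e.reads 10 = false) {Q : Fin G.n → Prop}
    (hQ : ∀ i : Fin G.n, e.eval (σ.set 11 i) ≠ 0 ↔ Q i) :
    SameUpTo [10, 11] ((count₁ e).exec σ) σ ∧ ((count₁ e).exec σ).out = σ.out ∧
    ((count₁ e).exec σ).var 10 = σ.var 10 + ∑ i, if Q i then 1 else 0 := by
  obtain ⟨h1, h2, h3⟩ := ((counts_tally he).rep (x := 11) (b := .head) (by norm_num) (by norm_num)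
    (by simp) (by norm_num) (by simp)).2 σ
  refine ⟨h1, h2, h3.trans ?_⟩
  beta_reduce
  rw [h.head, Finset.sum_range]
  simp only [hQ]

open Classical in
theorem Rep.count₂ (h : Rep G σ s) (he : e.reads 10 = false) {Q : Fin G.n → Fin G.n → Prop}
    (hQ : ∀ i j : Fin G.n, e.eval ((σ.set 11 i).set 12 j) ≠ 0 ↔ Q i j) :
    SameUpTo [10, 11, 12] ((count₂ e).exec σ) σ ∧ ((count₂ e).exec σ).out = σ.out ∧
    ((count₂ e).exec σ).var 10 = σ.var 10 + ∑ i, ∑ j, if Q i j then 1 else 0 := by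
  obtain ⟨h1, h2, h3⟩ := (((counts_tally he).rep (x := 12) (b := .head) (by norm_num) (by norm_num)
    (by simp) (by norm_num) (by simp)).rep (x := 11) (b := .head) (by norm_num) (by norm_num)
    (by simp) (by norm_num) (by simp)).2 σ
  refine ⟨h1, h2, h3.trans ?_⟩
  beta_reduce
  rw [h.head, Finset.sum_range]
  congr 1
  refine sum_congr rfl fun i _ => ?_
  rw [(h.set (x := 11) (by norm_num) i).head, Finset.sum_range]
  simp only [hQ]

theorem Rep.sameUpTo (h : Rep G σ s) {L : List ℕ} {τ : Store} (hs : SameUpTo L τ σ)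
    (hL : 0 ∉ L) : Rep G τ s := h.congr hs.1 (hs.2 0 hL)

end

/-! ### The local search -/

/-- Started in a store that satisfies `A`, the program `c` raises the potential if the state of the
local search satisfies `P`, and keeps that state otherwise. -/
def Searches (G : Graph) (c : Code) (A : Store → Prop) (P : Core G.n → Prop) : Prop :=
  ∀ σ s, A σ → Rep G σ s → s.Valid G.graph → ∃ s', Rep G (c.exec σ) s' ∧ s'.Valid G.graph ∧
    (¬ P s → s' = s) ∧ (P s → s.potential < s'.potential)

/-- Until the first success the state is still `s`, so a loop without success has refuted every `P
i` at `s` itself; after a success the potential never falls back. -/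
theorem Searches.rep {G : Graph} {c : Code} {A : Store → Prop} {P : Fin G.n → Core G.n → Prop}
    {x : ℕ} (hx : 5 ≤ x) (hA : ∀ σ v, A σ → A (σ.set x v)) (hAc : ∀ σ, A σ → A (c.exec σ))
    (hc : c.avoidsVar x = true) (h : ∀ i : Fin G.n, Searches G c (fun σ => A σ ∧ σ.var x = i) (P i)) :
    Searches G (.rep x .head c) A (fun s => ∃ i, P i s) := by
  intro σ s hσ hr hs
  have key := rep_induction (x := x) (b := .head) (c := c) (σ := σ)
    (fun m τ => A τ ∧ ∃ s', Rep G τ s' ∧ s'.Valid G.graph ∧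
      ((s' = s ∧ ∀ i : Fin G.n, (i : ℕ) < m → ¬ P i s) ∨
        ((∃ i, P i s) ∧ s.potential < s'.potential)))
    (fun τ => exec_var hc τ)
    ⟨hA _ _ hσ, s, hr.set hx 0, hs, Or.inl ⟨rfl, by simp⟩⟩ ?_
  · rw [hr.head] at key
    obtain ⟨-, s', h1, h2, h3⟩ := key
    refine ⟨s', h1, h2, ?_, ?_⟩
    · rintro hn
      rcases h3 with h3 | h3
      · exact h3.1
      · exact absurd h3.1 hn
    · rintro ⟨i, hi⟩
      rcases h3 with h3 | h3
      · exact absurd hi (h3.2 i i.2)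
      · exact h3.2
  · rintro i hi τ hτ ⟨hAτ, s', h1, h2, h3⟩
    rw [hr.head] at hi
    obtain ⟨s'', k1, k2, k3, k4⟩ := h ⟨i, hi⟩ τ s' ⟨hAτ, hτ⟩ h1 h2
    refine ⟨hA _ _ (hAc _ hAτ), s'', k1.set hx _, k2, ?_⟩
    by_cases hP : P ⟨i, hi⟩ s'
    · have := k4 hP
      rcases h3 with ⟨rfl, h3⟩ | ⟨h3, h4⟩
      · exact Or.inr ⟨⟨_, hP⟩, this⟩
      · exact Or.inr ⟨h3, h4.trans this⟩
    · obtain rfl := k3 hP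
      rcases h3 with ⟨rfl, h3⟩ | h3
      · refine Or.inl ⟨rfl, fun j hj => ?_⟩
        rcases Nat.lt_succ_iff_lt_or_eq.1 hj with hj | hj
        · exact h3 j hj
        · have : j = ⟨i, hi⟩ := Fin.ext hj
          rwa [this]
      · exact Or.inr h3

theorem Searches.seq {G : Graph} {c₁ c₂ : Code} {P₁ P₂ : Core G.n → Prop}
    (h₁ : Searches G c₁ (fun _ => True) P₁) (h₂ : Searches G c₂ (fun _ => True) P₂) :
    Searches G (.seq c₁ c₂) (fun _ => True) (fun s => P₁ s ∨ P₂ s) := by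
  intro σ s _ hr hs
  obtain ⟨s', a1, a2, a3, a4⟩ := h₁ σ s trivial hr hs
  obtain ⟨s'', b1, b2, b3, b4⟩ := h₂ _ s' trivial a1 a2
  refine ⟨s'', b1, b2, fun hn => ?_, fun hp => ?_⟩
  · rw [not_or] at hn
    obtain rfl := a3 hn.1
    exact b3 hn.2
  · by_cases hP₁ : P₁ s
    · by_cases hP₂ : P₂ s'
      · exact (a4 hP₁).trans (b4 hP₂)
      · rw [b3 hP₂]
        exact a4 hP₁
    · obtain rfl := a3 hP₁
      exact b4 (hp.resolve_left hP₁)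

/-- The program `c` finds a state without `P`, or else raises the potential by `m`. -/
def Converges (G : Graph) (c : Code) (m : ℕ) (P : Core G.n → Prop) : Prop :=
  ∀ σ s, Rep G σ s → s.Valid G.graph → ∃ s', Rep G (c.exec σ) s' ∧ s'.Valid G.graph ∧
    (¬ P s → s' = s) ∧ (¬ P s' ∨ s.potential + m ≤ s'.potential)

theorem Searches.converges {G : Graph} {c : Code} {P : Core G.n → Prop}
    (h : Searches G c (fun _ => True) P) : Converges G c 1 P := by
  intro σ s hr hs
  obtain ⟨s', a1, a2, a3, a4⟩ := h σ s trivial hr hs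
  refine ⟨s', a1, a2, a3, ?_⟩
  by_cases hP : P s
  · exact Or.inr (a4 hP)
  · rw [a3 hP]
    exact Or.inl hP

/-- Once a state without `P` is reached it persists; otherwise each of the `n * n + 1` passes gains
`m`. -/
theorem Converges.rep {G : Graph} {c : Code} {m : ℕ} {P : Core G.n → Prop}
    (h : Converges G c m P) {x : ℕ} (hx : 5 ≤ x) (hc : c.avoidsVar x = true) :
    Converges G (.rep x .first c) ((G.n * G.n + 1) * m) P := by
  intro σ s hr hs
  have key := rep_induction (x := x) (b := .first) (c := c) (σ := σ)
    (fun i τ => ∃ s', Rep G τ s' ∧ s'.Valid G.graph ∧ (¬ P s → s' = s) ∧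
      (¬ P s' ∨ s.potential + i * m ≤ s'.potential))
    (fun τ => exec_var hc τ) ⟨s, hr.set hx 0, hs, fun _ => rfl, Or.inr (by simp)⟩ ?_
  · rw [Bound.eval_first, hr.size] at key
    exact key
  · rintro i - τ - ⟨s', h1, h2, h3, h4⟩
    obtain ⟨s'', k1, k2, k3, k4⟩ := h τ s' h1 h2
    refine ⟨s'', k1.set hx _, k2, fun hn => ?_, ?_⟩
    · obtain rfl := h3 hn
      exact k3 hn
    · rcases h4 with h4 | h4
      · rw [k3 h4]
        exact Or.inl h4
      · rcases k4 with k4 | k4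
        · exact Or.inl k4
        · right
          rw [Nat.succ_mul]
          omega

/-! #### Adding a triangle -/

open Expr in
def addStep : Code :=
  .ite (conj (edge (.var 5) (.var 6)) (conj (edge (.var 6) (.var 7)) (conj (edge (.var 5) (.var 7))
      (conj (neg (entry 5 (.var 5) (.var 6))) (conj (neg (entry 5 (.var 6) (.var 7)))
        (neg (entry 5 (.var 5) (.var 7))))))))
    (insertTriangle 5 6 7 ;; reset) .skip

theorem searches_addStep (G : Graph) (a b c : Fin G.n) :
    Searches G addStep (fun σ => ((True ∧ σ.var 5 = a) ∧ σ.var 6 = b) ∧ σ.var 7 = c)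
      (fun s => s.CanAdd G.graph a b c) := by
  rintro σ s ⟨⟨⟨-, ha⟩, hb⟩, hc⟩ hr hs
  have ha' : (Expr.var 5).eval σ = a := ha
  have hb' : (Expr.var 6).eval σ = b := hb
  have hc' : (Expr.var 7).eval σ = c := hc
  have hcond : (Expr.conj (edge (.var 5) (.var 6))
      (Expr.conj (edge (.var 6) (.var 7)) (Expr.conj (edge (.var 5) (.var 7))
      (Expr.conj (Expr.neg (entry 5 (.var 5) (.var 6))) (Expr.conj (Expr.neg (entry 5 (.var 6)
        (.var 7))) (Expr.neg (entry 5 (.var 5) (.var 7)))))))).eval σ ≠ 0 ↔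
      s.CanAdd G.graph a b c := by
    simp only [Expr.eval_conj_ne_zero, Expr.eval_neg_ne_zero, hr.eval_edge ha' hb',
      hr.eval_edge hb' hc', hr.eval_edge ha' hc', hr.eval_third ha' hb', hr.eval_third hb' hc',
      hr.eval_third ha' hc', code_eq_zero, Core.CanAdd]
  rw [addStep, Code.exec]
  split_ifs with h
  · obtain ⟨h1, h2⟩ := hs.add (hcond.1 h)
    exact ⟨_, (hr.insertTriangle ha hb hc).reset, h1, fun hn => absurd (hcond.1 h) hn,
      fun _ => h2⟩
  · exact ⟨s, hr, hs, fun _ => rfl, fun hp => absurd (hcond.2 hp) h⟩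

/-! #### Replacing a triangle by two -/

open Expr in
def replaceStep : Code :=
  -- If the edge is not packed, truncation yields the meaningless vertex 0; the test that follows
  -- then fails.
  .assign 8 (pred (entry 5 (.var 5) (.var 6))) ;;
  .ite (conj (entry 7 (.var 5) (.var 6)) (conj (entry 5 (.var 5) (.var 6))
      (entry 7 (.var 5) (.var 8))))
    (.assign 7 (pred (entry 7 (.var 5) (.var 6))) ;;
      .assign 9 (pred (entry 7 (.var 5) (.var 8))) ;;
      deleteTriangle 5 6 8 ;; insertTriangle 5 6 7 ;; insertTriangle 5 8 9 ;; reset) .skip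

theorem searches_replaceStep (G : Graph) (y z : Fin G.n) :
    Searches G replaceStep (fun σ => (True ∧ σ.var 5 = y) ∧ σ.var 6 = z)
      (fun s => s.CanReplace y z) := by
  rintro σ s ⟨⟨-, hy⟩, hz⟩ hr hs
  have hr₁ := hr.set (x := 8) (by norm_num) ((pred (entry 5 (.var 5) (.var 6))).eval σ)
  rw [replaceStep, Code.exec, Code.exec]
  have hval : (pred (entry 5 (.var 5) (.var 6))).eval σ = code (s.third y z) - 1 := by
    simp only [pred, Expr.eval, hr.eval_third (e₁ := .var 5) (e₂ := .var 6) hy hz]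
  rw [hval] at hr₁ ⊢
  generalize hτ : σ.set 8 (code (s.third y z) - 1) = τ at hr₁
  have hy₁ : τ.var 5 = y := by rw [← hτ, Store.set_var]; simpa using hy
  have hz₁ : τ.var 6 = z := by rw [← hτ, Store.set_var]; simpa using hz
  have ey : (Expr.var 5).eval τ = y := hy₁
  have ez : (Expr.var 6).eval τ = z := hz₁
  rw [Code.exec]
  split_ifs with hc
  · simp only [Expr.eval_conj_ne_zero, hr₁.eval_owner ey ez, hr₁.eval_third ey ez,
      code_ne_zero] at hc
    obtain ⟨h1, h2, h3⟩ := hc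
    obtain ⟨u, hu⟩ := Option.ne_none_iff_exists'.1 h1
    obtain ⟨w, hw⟩ := Option.ne_none_iff_exists'.1 h2
    have hw₁ : τ.var 8 = w := by rw [← hτ, Store.set_var]; simp [hw, code]
    have ew : (Expr.var 8).eval τ = w := hw₁
    rw [hr₁.eval_owner ey ew, code_ne_zero] at h3
    obtain ⟨x, hx⟩ := Option.ne_none_iff_exists'.1 h3
    obtain ⟨k1, k2⟩ := hs.replace hu hw hx
    refine ⟨_, ?_, k1, fun hn => absurd ⟨u, w, x, hu, hw, hx⟩ hn, fun _ => k2⟩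
    have hu₂ : (pred (entry 7 (.var 5) (.var 6))).eval τ = u := by
      simp [pred, Expr.eval, hr₁.eval_owner ey ez, hu, code]
    simp only [Code.exec, hu₂]
    have hr₂ := hr₁.set (x := 7) (by norm_num) u
    have hx₂ : (pred (entry 7 (.var 5) (.var 8))).eval (τ.set 7 u) = x := by
      simp only [pred, Expr.eval, hr₂.eval_owner (i := y) (j := w) (e₁ := .var 5) (e₂ := .var 8)
        (by simpa [Expr.eval, Store.set_var] using hy₁)
        (by simpa [Expr.eval, Store.set_var] using hw₁), hx, code]
      simp
    simp only [hx₂]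
    have hr₃ := hr₂.set (x := 9) (by norm_num) x
    generalize hρ : (τ.set 7 u).set 9 x = ρ at hr₃
    have v5 : ρ.var 5 = y := by simp [← hρ, Store.set_var, hy₁]
    have v6 : ρ.var 6 = z := by simp [← hρ, Store.set_var, hz₁]
    have v7 : ρ.var 7 = u := by simp [← hρ, Store.set_var]
    have v8 : ρ.var 8 = w := by simp [← hρ, Store.set_var, hw₁]
    have v9 : ρ.var 9 = x := by simp [← hρ, Store.set_var]
    exact (((hr₃.deleteTriangle v5 v6 v8).insertTriangle v5 v6 v7).insertTriangle v5 v8 v9).reset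
  · refine ⟨s, hr₁, hs, fun _ => rfl, ?_⟩
    rintro ⟨u, w, x, hu, hw, hx⟩
    have hw₁ : τ.var 8 = w := by rw [← hτ, Store.set_var]; simp [hw, code]
    have ew : (Expr.var 8).eval τ = w := hw₁
    refine absurd ?_ hc
    simp [Expr.eval_conj_ne_zero, hr₁.eval_owner ey ez, hr₁.eval_third ey ez,
      hr₁.eval_owner ey ew, code_ne_zero, hu, hw, hx]

/-! #### Bidding for an edge -/

-- Variable 10 accumulates the violations of the three universally quantified conditions in `CanBid`
-- and is zero exactly when all of them hold. Variable 0 holds `n * n + 1`, the cap.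
open Expr in
def bidStep : Code :=
  .assign 10 (.const 0) ;;
  count₁ (entry 5 (.var 7) (.var 11)) ;;
  count₂ (eq (entry 7 (.var 11) (.var 12)) (succ (.var 7))) ;;
  count₂ (conj (edge (.var 7) (.var 11)) (conj (edge (.var 7) (.var 12))
    (conj (entry 5 (.var 11) (.var 12))
      (lt (entry 6 (.var 11) (.var 12)) (entry 6 (.var 5) (.var 6)))))) ;;
  .ite (conj (neg (.var 10)) (conj (edge (.var 7) (.var 5)) (conj (edge (.var 7) (.var 6))
      (conj (entry 5 (.var 5) (.var 6)) (lt (entry 6 (.var 5) (.var 6)) (.var 0))))))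
    (.put 6 (position (.var 5) (.var 6)) (succ (entry 6 (.var 5) (.var 6))) ;;
      -- Copies the entry just written, which is already raised.
      .put 6 (position (.var 6) (.var 5)) (entry 6 (.var 5) (.var 6)) ;;
      .put 7 (position (.var 5) (.var 6)) (succ (.var 7)) ;;
      .put 7 (position (.var 6) (.var 5)) (succ (.var 7))) .skip

theorem searches_bidStep (G : Graph) (y z u : Fin G.n) :
    Searches G bidStep (fun σ => ((True ∧ σ.var 5 = y) ∧ σ.var 6 = z) ∧ σ.var 7 = u)
      (fun s => s.CanBid G.graph u y z) := by
  classical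
  rintro σ s ⟨⟨⟨-, hy⟩, hz⟩, hu⟩ hr hs
  rw [bidStep, Code.exec, Code.exec, Code.exec, Code.exec, Code.exec]
  have hr₁ := hr.set (x := 10) (by norm_num) ((Expr.const 0).eval σ)
  generalize hσ₁ : σ.set 10 ((Expr.const 0).eval σ) = σ₁ at hr₁
  have y1 : σ₁.var 5 = y := by simp [← hσ₁, Store.set_var, hy]
  have z1 : σ₁.var 6 = z := by simp [← hσ₁, Store.set_var, hz]
  have u1 : σ₁.var 7 = u := by simp [← hσ₁, Store.set_var, hu]
  have f1 : σ₁.var 10 = 0 := by simp [← hσ₁, Store.set_var, Expr.eval]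
  obtain ⟨hsame, -, f2⟩ := hr₁.count₁ (e := entry 5 (.var 7) (.var 11)) rfl
    (Q := fun i => s.third u i ≠ none) (fun i => by
      rw [(hr₁.set (x := 11) (by norm_num) i).eval_third (i := u) (j := i)
        (by simp [Expr.eval, Store.set_var, u1]) (by simp [Expr.eval, Store.set_var]),
        code_ne_zero])
  have hr₂ := hr₁.sameUpTo hsame (by simp)
  have y2 := (hsame.2 5 (by simp)).trans y1
  have z2 := (hsame.2 6 (by simp)).trans z1
  have u2 := (hsame.2 7 (by simp)).trans u1
  generalize (count₁ (entry 5 (.var 7) (.var 11))).exec σ₁ = σ₂ at *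
  obtain ⟨hsame, -, f3⟩ := hr₂.count₂
    (e := Expr.eq (entry 7 (.var 11) (.var 12)) (succ (.var 7))) rfl
    (Q := fun i j => s.owner i j = some u) (fun i j => by
      rw [Expr.eval_eq_ne_zero, ((hr₂.set (x := 11) (by norm_num) i).set (x := 12) (by norm_num)
        j).eval_owner (i := i) (j := j)
        (by simp [Expr.eval, Store.set_var]) (by simp [Expr.eval, Store.set_var])]
      simp [Expr.eval, Store.set_var, u2, succ, code_eq_succ])
  have hr₃ := hr₂.sameUpTo hsame (by simp)
  have y3 := (hsame.2 5 (by simp)).trans y2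
  have z3 := (hsame.2 6 (by simp)).trans z2
  have u3 := (hsame.2 7 (by simp)).trans u2
  generalize (count₂ (Expr.eq (entry 7 (.var 11) (.var 12)) (succ (.var 7)))).exec σ₂ = σ₃ at *
  obtain ⟨hsame, -, f4⟩ := hr₃.count₂
    (e := Expr.conj (edge (.var 7) (.var 11)) (Expr.conj (edge (.var 7) (.var 12))
      (Expr.conj (entry 5 (.var 11) (.var 12))
      (Expr.lt (entry 6 (.var 11) (.var 12)) (entry 6 (.var 5) (.var 6)))))) rfl
    (Q := fun i j => G.graph.Adj u i ∧ G.graph.Adj u j ∧ s.third i j ≠ none ∧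
      s.price i j < s.price y z) (fun i j => by
      have hr' := (hr₃.set (x := 11) (by norm_num) i).set (x := 12) (by norm_num) j
      generalize hτ : (σ₃.set 11 i).set 12 j = τ at *
      have v5 : (Expr.var 5).eval τ = y := by simp [← hτ, Store.set_var, y3, Expr.eval]
      have v6 : (Expr.var 6).eval τ = z := by simp [← hτ, Store.set_var, z3, Expr.eval]
      have v7 : (Expr.var 7).eval τ = u := by simp [← hτ, Store.set_var, u3, Expr.eval]
      have v11 : (Expr.var 11).eval τ = i := by simp [← hτ, Store.set_var, Expr.eval]
      have v12 : (Expr.var 12).eval τ = j := by simp [← hτ, Store.set_var, Expr.eval]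
      simp only [Expr.eval_conj_ne_zero, Expr.eval_lt_ne_zero, hr'.eval_edge v7 v11,
        hr'.eval_edge v7 v12, hr'.eval_third v11 v12, hr'.eval_price v11 v12,
        hr'.eval_price v5 v6, code_ne_zero])
  have hr₄ := hr₃.sameUpTo hsame (by simp)
  have y4 : (Expr.var 5).eval _ = _ := (hsame.2 5 (by simp)).trans y3
  have z4 : (Expr.var 6).eval _ = _ := (hsame.2 6 (by simp)).trans z3
  have u4 : (Expr.var 7).eval _ = _ := (hsame.2 7 (by simp)).trans u3
  generalize (count₂ (Expr.conj (edge (.var 7) (.var 11)) (Expr.conj (edge (.var 7) (.var 12))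
      (Expr.conj (entry 5 (.var 11) (.var 12))
      (Expr.lt (entry 6 (.var 11) (.var 12)) (entry 6 (.var 5) (.var 6))))))).exec σ₃ = σ₄ at *
  have hflag : σ₄.var 10 = 0 ↔ (∀ x, s.third u x = none) ∧ (∀ a b, s.owner a b ≠ some u) ∧
      (∀ a b, G.graph.Adj u a → G.graph.Adj u b → s.third a b ≠ none →
        s.price y z ≤ s.price a b) := by
    rw [f4, f3, f2, f1]
    simp [Finset.sum_eq_zero_iff, and_assoc]
  have hcond : (Expr.conj (Expr.neg (.var 10)) (Expr.conj (edge (.var 7) (.var 5))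
      (Expr.conj (edge (.var 7) (.var 6)) (Expr.conj (entry 5 (.var 5) (.var 6))
        (Expr.lt (entry 6 (.var 5) (.var 6)) (.var 0)))))).eval σ₄ ≠ 0 ↔
      s.CanBid G.graph u y z := by
    simp only [Expr.eval_conj_ne_zero, Expr.eval_neg_ne_zero, Expr.eval_lt_ne_zero,
      hr₄.eval_edge u4 y4, hr₄.eval_edge u4 z4, hr₄.eval_third y4 z4, hr₄.eval_price y4 z4,
      code_ne_zero, Expr.eval, hflag, Core.CanBid, hr₄.size, and_assoc]
  rw [Code.exec]
  simp only [hcond]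
  split_ifs with h
  · obtain ⟨h1, h2⟩ := hs.bid h
    refine ⟨_, ?_, h1, fun hn => absurd h hn, fun _ => h2⟩
    have k1 := hr₄.put_price y4 z4 (e := succ (entry 6 (.var 5) (.var 6)))
      (v := s.price y z + 1) (by simp [succ, Expr.eval, hr₄.eval_price y4 z4])
    have k2 := k1.put_price (e₁ := .var 6) (e₂ := .var 5) (e := entry 6 (.var 5) (.var 6)) z4 y4
      (v := s.price y z + 1)
      (by rw [k1.eval_price (e₁ := .var 5) (e₂ := .var 6) y4 z4]; simp [upd])
    have k3 := k2.put_owner (e₁ := .var 5) (e₂ := .var 6) (e := succ (.var 7)) y4 z4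
      (v := some u) (congrArg (· + 1) u4)
    exact k3.put_owner (e₁ := .var 6) (e₂ := .var 5) (e := succ (.var 7)) z4 y4 (v := some u)
      (congrArg (· + 1) u4)
  · exact ⟨s, hr₄, hs, fun _ => rfl, fun hp => absurd hp h⟩

/-! #### The whole search -/

def sweep : Code :=
  .rep 5 .head (.rep 6 .head (.rep 7 .head addStep)) ;;
  .rep 5 .head (.rep 6 .head replaceStep) ;;
  .rep 5 .head (.rep 6 .head (.rep 7 .head bidStep))

/-- Three nested loops make `(n * n + 1) ^ 3` sweeps, which is the strict upper bound for the
potential. -/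
def search : Code := .rep 13 .first (.rep 14 .first (.rep 15 .first sweep))

theorem searches_sweep (G : Graph) : Searches G sweep (fun _ => True) (fun s =>
    (∃ a b c, s.CanAdd G.graph a b c) ∨ (∃ y z, s.CanReplace y z) ∨
      ∃ y z u, s.CanBid G.graph u y z) := by
  refine Searches.seq ?_ (Searches.seq ?_ ?_)
  · refine Searches.rep (by norm_num) (fun _ _ => id) (fun _ => id) rfl fun a => ?_
    refine Searches.rep (by norm_num) (fun σ v h => ?_) (fun σ h => ?_) rfl fun b => ?_
    · simpa [Store.set_var] using h
    · rwa [exec_var rfl]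
    refine Searches.rep (by norm_num) (fun σ v h => ?_) (fun σ h => ?_) rfl fun c => ?_
    · simpa [Store.set_var] using h
    · rwa [exec_var rfl, exec_var rfl]
    exact searches_addStep G a b c
  · refine Searches.rep (by norm_num) (fun _ _ => id) (fun _ => id) rfl fun a => ?_
    refine Searches.rep (by norm_num) (fun σ v h => ?_) (fun σ h => ?_) rfl fun b => ?_
    · simpa [Store.set_var] using h
    · rwa [exec_var rfl]
    exact searches_replaceStep G a b
  · refine Searches.rep (by norm_num) (fun _ _ => id) (fun _ => id) rfl fun a => ?_
    refine Searches.rep (by norm_num) (fun σ v h => ?_) (fun σ h => ?_) rfl fun b => ?_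
    · simpa [Store.set_var] using h
    · rwa [exec_var rfl]
    refine Searches.rep (by norm_num) (fun σ v h => ?_) (fun σ h => ?_) rfl fun c => ?_
    · simpa [Store.set_var] using h
    · rwa [exec_var rfl, exec_var rfl]
    exact searches_bidStep G a b c

theorem Rep.search {G : Graph} {σ : Store} {s : Core G.n} (hr : Rep G σ s)
    (hs : s.Valid G.graph) :
    ∃ s', Rep G (search.exec σ) s' ∧ s'.Valid G.graph ∧ s'.Stuck G.graph := by
  obtain ⟨s', h1, h2, -, h3⟩ := ((((searches_sweep G).converges.rep (x := 15) (by norm_num)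
    rfl).rep (x := 14) (by norm_num) rfl).rep (x := 13) (by norm_num) rfl) σ s hr hs
  refine ⟨s', h1, h2, ?_⟩
  rcases h3 with h3 | h3
  · simp only [not_or, not_exists] at h3
    exact ⟨h3.1, fun u y z => h3.2.2 y z u, h3.2.1⟩
  · have := s'.potential_lt h2
    have e : (G.n * G.n + 1) * ((G.n * G.n + 1) * ((G.n * G.n + 1) * 1)) =
      (G.n * G.n + 1) ^ 3 := by ring
    omega

/-! ### Level, size of the packing, and kept vertices -/

section

variable {n : ℕ}

open Classical in
/-- The vertices of the kernel, in increasing order; there are none if the packing is larger than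
the parameter. -/
noncomputable def keptList (s : Core n) (l k : ℕ) : List (Fin n) :=
  (List.finRange n).filter fun v => s.Kept l v ∧ s.packed.length ≤ k

theorem mem_keptList {s : Core n} {l k : ℕ} {v : Fin n} :
    v ∈ keptList s l k ↔ s.Kept l v ∧ s.packed.length ≤ k := by
  simp [keptList]

theorem nodup_keptList (s : Core n) (l k : ℕ) : (keptList s l k).Nodup :=
  (List.nodup_finRange n).filter _

open Classical in
theorem length_keptList_le {G : SimpleGraph (Fin n)} {s : Core n} {l k : ℕ} (h : s.Valid G)
    (hs : s.Stuck G) : (keptList s l k).length ≤ 4 * k := by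
  by_cases hk : s.packed.length ≤ k
  · rw [← List.toFinset_card_of_nodup (nodup_keptList s l k)]
    refine (card_le_card (t := univ.filter fun v => s.Kept l v) fun v hv => ?_).trans
      ((h.card_kept_le hs.no_replace).trans (by omega))
    simpa using (mem_keptList.1 (List.mem_toFinset.1 hv)).1
  · have : keptList s l k = [] := by simp [keptList, hk]
    simp [this]

end

/-- Variable 20 runs through the multiples of `n` by repeated addition. -/
def fillRows : Code :=
  .rep 5 .head (.put 8 (.var 5) (.var 20) ;; .assign 20 (.add (.var 20) (.get 0 (.const 0))))

open Expr in
def findLevel : Code :=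
  .rep 13 .first (.assign 10 (.const 0) ;; count₂ (eq (entry 6 (.var 11) (.var 12)) (succ (.var 13))) ;;
    .ite (neg (.var 10)) (.assign 16 (succ (.var 13))) .skip)

-- A table entry is the third vertex plus one, hence the successor on the left; an empty entry is
-- zero and fails the test.
open Expr in
def isPacked (x y : ℕ) : Expr :=
  conj (lt (.var x) (.var y)) (lt (succ (.var y)) (entry 5 (.var x) (.var y)))

def countPacked : Code :=
  .assign 10 (.const 0) ;; count₂ (isPacked 11 12) ;; .assign 17 (.var 10)

open Expr in
def listKept : Code :=
  .rep 13 .head (.assign 10 (.const 0) ;; count₁ (entry 5 (.var 13) (.var 11)) ;;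
    count₂ (conj (eq (entry 7 (.var 11) (.var 12)) (succ (.var 13)))
      (neg (lt (.var 16) (entry 6 (.var 11) (.var 12))))) ;;
    .ite (conj (.var 10) (neg (.sub (.var 17) (.get 1 (.const 0)))))
      (.put 9 (.var 18) (.var 13) ;; .assign 18 (succ (.var 18))) .skip)

def analyze : Code := fillRows ;; search ;; findLevel ;; countPacked ;; listKept

/-- The result of `analyze`. -/
structure Analyzed (G : Graph) (k : ℕ) (s : Core G.n) (l : ℕ) (σ : Store) : Prop where
  rep : Rep G σ s
  level : σ.var 16 = l
  packed : σ.var 17 = s.packed.length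
  param : σ.arr 1 0 = k
  kept : (keptList s l k).map Fin.val = (List.range (σ.var 18)).map (σ.arr 9)

theorem Analyzed.agrees {G : Graph} {k : ℕ} {s : Core G.n} {l : ℕ} {σ τ : Store}
    (h : Analyzed G k s l σ) (hst : σ.Agrees τ) : Analyzed G k s l τ := by
  obtain ⟨⟨h1, h2, h3, h4, h5, h6⟩, h7, h8, h9, h10⟩ := h
  refine ⟨⟨?_, ?_, ?_, ?_, ?_, ?_⟩, ?_, ?_, ?_, ?_⟩
  · rwa [← (hst 0 (by norm_num)).2]
  · rwa [← (hst 0 (by norm_num)).1]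
  · rwa [← (hst 8 (by norm_num)).2]
  · rwa [← (hst 5 (by norm_num)).2]
  · rwa [← (hst 6 (by norm_num)).2]
  · rwa [← (hst 7 (by norm_num)).2]
  · rwa [← (hst 16 (by norm_num)).1]
  · rwa [← (hst 17 (by norm_num)).1]
  · rwa [← (hst 1 (by norm_num)).2]
  · rwa [← (hst 18 (by norm_num)).1, ← (hst 9 (by norm_num)).2]

theorem init_var_eq_zero {ws : List (List ℕ)} {x : ℕ} (h : ws.length ≤ x) :
    (init ws).var x = 0 := by
  simp only [init, List.getD_eq_default _ _ h, List.length_nil]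

theorem init_arr_eq_zero {ws : List (List ℕ)} {a : ℕ} (h : ws.length ≤ a) (j : ℕ) :
    (init ws).arr a j = 0 := by
  simp only [init, List.getD_eq_default _ _ h, List.getD_nil]

theorem rep_fillRows (G : Graph) (w : List ℕ) :
    Rep G (fillRows.exec (init [encodeGraph G, w])) (Core.restart fun _ _ => none) := by
  set σ := init [encodeGraph G, w] with hσ
  have hin : ∀ j, σ.arr 0 j = (encodeGraph G).getD j 0 := fun j => by simp [hσ, init]
  have hhead : Bound.eval σ .head = G.n := by simp [hin, encodeGraph]
  have key := rep_induction (x := 5) (b := .head) (σ := σ)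
    (c := .put 8 (.var 5) (.var 20) ;; .assign 20 (.add (.var 20) (.get 0 (.const 0))))
    (fun m τ => (∀ j, τ.arr 0 j = (encodeGraph G).getD j 0) ∧ τ.var 20 = m * G.n ∧
      ∀ i < m, τ.arr 8 i = i * G.n) (fun τ => by simp [Code.exec, Store.set_var])
    ⟨hin, by rw [Store.set_var, if_neg (by norm_num), hσ, init_var_eq_zero (by simp), zero_mul],
      by simp⟩
    (fun i _ τ hi ⟨h1, h2, h3⟩ => ⟨h1, ?_, fun j hj => ?_⟩)
  · rw [hhead] at key
    have hzero : ∀ a, 5 ≤ a → ∀ j, σ.arr a j = 0 := fun a ha =>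
      init_arr_eq_zero (by simp only [List.length_cons, List.length_nil]; omega)
    have hfr : ∀ a, a ≠ 8 → (fillRows.exec σ).arr a = σ.arr a := fun a ha =>
      exec_arr (by simp [fillRows, Code.avoidsArr, ha]) σ
    refine ⟨key.1, ?_, fun i => key.2.2 i i.2, fun i j => ?_, fun i j => ?_, fun i j => ?_⟩
    · rw [exec_var rfl]
      simp [hσ, init, encodeGraph]
    · rw [hfr 5 (by norm_num), hzero 5 le_rfl]; rfl
    · rw [hfr 6 (by norm_num), hzero 6 (by norm_num)]; rfl
    · rw [hfr 7 (by norm_num), hzero 7 (by norm_num)]; rfl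
  · have h0 := h1 0
    simp only [encodeGraph, List.getD_cons_zero] at h0
    simp [Code.exec, Expr.eval, Store.set_var, h2, h0, Nat.succ_mul]
  · rcases Nat.lt_succ_iff_lt_or_eq.1 hj with hj | rfl
    · have hne : j ≠ i := by omega
      simpa [Code.exec, Expr.eval, hi, hne] using h3 j hj
    · simp [Code.exec, Expr.eval, hi, h2]

section

variable {G : Graph} {σ : Store} {s : Core G.n}

theorem Rep.isPacked (h : Rep G σ s) {x y : ℕ} {i j : Fin G.n} (hx : σ.var x = i)
    (hy : σ.var y = j) :
    (isPacked x y).eval σ ≠ 0 ↔ i < j ∧ ∃ c, s.third i j = some c ∧ j < c := by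
  simp only [TrianglePacking.isPacked, Expr.eval_conj_ne_zero, Expr.eval_lt_ne_zero,
    h.eval_third (e₁ := .var x) (e₂ := .var y) hx hy, succ, Expr.eval, hx, hy, Fin.lt_def]
  cases s.third i j <;> simp [code]

/-- The loop tries 1, …, `n * n + 1` and keeps the last value that is no price. `exists_level`
excludes that none is found and the variable remains zero. -/
theorem Rep.findLevel (h : Rep G σ s) (h₀ : σ.var 16 = 0) :
    Rep G (findLevel.exec σ) s ∧ (findLevel.exec σ).var 16 ≤ G.n * G.n + 1 ∧
    ∀ a b, s.price a b ≠ (findLevel.exec σ).var 16 := by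
  classical
  have key := rep_induction (x := 13) (b := .first) (σ := σ)
    (c := .assign 10 (.const 0) ;;
      TrianglePacking.count₂ (Expr.eq (entry 6 (.var 11) (.var 12)) (succ (.var 13)));;
      .ite (Expr.neg (.var 10)) (.assign 16 (succ (.var 13))) .skip)
    (fun m τ => Rep G τ s ∧ τ.var 16 ≤ G.n * G.n + 1 ∧
      ((τ.var 16 = 0 ∧ ∀ i < m, ∃ a b, s.price a b = i + 1) ∨ ∀ a b, s.price a b ≠ τ.var 16))
    (fun τ => exec_var rfl τ)
    ⟨h.set (by norm_num) 0, by simp [Store.set_var, h₀], Or.inl ⟨by simp [Store.set_var, h₀],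
      by simp⟩⟩ ?_
  · obtain ⟨h1, h2, h3⟩ := key
    refine ⟨h1, h2, ?_⟩
    rcases h3 with ⟨-, h3⟩ | h3
    · obtain ⟨l, hl1, hl2, hl⟩ := s.exists_level
      obtain ⟨a, b, hab⟩ := h3 (l - 1) (by rw [Bound.eval_first, h.size]; omega)
      exact absurd (hab.trans (by omega)) (hl a b)
    · exact h3
  · rintro i hi τ hτ ⟨h1, h2, h3⟩
    rw [Bound.eval_first, h.size] at hi
    rw [Code.exec, Code.exec, Code.exec]
    have hr₁ := h1.set (x := 10) (by norm_num) ((Expr.const 0).eval τ)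
    obtain ⟨hsame, -, hf⟩ := hr₁.count₂
      (e := Expr.eq (entry 6 (.var 11) (.var 12)) (succ (.var 13))) rfl
      (Q := fun a b => s.price a b = i + 1) (fun a b => by
        have hr' := (hr₁.set (x := 11) (by norm_num) a).set (x := 12) (by norm_num) b
        rw [Expr.eval_eq_ne_zero, hr'.eval_price (e₁ := .var 11) (e₂ := .var 12) (i := a) (j := b)
          (by simp [Expr.eval, Store.set_var]) (by simp [Expr.eval, Store.set_var])]
        simp [Expr.eval, Store.set_var, succ, hτ])
    have hr₂ := hr₁.sameUpTo hsame (by simp)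
    have v13 := hsame.2 13 (by simp)
    have v16 := hsame.2 16 (by simp)
    generalize (TrianglePacking.count₂ (Expr.eq (entry 6 (.var 11) (.var 12)) (succ (.var 13)))).exec
      (τ.set 10 ((Expr.const 0).eval τ)) = ρ at *
    simp only [Store.set_var, Expr.eval] at v13 v16 hf
    simp only [hτ] at v13
    have hf' : ρ.var 10 = 0 ↔ ∀ a b, s.price a b ≠ i + 1 := by
      rw [hf]
      simp [Finset.sum_eq_zero_iff]
    rw [Code.exec]
    split_ifs with hc
    · rw [Expr.eval_neg_ne_zero] at hc
      have hc' := hf'.1 hc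
      have e16 : ((ρ.set 16 ((succ (.var 13)).eval ρ)).set 13 (i + 1)).var 16 = i + 1 := by
        simp [Store.set_var, succ, Expr.eval, v13]
      refine ⟨(hr₂.set (by norm_num) _).set (by norm_num) _, ?_, Or.inr ?_⟩
      · exact e16.le.trans (by omega)
      · intro a b
        exact fun he => hc' a b (he.trans e16)
    · rw [Expr.eval_neg_ne_zero] at hc
      have hc' : ∃ a b, s.price a b = i + 1 := by
        by_contra hne
        push Not at hne
        exact hc (hf'.2 hne)
      have e16 : ((Code.skip.exec ρ).set 13 (i + 1)).var 16 = τ.var 16 := by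
        simpa [Store.set_var, Code.exec] using v16
      refine ⟨hr₂.set (by norm_num) _, e16.le.trans h2, ?_⟩
      rw [e16]
      rcases h3 with ⟨h3, h4⟩ | h3
      · refine Or.inl ⟨h3, fun j hj => ?_⟩
        rcases Nat.lt_succ_iff_lt_or_eq.1 hj with hj | rfl
        · exact h4 j hj
        · exact hc'
      · exact Or.inr h3

theorem Rep.countPacked (h : Rep G σ s) :
    Rep G (countPacked.exec σ) s ∧ (countPacked.exec σ).var 17 = s.packed.length := by
  classical
  rw [TrianglePacking.countPacked, Code.exec, Code.exec, Code.exec, Code.exec]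
  have hr₁ := h.set (x := 10) (by norm_num) ((Expr.const 0).eval σ)
  obtain ⟨hsame, -, hf⟩ := hr₁.count₂ (e := TrianglePacking.isPacked 11 12) rfl
    (Q := fun i j => i < j ∧ ∃ c, s.third i j = some c ∧ j < c) (fun i j =>
      ((hr₁.set (x := 11) (by norm_num) i).set (x := 12) (by norm_num) j).isPacked
        (by simp [Store.set_var]) (by simp [Store.set_var]))
  refine ⟨(hr₁.sameUpTo hsame (by simp)).set (by norm_num) _, ?_⟩
  rw [Store.set_var, if_pos rfl]
  refine hf.trans ?_
  rw [Core.packed, length_scan]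
  simp only [Store.set_var, if_true, Expr.eval, zero_add]
  refine sum_congr rfl fun i _ => sum_congr rfl fun j _ => ?_
  cases ht : s.third i j with
  | none => simp
  | some c =>
    simp only [Option.some.injEq, exists_eq_left', Option.bind_some]
    split_ifs <;> simp

theorem Rep.listKept (h : Rep G σ s) {l k : ℕ} (h16 : σ.var 16 = l)
    (h17 : σ.var 17 = s.packed.length) (h1 : σ.arr 1 0 = k) (h18 : σ.var 18 = 0) :
    Analyzed G k s l (listKept.exec σ) := by
  classical
  let p : ℕ → Prop := fun i => ∃ hi : i < G.n, s.Kept l ⟨i, hi⟩ ∧ s.packed.length ≤ k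
  have key := rep_induction (x := 13) (b := .head) (σ := σ)
    (c := .assign 10 (.const 0) ;; TrianglePacking.count₁ (entry 5 (.var 13) (.var 11)) ;;
    TrianglePacking.count₂ (Expr.conj (Expr.eq (entry 7 (.var 11) (.var 12)) (succ (.var 13)))
      (Expr.neg (Expr.lt (.var 16) (entry 6 (.var 11) (.var 12))))) ;;
    .ite (Expr.conj (.var 10) (Expr.neg (.sub (.var 17) (.get 1 (.const 0)))))
      (.put 9 (.var 18) (.var 13) ;; .assign 18 (succ (.var 18))) .skip)
    (fun m τ => Rep G τ s ∧ τ.var 16 = l ∧ τ.var 17 = s.packed.length ∧ τ.arr 1 0 = k ∧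
      (List.range m).filter p = (List.range (τ.var 18)).map (τ.arr 9))
    (fun τ => exec_var rfl τ)
    ⟨h.set (by norm_num) 0, by simp [Store.set_var, h16], by simp [Store.set_var, h17], h1,
      by simp [Store.set_var, h18]⟩ ?_
  · obtain ⟨a1, a2, a3, a4, a5⟩ := key
    refine ⟨a1, a2, a3, a4, ?_⟩
    rw [h.head] at a5
    rw [TrianglePacking.listKept, ← a5, ← List.map_coe_finRange_eq_range, List.filter_map, keptList]
    congr 2
    funext v
    simp [p]
  · rintro i hi τ hτ ⟨a1, a2, a3, a4, a5⟩
    rw [h.head] at hi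
    rw [Code.exec, Code.exec, Code.exec, Code.exec]
    have hr₁ := a1.set (x := 10) (by norm_num) ((Expr.const 0).eval τ)
    have t1 : ∀ x, x ≠ 10 → (τ.set 10 ((Expr.const 0).eval τ)).var x = τ.var x := fun x hx => by
      simp [Store.set_var, hx]
    have f1 : (τ.set 10 ((Expr.const 0).eval τ)).var 10 = 0 := by simp [Store.set_var, Expr.eval]
    have r1 : (τ.set 10 ((Expr.const 0).eval τ)).arr = τ.arr := rfl
    generalize τ.set 10 ((Expr.const 0).eval τ) = τ₁ at *
    obtain ⟨hsame, -, hf⟩ := hr₁.count₁ (e := entry 5 (.var 13) (.var 11)) rfl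
      (Q := fun j => s.third ⟨i, hi⟩ j ≠ none) (fun j => by
        rw [(hr₁.set (x := 11) (by norm_num) j).eval_third (i := ⟨i, hi⟩) (j := j)
          (by simp [Expr.eval, Store.set_var, t1, hτ]) (by simp [Expr.eval, Store.set_var]),
          code_ne_zero])
    have hr₂ := hr₁.sameUpTo hsame (by simp)
    have t2 : ∀ x ∉ [10, 11], _ := fun x hx => (hsame.2 x hx).trans (t1 x (by simp_all))
    have r2 := hsame.1.trans r1
    generalize (TrianglePacking.count₁ (entry 5 (.var 13) (.var 11))).exec τ₁ = τ₂ at *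
    obtain ⟨hsame', -, hf'⟩ := hr₂.count₂
      (e := Expr.conj (Expr.eq (entry 7 (.var 11) (.var 12)) (succ (.var 13)))
        (Expr.neg (Expr.lt (.var 16) (entry 6 (.var 11) (.var 12))))) rfl
      (Q := fun a b => s.owner a b = some ⟨i, hi⟩ ∧ s.price a b ≤ l) (fun a b => by
        have hr' := (hr₂.set (x := 11) (by norm_num) a).set (x := 12) (by norm_num) b
        have e13 := t2 13 (by simp)
        have e16 := t2 16 (by simp)
        generalize hρ : (τ₂.set 11 a).set 12 b = ρ at *
        have v11 : (Expr.var 11).eval ρ = a := by simp [← hρ, Store.set_var, Expr.eval]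
        have v12 : (Expr.var 12).eval ρ = b := by simp [← hρ, Store.set_var, Expr.eval]
        have v13 : ρ.var 13 = i := by simp [← hρ, Store.set_var, e13, hτ]
        have v16 : ρ.var 16 = l := by simp [← hρ, Store.set_var, e16, a2]
        have hlt := (Expr.eval_lt_ne_zero ρ (.var 16) (entry 6 (.var 11) (.var 12))).not
        rw [ne_eq, not_not] at hlt
        rw [Expr.eval_conj_ne_zero, Expr.eval_eq_ne_zero, Expr.eval_neg_ne_zero, hlt,
          hr'.eval_owner v11 v12, hr'.eval_price v11 v12]
        simp only [succ, Expr.eval, v13, v16, not_lt]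
        rw [← code_eq_succ])
    have hr₃ := hr₂.sameUpTo hsame' (by simp)
    have t3 : ∀ x ∉ [10, 11, 12], _ := fun x hx => (hsame'.2 x hx).trans (t2 x (by simp_all))
    have r3 := hsame'.1.trans r2
    generalize (TrianglePacking.count₂ (Expr.conj (Expr.eq (entry 7 (.var 11) (.var 12)) (succ (.var 13)))
        (Expr.neg (Expr.lt (.var 16) (entry 6 (.var 11) (.var 12)))))).exec τ₂ = τ₃ at *
    have e13 := (t3 13 (by simp)).trans hτ
    have e16 := (t3 16 (by simp)).trans a2
    have e17 := (t3 17 (by simp)).trans a3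
    have e18 := t3 18 (by simp)
    have hkept : τ₃.var 10 ≠ 0 ↔ s.Kept l ⟨i, hi⟩ := by
      rw [hf', hf, f1, zero_add, ← Nat.pos_iff_ne_zero, Nat.add_pos_iff_pos_or_pos,
        Nat.pos_iff_ne_zero, Nat.pos_iff_ne_zero, ne_eq, ne_eq, Finset.sum_eq_zero_iff,
        Finset.sum_eq_zero_iff]
      simp [Core.Kept, Finset.sum_eq_zero_iff]
    have hcond : (Expr.conj (.var 10) (Expr.neg (.sub (.var 17) (.get 1 (.const 0))))).eval τ₃ ≠ 0 ↔
        p i := by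
      rw [Expr.eval_conj_ne_zero, Expr.eval_neg_ne_zero]
      simp only [Expr.eval, hkept, e17, r3, a4, p, hi, exists_true_left, Nat.sub_eq_zero_iff_le]
    rw [List.range_succ, List.filter_append, a5, Code.exec]
    by_cases hp : p i
    · rw [if_pos (hcond.2 hp)]
      refine ⟨?_, ?_, ?_, ?_, ?_⟩
      · refine Rep.set ?_ (by norm_num) _
        refine Rep.set ?_ (by norm_num) _
        exact ⟨hr₃.input, hr₃.size, hr₃.row, hr₃.third, hr₃.price, hr₃.owner⟩
      · simp [Code.exec, Store.set_var, e16]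
      · simp [Code.exec, Store.set_var, e17]
      · simp [Code.exec, r3, a4]
      · have hv : ((((Code.put 9 (.var 18) (.var 13)) ;; .assign 18 (succ (.var 18))).exec τ₃).set 13
            (i + 1)).var 18 = τ.var 18 + 1 := by
          simp [Code.exec, Store.set_var, succ, Expr.eval, e18]
        rw [hv, List.range_succ, List.map_append]
        congr 1
        · refine List.map_congr_left fun j hj => ?_
          have hne : j ≠ τ.var 18 := by
            have := List.mem_range.1 hj
            omega
          simp [Code.exec, Expr.eval, e18, hne, r3]
        · simp [Code.exec, Expr.eval, e18, e13, hp]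
    · rw [if_neg (fun hc => hp (hcond.1 hc))]
      refine ⟨hr₃.set (by norm_num) _, ?_, ?_, ?_, ?_⟩
      · simp [Code.exec, Store.set_var, e16]
      · simp [Code.exec, Store.set_var, e17]
      · simp [Code.exec, r3, a4]
      · simp [Code.exec, Store.set_var, e18, r3, hp]

end

theorem wf_analyze : analyze.wf = true := by decide

theorem ignores_analyze : analyze.ignores = true := by decide

theorem silent_analyze : analyze.silent = true := by decide

/-- The state and the level are whatever the program has computed; only the listed properties
matter. The reduction is later defined from them by choice, so it is computed by the program by
construction. -/
theorem exists_analyzed (G : Graph) (k : ℕ) :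
    ∃ s l, s.Valid G.graph ∧ s.Stuck G.graph ∧ l ≤ G.n * G.n + 1 ∧ (∀ a b, s.price a b ≠ l) ∧
      Analyzed G k s l (analyze.exec (init [encodeGraph G, [k]])) := by
  have h₀ := rep_fillRows G [k]
  obtain ⟨s, h1, h2, h3⟩ := h₀.search (Core.valid_restart ⟨by simp, by simp, by simp⟩)
  have hv : ∀ x, 5 ≤ x → (init [encodeGraph G, [k]]).var x = 0 := fun x hx =>
    init_var_eq_zero (by simp only [List.length_cons, List.length_nil]; omega)
  obtain ⟨h4, h5, h6⟩ := h1.findLevel (by rw [exec_var rfl, exec_var rfl, hv 16 (by norm_num)])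
  obtain ⟨h7, h8⟩ := h4.countPacked
  refine ⟨s, _, h2, h3, h5, h6, h7.listKept ?_ h8 ?_ ?_⟩
  · rw [exec_var rfl]
  · rw [exec_arr rfl, exec_arr rfl, exec_arr rfl, exec_arr rfl]
    simp [init]
  · rw [exec_var rfl, exec_var rfl, exec_var rfl, exec_var rfl, hv 18 (by norm_num)]

/-! ### The kernel -/

section

variable {n m : ℕ}

/-- Apply `f` to the three vertices of a triple. -/
def mapTriple {α β : Type*} (f : α → β) (t : α × α × α) : β × β × β := (f t.1, f t.2.1, f t.2.2)

theorem vset_mapTriple (f : Fin m → Fin n) (t : Fin m × Fin m × Fin m) :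
    vset (mapTriple f t) = (vset t).image f := by
  simp [vset, mapTriple, image_insert]

theorem isPackingList_map {f : Fin m → Fin n} (hf : Function.Injective f)
    (H : SimpleGraph (Fin n)) (L : List (Fin m × Fin m × Fin m)) :
    IsPackingList H (L.map (mapTriple f)) ↔ IsPackingList (H.comap f) L := by
  have hd : ∀ t t' : Fin m × Fin m × Fin m,
      EdgeDisjoint (mapTriple f t) (mapTriple f t') ↔ EdgeDisjoint t t' := by
    intro t t'
    simp only [EdgeDisjoint, vset_mapTriple, forall_mem_image, hf.mem_finset_image, hf.eq_iff]
  constructor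
  · rintro ⟨h1, h2⟩
    refine ⟨fun t ht => ?_, ?_⟩
    · simpa [mapTriple] using h1 _ (List.mem_map_of_mem ht)
    · rw [List.pairwise_map] at h2
      exact h2.imp fun h => (hd _ _).1 h
  · rintro ⟨h1, h2⟩
    refine ⟨fun t ht => ?_, ?_⟩
    · obtain ⟨t', ht', rfl⟩ := List.mem_map.1 ht
      simpa [mapTriple] using h1 t' ht'
    · rw [List.pairwise_map]
      exact h2.imp fun h => (hd _ _).2 h

/-- The subgraph of `H` induced by the vertices in the list `K`. -/
def inducedGraph (H : SimpleGraph (Fin n)) (K : List (Fin n)) : Graph := ⟨K.length, H.comap K.get⟩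

end

/-- The solution for the given graph made from a solution for the kernel. -/
noncomputable def liftTriples {n : ℕ} (s : Core n) (l k : ℕ) (t : List (ℕ × ℕ × ℕ)) :
    List (ℕ × ℕ × ℕ) :=
  if s.packed.length ≤ k then
    -- The default 0 is never used when `t` is feasible, since its entries are then vertices of the
    -- kernel.
    t.map (mapTriple fun j => ((keptList s l k).map Fin.val).getD j 0) ++ (s.crown l).map toTriple
  else s.packed.map toTriple

/-! ### Output -/

def listTriples (e e₁ e₂ e₃ : Expr) : Code :=
  .rep 5 .head (.rep 6 .head (.ite e (.emit e₁ ;; .emit e₂ ;; .emit e₃) .skip))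

theorem encodeTriples_append (s t : List (ℕ × ℕ × ℕ)) :
    encodeTriples (s ++ t) = encodeTriples s ++ encodeTriples t := by
  simp [encodeTriples]

theorem encodeTriples_map (f : ℕ → ℕ) (s : List (ℕ × ℕ × ℕ)) :
    encodeTriples (s.map (mapTriple f)) = (encodeTriples s).map f := by
  simp [encodeTriples, List.flatMap_map, List.map_flatMap, mapTriple]

theorem flatMap_range {α : Type*} (n : ℕ) (f : ℕ → List α) :
    (List.range n).flatMap f = (List.finRange n).flatMap fun i : Fin n => f i := by
  rw [← List.map_coe_finRange_eq_range, List.flatMap_map]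

theorem encodeTriples_scan {n : ℕ} (g : Fin n → Fin n → Option (Fin n × Fin n × Fin n)) :
    encodeTriples ((scan g).map toTriple) = (List.finRange n).flatMap fun i =>
      (List.finRange n).flatMap fun j => encodeTriples ((g i j).toList.map toTriple) := by
  simp [encodeTriples, scan, List.map_flatMap, List.flatMap_assoc]

theorem Rep.listTriples {G : Graph} {σ : Store} {s : Core G.n} (h : Rep G σ s)
    {e e₁ e₂ e₃ : Expr} {g : Fin G.n → Fin G.n → Option (Fin G.n × Fin G.n × Fin G.n)}
    (hg : ∀ i j : Fin G.n, ∀ τ, τ = (σ.set 5 i).set 6 j → (if e.eval τ ≠ 0 then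
      [e₁.eval τ, e₂.eval τ, e₃.eval τ] else []) = encodeTriples ((g i j).toList.map toTriple)) :
    ((listTriples e e₁ e₂ e₃).exec σ).out = σ.out ++ encodeTriples ((scan g).map toTriple) := by
  have key := (((((lists_emit (e := e₁)).seq ((lists_emit (e := e₂)).seq
    (lists_emit (e := e₃)))).when (e := e) (by simp)).rep (x := 6) (b := .head) (by norm_num)
    (by simp) (by simp)).rep (x := 5) (b := .head) (by norm_num) (by simp) (by simp)).2 σ
  refine key.2.trans ?_
  rw [encodeTriples_scan]
  beta_reduce
  rw [h.head, flatMap_range]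
  congr 2
  funext i
  rw [(h.set (x := 5) (by norm_num) i).head, flatMap_range]
  congr 1
  funext j
  exact hg i j _ rfl

-- Loops can run only up to `n`, so the tests against variable 18 cut them down to the number of
-- kernel vertices.
open Expr in
def emitKernel : Code :=
  .emit (.get 1 (.const 0)) ;; .emit (.var 18) ;;
  .rep 5 .head (.ite (lt (.var 5) (.var 18)) (.rep 6 .head (.ite (lt (.var 6) (.var 18))
    (.emit (conj (edge (.get 9 (.var 5)) (.get 9 (.var 6)))
      (neg (lt (.var 16) (entry 6 (.get 9 (.var 5)) (.get 9 (.var 6))))))) .skip)) .skip)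

open Expr in
def emitLift : Code :=
  .ite (.sub (.var 17) (.get 1 (.const 0)))
    (listTriples (isPacked 5 6) (.var 5) (.var 6) (pred (entry 5 (.var 5) (.var 6))))
    (.rep 5 .fifth (.emit (.get 9 (.get 4 (.var 5)))) ;;
      listTriples (conj (lt (.var 5) (.var 6)) (lt (.var 16) (entry 6 (.var 5) (.var 6))))
        (pred (entry 7 (.var 5) (.var 6))) (.var 5) (.var 6))

theorem flatMap_range_ite {α : Type*} {m n : ℕ} (h : m ≤ n) (f : ℕ → List α) :
    ((List.range n).flatMap fun i => if i < m then f i else []) = (List.range m).flatMap f := by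
  obtain ⟨k, rfl⟩ := Nat.exists_eq_add_of_le h
  rw [List.range_add, List.flatMap_append, List.flatMap_map]
  have h2 : ((List.range k).flatMap fun i => if m + i < m then f (m + i) else []) = [] := by
    simp
  rw [h2, List.append_nil]
  refine List.flatMap_congr fun i hi => ?_
  rw [if_pos (List.mem_range.1 hi)]

open Classical in
theorem encodeGraph_eq (H : Graph) : encodeGraph H = H.n :: (List.finRange H.n).flatMap fun i =>
    (List.finRange H.n).flatMap fun j => [if H.graph.Adj i j then 1 else 0] := by
  simp only [encodeGraph, List.ofFn_mul, divNat_index, modNat_index, List.ofFn_eq_map,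
    ← List.map_eq_flatMap]
  rfl

namespace Analyzed

variable {G : Graph} {k : ℕ} {s : Core G.n} {l : ℕ} {σ : Store}

theorem var_eq (h : Analyzed G k s l σ) : σ.var 18 = (keptList s l k).length := by
  have := congrArg List.length h.kept
  simpa using this.symm

theorem get_eq (h : Analyzed G k s l σ) (i : Fin (keptList s l k).length) :
    σ.arr 9 i = ((keptList s l k).get i : Fin G.n) := by
  have hi : (i : ℕ) < ((keptList s l k).map Fin.val).length := by simp
  have h1 := List.getElem_of_eq h.kept hi
  simpa using h1.symm

theorem emitKernel (h : Analyzed G k s l σ) (hs : s.Valid G.graph) (ho : σ.out = []) :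
    (emitKernel.exec σ).out =
      k :: encodeGraph (inducedGraph (s.residual G.graph l) (keptList s l k)) := by
  classical
  have key := ((((((lists_emit (e := Expr.conj (edge (.get 9 (.var 5)) (.get 9 (.var 6)))
      (Expr.neg (Expr.lt (.var 16) (entry 6 (.get 9 (.var 5)) (.get 9 (.var 6))))))).when
      (e := Expr.lt (.var 6) (.var 18)) (by simp)).rep (x := 6) (b := .head) (by norm_num)
      (by simp) (by simp)).when (e := Expr.lt (.var 5) (.var 18)) (by simp; rfl)).rep (x := 5)
      (b := .head) (by norm_num) (by simp) (by simp)).2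
      { σ with out := [k, σ.var 18] }).2
  rw [TrianglePacking.emitKernel, Code.exec, Code.exec, Code.exec, Code.exec]
  simp only [Expr.eval, ho, h.param]
  refine key.trans ?_
  rw [encodeGraph_eq]
  have hlen : (keptList s l k).length ≤ G.n := by
    simpa using (nodup_keptList s l k).length_le_card
  have hr : Rep G { σ with out := [k, σ.var 18] } s := h.rep.congr rfl rfl
  have h9 := h.get_eq
  have h18 := h.var_eq
  have t9 : ({ σ with out := [k, σ.var 18] } : Store).arr 9 = σ.arr 9 := rfl
  have t16 : ({ σ with out := [k, σ.var 18] } : Store).var 16 = l := h.level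
  have t18 : ({ σ with out := [k, σ.var 18] } : Store).var 18 = (keptList s l k).length := h18
  have tout : ({ σ with out := [k, σ.var 18] } : Store).out = [k, (keptList s l k).length] := by
    rw [← h18]
  generalize ({ σ with out := [k, σ.var 18] } : Store) = τ at *
  simp only [Expr.eval_lt_ne_zero, hr.head, (hr.set (x := 5) (by norm_num) _).head, tout]
  have e5 : ∀ i, (Expr.var 5).eval (τ.set 5 i) = i := fun i => by simp [Expr.eval, Store.set_var]
  have e5' : ∀ i, (Expr.var 18).eval (τ.set 5 i) = (keptList s l k).length := fun i => by
    simp [Expr.eval, Store.set_var, t18]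
  have e6 : ∀ i j, (Expr.var 6).eval ((τ.set 5 i).set 6 j) = j := fun i j => by
    simp [Expr.eval, Store.set_var]
  have e6' : ∀ i j, (Expr.var 18).eval ((τ.set 5 i).set 6 j) = (keptList s l k).length :=
    fun i j => by simp [Expr.eval, Store.set_var, t18]
  simp only [e5, e5', e6, e6']
  rw [flatMap_range_ite hlen, flatMap_range]
  simp only [flatMap_range_ite hlen, flatMap_range]
  rw [List.cons_append, List.cons_append, List.nil_append]
  congr 2
  refine List.flatMap_congr fun i _ => List.flatMap_congr fun j _ => ?_
  have hr' := (hr.set (x := 5) (by norm_num) i).set (x := 6) (by norm_num) j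
  have v5 : (Expr.get 9 (.var 5)).eval ((τ.set 5 i).set 6 j) = (keptList s l k).get i := by
    rw [← h9 i, ← t9]
    simp [Expr.eval, Store.set_var]
  have v6 : (Expr.get 9 (.var 6)).eval ((τ.set 5 i).set 6 j) = (keptList s l k).get j := by
    rw [← h9 j, ← t9]
    simp [Expr.eval, Store.set_var]
  have v16 : (Expr.var 16).eval ((τ.set 5 i).set 6 j) = l := by
    simp [Expr.eval, Store.set_var, t16]
  generalize (τ.set 5 i).set 6 j = ρ at *
  congr 1
  have hp := hr'.eval_price v5 v6
  have ha := hr'.eval_edge v5 v6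
  have ha' := hr'.eval_edge_le v5 v6
  have hn : (Expr.neg (Expr.lt (.var 16) (entry 6 (.get 9 (.var 5)) (.get 9 (.var 6))))).eval ρ =
      1 - (s.price ((keptList s l k).get i) ((keptList s l k).get j) - l) := by
    simp only [Expr.neg, Expr.lt, Expr.eval, ← hp, ← v16]
  rw [Expr.eval_conj, hn]
  have hadj : (inducedGraph (s.residual G.graph l) (keptList s l k)).graph.Adj i j ↔
      G.graph.Adj ((keptList s l k).get i) ((keptList s l k).get j) ∧
        s.price ((keptList s l k).get i) ((keptList s l k).get j) ≤ l := by
    have := hs.price_symm ((keptList s l k).get i) ((keptList s l k).get j)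
    change (_ ∧ _ ∧ _) ↔ _
    rw [← this, and_self]
  rw [← ha] at hadj
  split_ifs with hif
  · rw [hadj] at hif
    omega
  · rw [hadj] at hif
    omega

theorem emitLift (h : Analyzed G k s l σ) (hs : s.Valid G.graph) (ho : σ.out = [])
    {t : List (ℕ × ℕ × ℕ)} (h4 : ∀ j, σ.arr 4 j = (encodeTriples t).getD j 0)
    (h4' : σ.var 4 = (encodeTriples t).length)
    (ht : ∀ v ∈ encodeTriples t, v < (keptList s l k).length) :
    (emitLift.exec σ).out = encodeTriples (liftTriples s l k t) := by
  rw [TrianglePacking.emitLift, Code.exec]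
  have hcond : (Expr.sub (.var 17) (.get 1 (.const 0))).eval σ ≠ 0 ↔ ¬ s.packed.length ≤ k := by
    simp only [Expr.eval, h.packed, h.param]
    omega
  rw [liftTriples]
  split_ifs with h1 h2 h2
  · exact absurd h2 (hcond.1 h1)
  · rw [h.rep.listTriples (g := fun a b => (s.third a b).bind fun c =>
      if a < b ∧ b < c then some (a, b, c) else none), ho]
    · rfl
    rintro i j τ rfl
    have hr := (h.rep.set (x := 5) (by norm_num) i).set (x := 6) (by norm_num) j
    have v5 : ((σ.set 5 i).set 6 j).var 5 = i := by simp [Store.set_var]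
    have v6 : ((σ.set 5 i).set 6 j).var 6 = j := by simp [Store.set_var]
    have hp := hr.isPacked v5 v6
    generalize (σ.set 5 i).set 6 j = τ at *
    simp only [hp, pred, Expr.eval, hr.eval_third (e₁ := .var 5) (e₂ := .var 6) v5 v6, v5, v6]
    cases s.third i j with
    | none => simp [encodeTriples]
    | some c =>
      by_cases hc : i < j ∧ j < c
      · simp [hc, encodeTriples, toTriple, code]
      · simp [hc, encodeTriples]
  · have key := ((lists_emit (e := .get 9 (.get 4 (.var 5)))).rep (x := 5) (b := .fifth)
      (by norm_num) (by simp) (by simp)).2 σ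
    rw [Code.exec]
    have hr := h.rep.sameUpTo key.1 (by simp)
    have v16 := (key.1.2 16 (by simp)).trans h.level
    have hout := key.2
    generalize (Code.rep 5 .fifth (.emit (.get 9 (.get 4 (.var 5))))).exec σ = ρ at *
    rw [hr.listTriples (g := fun a b => (s.owner a b).bind fun u =>
      if a < b ∧ l < s.price a b then some (u, a, b) else none), hout, encodeTriples_append,
      encodeTriples_map, ho]
    · congr 1
      simp only [Bound.eval_fifth, h4', Expr.eval, Store.set_arr, Store.set_var, if_true, h4,
        List.nil_append]
      rw [← List.map_eq_flatMap]
      apply List.ext_getElem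
      · simp
      · intro i hi hi'
        simp only [List.length_map] at hi'
        simp only [List.getElem_map, List.getElem_range, List.getD_eq_getElem _ _ hi']
        have hlt := ht _ (List.getElem_mem hi')
        rw [h.get_eq ⟨_, hlt⟩]
        simp [hlt]
    · rintro i j τ rfl
      have hr' := (hr.set (x := 5) (by norm_num) i).set (x := 6) (by norm_num) j
      have v5 : ((ρ.set 5 i).set 6 j).var 5 = i := by simp [Store.set_var]
      have v6 : ((ρ.set 5 i).set 6 j).var 6 = j := by simp [Store.set_var]
      have v16' : ((ρ.set 5 i).set 6 j).var 16 = l := by simp [Store.set_var, v16]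
      generalize (ρ.set 5 i).set 6 j = τ at *
      simp only [Expr.eval_conj_ne_zero, Expr.eval_lt_ne_zero, pred]
      simp only [Expr.eval, hr'.eval_price (e₁ := .var 5) (e₂ := .var 6) v5 v6,
        hr'.eval_owner (e₁ := .var 5) (e₂ := .var 6) v5 v6, v5, v6, v16']
      cases ho : s.owner i j with
      | none => simp [encodeTriples, hs.price_eq_zero ho]
      | some c =>
        by_cases hc : i < j ∧ l < s.price i j
        · simp [hc, encodeTriples, toTriple, code]
        · simp [hc, encodeTriples]
  · exact absurd (hcond.2 h2) (not_not.2 (not_not.1 h1))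

end Analyzed

/-! ### Values and optima -/

open Classical in
theorem value_eq (G : Graph) (k : ℕ) (t : List (ℕ × ℕ × ℕ)) :
    problem.bySolutionSize.value G k t =
      if ∃ L, L.map toTriple = t ∧ IsPackingList G.graph L then ((min t.length (k + 1) : ℕ) : EReal)
      else ⊥ := by
  simp only [MaxProblem.bySolutionSize, problem, exists_packing_iff]
  split_ifs with h
  · rcases le_total t.length (k + 1) with hk | hk
    · rw [min_eq_left hk, min_eq_left]
      exact_mod_cast hk
    · rw [min_eq_right hk, min_eq_right]
      · push_cast
        rfl
      · exact_mod_cast hk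
  · simp

theorem value_map (G : Graph) (k : ℕ) {L : List (Fin G.n × Fin G.n × Fin G.n)}
    (h : IsPackingList G.graph L) :
    problem.bySolutionSize.value G k (L.map toTriple) = ((min L.length (k + 1) : ℕ) : EReal) := by
  rw [value_eq, if_pos ⟨L, rfl, h⟩, List.length_map]

theorem isSolution_iff (G : Graph) (k : ℕ) (t : List (ℕ × ℕ × ℕ)) :
    problem.bySolutionSize.IsSolution G k t ↔
      ∃ L, L.map toTriple = t ∧ IsPackingList G.graph L := by
  constructor
  · intro h
    by_contra hn
    exact h (by rw [value_eq, if_neg hn])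
  · rintro ⟨L, rfl, hL⟩
    exact fun hb => EReal.natCast_ne_bot _ ((value_map G k hL).symm.trans hb)

/-- Packings have bounded length, so a longest one exists, and truncation at `k + 1` is monotone. -/
theorem exists_opt (G : Graph) (k : ℕ) : ∃ L, IsPackingList G.graph L ∧
    (∀ L', IsPackingList G.graph L' → L'.length ≤ L.length) ∧
    problem.bySolutionSize.opt G k = ((min L.length (k + 1) : ℕ) : EReal) := by
  obtain ⟨L, hL, hmax⟩ : ∃ L, IsPackingList G.graph L ∧
      ∀ L', IsPackingList G.graph L' → L'.length ≤ L.length := by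
    classical
    have hex : ∃ m, ∃ L, IsPackingList G.graph L ∧ L.length = m := ⟨0, [], .nil _, rfl⟩
    have hb : ∀ m, (∃ L, IsPackingList G.graph L ∧ L.length = m) → m ≤ G.n * (G.n * G.n) := by
      rintro _ ⟨L, hL, rfl⟩
      exact hL.length_le
    obtain ⟨L, hL, hlen⟩ := Nat.findGreatest_spec
      (P := fun m => ∃ L, IsPackingList G.graph L ∧ L.length = m) (hb _ hex.choose_spec) hex.choose_spec
    refine ⟨L, hL, fun L' hL' => ?_⟩
    rw [hlen]
    exact Nat.le_findGreatest hL'.length_le ⟨L', hL', rfl⟩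
  refine ⟨L, hL, hmax, le_antisymm (iSup_le fun t => ?_) ?_⟩
  · refine (value_eq G k t).trans_le ?_
    split_ifs with h
    · obtain ⟨L', rfl, hL'⟩ := h
      have := hmax L' hL'
      rw [List.length_map]
      exact_mod_cast min_le_min_right _ this
    · exact bot_le
  · rw [← value_map G k hL]
    exact le_iSup (fun t => problem.bySolutionSize.value G k t) _

/-- The comparison of the quotients after cross-multiplication. If `o' = 0`, the kernel ratio counts
as 1 and the lifted solution must be optimal, which `h₀` provides. -/
theorem approxRatio_le {v o v' o' : ℕ} (hv : v ≤ o) (hv' : v' ≤ o') (h₀ : o' = 0 → v = o)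
    (h : v' * o ≤ v * o') :
    ((1 / 1 : ℝ) : EReal) * approxRatio (v' : EReal) (o' : EReal) ≤
      approxRatio (v : EReal) (o : EReal) := by
  have key : ∀ a b : ℕ, a ≤ b → approxRatio (a : EReal) (b : EReal) =
      ((if b = 0 then 1 else (a : ℝ) / b : ℝ) : EReal) := by
    intro a b hab
    rw [approxRatio]
    by_cases hb : b = 0
    · have ha : a = 0 := by omega
      simp [ha, hb]
    · rw [if_neg (by simp [hb]), if_neg hb, EReal.coe_div]
      rfl
  rw [key v o hv, key v' o' hv', div_one, EReal.coe_one, one_mul, EReal.coe_le_coe_iff]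
  split_ifs with h1 h2 h2
  · exact le_rfl
  · have : (o : ℝ) ≠ 0 := by exact_mod_cast h2
    rw [h₀ h1, div_self this]
  · exact div_le_one_of_le₀ (by exact_mod_cast hv') (by positivity)
  · rw [div_le_div_iff₀ (by positivity) (by positivity)]
    exact_mod_cast h

/-! ### Correctness of the kernel -/

section

variable {G : Graph} {k l : ℕ} {s : Core G.n}

theorem isPackingList_lift (h : s.Valid G.graph) (hk : s.packed.length ≤ k)
    {L : List (Fin (keptList s l k).length × Fin (keptList s l k).length ×
      Fin (keptList s l k).length)}
    (hL : IsPackingList ((s.residual G.graph l).comap (keptList s l k).get) L) :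
    ∃ L', IsPackingList G.graph L' ∧ L'.map toTriple = liftTriples s l k (L.map toTriple) ∧
      L'.length = L.length + (s.crown l).length := by
  have hinj : Function.Injective (keptList s l k).get :=
    List.nodup_iff_injective_get.1 (nodup_keptList s l k)
  refine ⟨L.map (mapTriple (keptList s l k).get) ++ s.crown l,
    h.isPackingList_append_crown ((isPackingList_map hinj _ L).2 hL) fun t ht v hv => ?_, ?_,
    by simp⟩
  · obtain ⟨t, -, rfl⟩ := List.mem_map.1 ht
    rw [vset_mapTriple, mem_image] at hv
    obtain ⟨i, -, rfl⟩ := hv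
    exact (mem_keptList.1 (List.get_mem _ i)).1
  · rw [liftTriples, if_pos hk, List.map_append, List.map_map, List.map_map]
    congr 1
    refine List.map_congr_left fun t _ => ?_
    simp [mapTriple, toTriple]

theorem exists_isPackingList_residual (h : s.Valid G.graph) (hs : s.Stuck G.graph)
    (hl : l ≤ G.n * G.n + 1) (hlev : ∀ a b, s.price a b ≠ l) (hk : s.packed.length ≤ k)
    {L : List (Fin G.n × Fin G.n × Fin G.n)} (hL : IsPackingList G.graph L) :
    ∃ L', IsPackingList ((s.residual G.graph l).comap (keptList s l k).get) L' ∧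
      L.length ≤ L'.length + (s.crown l).length := by
  have hinj : Function.Injective (keptList s l k).get :=
    List.nodup_iff_injective_get.1 (nodup_keptList s l k)
  obtain ⟨L', h1, h2, h3⟩ := h.exists_residual hs hl hlev hL
  have hget : ∀ v, s.Kept l v → ∃ i, (keptList s l k).get i = v := fun v hv =>
    List.mem_iff_get.1 (mem_keptList.2 ⟨hv, hk⟩)
  have hr : L' ∈ Set.range (List.map (mapTriple (keptList s l k).get)) := by
    rw [Set.range_list_map]
    intro t ht
    obtain ⟨i, hi⟩ := hget t.1 (h2 t ht _ (by simp [vset]))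
    obtain ⟨i', hi'⟩ := hget t.2.1 (h2 t ht _ (by simp [vset]))
    obtain ⟨i'', hi''⟩ := hget t.2.2 (h2 t ht _ (by simp [vset]))
    exact ⟨(i, i', i''), by rw [mapTriple, hi, hi', hi'']⟩
  obtain ⟨L'', rfl⟩ := hr
  exact ⟨L'', (isPackingList_map hinj _ L'').1 h1, by simpa using h3⟩

theorem approxRatio_lift_le (h : s.Valid G.graph) (hs : s.Stuck G.graph)
    (hl : l ≤ G.n * G.n + 1) (hlev : ∀ a b, s.price a b ≠ l) (t : List (ℕ × ℕ × ℕ))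
    (ht : problem.bySolutionSize.IsSolution
      (inducedGraph (s.residual G.graph l) (keptList s l k)) k t) :
    problem.bySolutionSize.IsSolution G k (liftTriples s l k t) ∧
      ((1 / 1 : ℝ) : EReal) * approxRatio
        (problem.bySolutionSize.value (inducedGraph (s.residual G.graph l) (keptList s l k)) k t)
        (problem.bySolutionSize.opt (inducedGraph (s.residual G.graph l) (keptList s l k)) k) ≤
      approxRatio (problem.bySolutionSize.value G k (liftTriples s l k t))
        (problem.bySolutionSize.opt G k) := by
  obtain ⟨L, rfl, hL⟩ := (isSolution_iff _ _ _).1 ht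
  obtain ⟨M', hM', hmax', ho'⟩ := exists_opt (inducedGraph (s.residual G.graph l) (keptList s l k)) k
  obtain ⟨M, hM, hmax, ho⟩ := exists_opt G k
  rw [value_map _ _ hL, ho', ho]
  have hLM' := hmax' L hL
  by_cases hk : s.packed.length ≤ k
  · obtain ⟨L', h1, h2, h3⟩ := isPackingList_lift h hk hL
    obtain ⟨N, h4, h5⟩ := exists_isPackingList_residual h hs hl hlev hk hM
    have h6 : N.length ≤ M'.length := hmax' N h4
    replace h3 : L'.length = L.length + (s.crown l).length := h3
    have h7 := hmax L' h1
    replace h2 : L'.map toTriple = liftTriples s l k (L.map toTriple) := h2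
    rw [← h2, value_map _ _ h1]
    refine ⟨(isSolution_iff _ _ _).2 ⟨L', rfl, h1⟩, ?_⟩
    refine approxRatio_le (min_le_min_right _ h7) (min_le_min_right _ hLM') (fun h0 => ?_) ?_
    · omega
    -- A lifted solution of length at least `k + 1` has the largest possible value. Otherwise, with
    -- c the size of the crown and no truncation in the kernel, the claim is |L|(|M'| + c) ≤ (|L| +
    -- c)|M'|, which holds as |L| ≤ |M'|.
    · rcases le_total (k + 1) L'.length with hc | hc
      · rw [min_eq_right hc, min_eq_right (hc.trans h7), mul_comm]
        exact Nat.mul_le_mul_left _ (min_le_min_right _ hLM')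
      · rw [min_eq_left hc, min_eq_left (by omega : L.length ≤ k + 1)]
        rcases le_total (k + 1) M'.length with hm | hm
        · rw [min_eq_right hm]
          exact Nat.mul_le_mul (by omega) (min_le_right _ _)
        · rw [min_eq_left hm]
          refine (Nat.mul_le_mul_left _ ((min_le_left _ _).trans
            (h5.trans (Nat.add_le_add_right h6 _)))).trans ?_
          rw [h3, mul_add, add_mul]
          refine Nat.add_le_add_left ?_ _
          rw [mul_comm]
          exact Nat.mul_le_mul_left _ hLM'
  -- The local search has found more than `k` triangles: the kernel has no vertices, and the packing
  -- already has the truncated value `k + 1`.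
  · have hp := h.isPackingList_packed
    have h7 := hmax _ hp
    have hnil : (keptList s l k).length = 0 := by simp [keptList, hk]
    have h0 : M'.length = 0 := by
      have : M'.length ≤ (keptList s l k).length * _ := hM'.length_le
      rw [hnil, zero_mul] at this
      omega
    rw [liftTriples, if_neg hk, value_map _ _ hp]
    refine ⟨(isSolution_iff _ _ _).2 ⟨_, rfl, hp⟩, ?_⟩
    refine approxRatio_le (min_le_min_right _ h7) (min_le_min_right _ hLM') (fun _ => ?_) ?_
    · omega
    · have : L.length = 0 := by omega
      simp [this]

end

/-! ### Running times -/

theorem length_le_wordSize (w : List ℕ) : w.length ≤ wordSize w := by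
  have := List.card_nsmul_le_sum (w.map fun a => a.size + 1) 1 (by simp)
  rwa [List.length_map, smul_eq_mul, mul_one] at this

theorem head_le_wordSize (G : Graph) : G.n ≤ wordSize (encodeGraph G) := by
  refine le_trans ?_ (length_le_wordSize _)
  simp only [encodeGraph, List.length_cons, List.length_ofFn]
  nlinarith

theorem outputsWithin {c : Code} (h : c.wf = true) {ws : List (List ℕ)} {o : List ℕ} {N : ℕ}
    (hN : ∀ b : Bound, b.eval (init ws) ≤ N) (ho : (c.exec (init ws)).out = o) :
    OutputsWithin c.compile ws o (c.time.eval N) := by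
  obtain ⟨t, ht, hr⟩ := run_compile h (init ws) hN
  exact ⟨_, t, hr, ho, ht⟩

theorem agrees_init (w₀ w₁ w₂ w₃ w₄ : List ℕ) :
    (init [w₀, w₁]).Agrees (init [w₀, w₁, w₂, w₃, w₄]) := by
  intro x hx
  match x, hx with
  | 0, _ => exact ⟨rfl, rfl⟩
  | 1, _ => exact ⟨rfl, rfl⟩
  | 2, hx => omega
  | 3, hx => omega
  | 4, hx => omega
  | x + 5, _ => exact ⟨rfl, rfl⟩

end TrianglePacking

open TrianglePacking RAM RAM.Code in
theorem mainTheorem9 :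
    TrianglePacking.problem.bySolutionSize.HasApproxKernel 1
      TrianglePacking.Graph.n (fun k => 4 * k) := by
  -- The final state of the analysis for each input defines both the reduction and the lifting.
  choose s l hs using exists_analyzed
  refine ⟨fun G k => (inducedGraph ((s G k).residual G.graph (l G k))
    (keptList (s G k) (l G k) k), k), fun G k t => liftTriples (s G k) (l G k) k t,
    ⟨(analyze ;; emitKernel).compile, (analyze ;; emitKernel).time, fun G k => ?_⟩,
    ⟨(analyze ;; emitLift).compile, (analyze ;; emitLift).time, fun G k G' k' t hr ht => ?_⟩,
    fun G k G' k' hr => ?_⟩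
  · obtain ⟨h1, -, -, -, h2⟩ := hs G k
    refine outputsWithin (by decide) (fun b => ?_) ?_
    · refine le_trans ?_ (Nat.le_add_right _ _)
      cases b with
      | head => exact head_le_wordSize G
      | first => exact length_le_wordSize _
      | fifth => exact Nat.zero_le _
    · rw [Code.exec]
      exact h2.emitKernel h1 (by rw [exec_out silent_analyze]; rfl)
  · obtain ⟨rfl, rfl⟩ := Prod.mk.inj hr
    obtain ⟨h1, -, -, -, h2⟩ := hs G k
    obtain ⟨L, rfl, -⟩ := (isSolution_iff _ _ _).1 ht
    refine outputsWithin (by decide) (fun b => ?_) ?_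
    · have e1 : wordSize (encodeGraph G) = problem.bySolutionSize.instSize G := rfl
      have e2 : wordSize (encodeTriples (L.map toTriple)) =
        problem.bySolutionSize.solSize (L.map toTriple) := rfl
      cases b with
      | head => exact (head_le_wordSize G).trans (by omega)
      | first => exact (length_le_wordSize (encodeGraph G)).trans (by omega)
      | fifth => exact (length_le_wordSize (encodeTriples (L.map toTriple))).trans (by omega)
    · rw [Code.exec]
      -- The rerun in the lifting program sees the same first two words and ignores the others, so
      -- it reproduces the tables of the reduction.
      refine (h2.agrees ((agrees_init _ _ _ _ _).exec wf_analyze ignores_analyze)).emitLift h1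
        (by rw [exec_out silent_analyze]; rfl) (fun j => ?_) ?_ fun v hv => ?_
      · rw [exec_arr (by decide)]
        rfl
      · rw [exec_var (by decide)]
        rfl
      · simp only [encodeTriples, List.mem_flatMap, List.mem_map] at hv
        obtain ⟨_, ⟨t, -, rfl⟩, hv⟩ := hv
        simp only [toTriple, List.mem_cons, List.not_mem_nil, or_false] at hv
        rcases hv with rfl | rfl | rfl
        exacts [t.1.2, t.2.1.2, t.2.2.2]
  · obtain ⟨rfl, rfl⟩ := Prod.mk.inj hr
    obtain ⟨h1, h2, h3, h4, -⟩ := hs G k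
    exact ⟨length_keptList_le h1 h2, Nat.le_mul_of_pos_left k (by norm_num), fun t ht => approxRatio_lift_le h1 h2 h3 h4 t ht⟩
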